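/- **Setting.** Let $V=\mathbb R^3$; identify $V^*$ with $\mathbb R^3$ by the dual basis, so that $\mathbf P(V^*)$ is the space of lines of $\mathbf P(V)$. The flag variety is $\mathscr F=\{(x,X)\in\mathbf P(V)\times\mathbf P(V^*)\mid x\in X\}$, and $\mathrm{PGL}(3,\mathbb R)$ acts on points, lines and flags. *Boxes.* For distinct points $x,y$ let $xy$ be the line through them, and for distinct lines $X,Y$ let $XY$ be their intersection point. An overmarked box $\Theta=(p,q,r,s;t,b)$ consists of three distinct points $p,q,t$ of a line $T$ and three distinct points $r,s,b$ of a line $B\ne T$, none of the six being $TB$; put $P=ts$, $Q=tr$, $R=bq$, $S=bp$. Let $j\Theta=(q,p,s,r;t,b)$; a marked box $[\Theta]$ is a class modulo $j$. The box is convex if $p,q$ separate $t,TB$ on $T$ and $r,s$ separate $b,TB$ on $B$. Then $\mathrm{int}[\Theta]$ denotes the interior of the convex quadrilateral with vertices $p,q,r,s$ in this cyclic order whose side $pq$ contains $t$ and whose side $rs$ contains $b$; the dual box $\Theta^*=(P,Q,R,S;T,B)$ is convex too, and $\mathrm{int}[\Theta^*]\subset\mathbf P(V^*)$ is defined in the same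 way. For $D\subset\mathbf P(V)$ let $D^\star\subset\mathbf P(V^*)$ be the set of lines that do not meet $\overline D$. Put $i(\Theta)=(s,r,p,q;b,t)$ and $\tau_1(\Theta)=(p,q,QR,PS;t,(pr)(qs))$. For $\lambda=(\varepsilon,\delta)\in\mathbb R^2$ let $\sigma_\lambda(\Theta)$ be the image of $\Theta$ under the projective transformation with matrix $$\begin{pmatrix}1&0&0\\0&e^{-\delta}\cosh\varepsilon&-\sinh\varepsilon\\0&-\sinh\varepsilon&e^{\delta}\cosh\varepsilon\end{pmatrix}$$ in a basis of $V$ for which $p=[-1:1:0]$, $q=[1:1:0]$, $r=[1:0:1]$, $s=[-1:0:1]$ (it is unique up to scaling). Put $i^\lambda=\sigma_\lambda i$, $\tau_1^\lambda=\sigma_\lambda\tau_1$; these act also on marked boxes. With $f(\varepsilon,\delta)=e^{-\delta}\cosh\varepsilon-\sinh\varepsilon-1$ let $\mathcal R=\{(\varepsilon,\delta)\mid f(\varepsilon,\delta)\ge0,\ f(\varepsilon,-\delta)\ge0\}$ and let $\mathcal R^\circ$ be its interior. *Groups and lamination.* In $\mathrm{PSL}(2,\mathbb R)$ let $I=\left(\begin{smallmatrix}0&1\\-1&0\end{smallmatrix}\right)$,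 $R=\left(\begin{smallmatrix}-1&1\\-1&0\end{smallmatrix}\right)$, and for $a>0$ let $R_*=h_aRh_a^{-1}$ with $h_a=\left(\begin{smallmatrix}\cosh a&\sinh a\\\sinh a&\cosh a\end{smallmatrix}\right)$. Let $\Gamma=\langle I,R_*\rangle$, let $\Gamma_o=\langle R_*,IR_*I\rangle$, and let $\Lambda\subset\partial\mathbb H^2=\mathbb R\cup\{\infty\}$ be the limit set of $\Gamma_o$. Let $e_0$ be the oriented geodesic $[\infty,0]$ from $\infty$ to $0$; the oriented leaves are the geodesics $ge_0$, $g\in\Gamma$. A labeling of the leaves for a convex box $\Theta$ assigns to each oriented leaf $\ell$ a marked box $[\Theta](\ell)$ such that $[\Theta](e_0)=[\Theta]$, $[\Theta](gIe_0)=i^\lambda[\Theta](ge_0)$ and $[\Theta](gR_*e_0)=i^\lambda\tau_1^\lambda[\Theta](ge_0)$ for all $g\in\Gamma$. Write $D_\ell=\mathrm{int}\,[\Theta](\ell)$ and $D^*_\ell=\mathrm{int}\,[\Theta](\ell)^*$, and let $\partial^+\ell$ be the open arc of $\partial\mathbb H^2$ to the left of $\ell$. **Proposition.** Let $a>0$,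 let $\Theta$ be a convex overmarked box and let $\lambda\in\mathcal R^\circ$. 1. There is exactly one homomorphism $\rho=\rho^\lambda_\Theta:\Gamma_o\to\mathrm{PGL}(3,\mathbb R)$ such that $\rho(R_*)$ maps $\Theta\mapsto j\varrho\Theta\mapsto\varrho^2\Theta\mapsto\Theta$ with $\varrho=i^\lambda\tau_1^\lambda$, and $\rho(IR_*I)$ maps $\Theta\mapsto j\varrho'\Theta\mapsto\varrho'^2\Theta\mapsto\Theta$ with $\varrho'=\tau_1^\lambda i^\lambda$. A labeling of the leaves exists, and for every labeling (given by representatives) all labels of leaves are convex overmarked boxes. 2. There is a continuous map $\Phi^\lambda=(\varphi_\lambda,\varphi_\lambda^*):\Lambda\to\mathscr F$ which is $\Gamma_o$-equivariant: $\gamma\Lambda\subseteq\Lambda$ and $\Phi^\lambda(\gamma\xi)=\rho(\gamma)\Phi^\lambda(\xi)$ for $\gamma\in\Gamma_o$, $\xi\in\Lambda$. For every labeling it has the properties 3 and 4. 3. There is a constant $C>1$ such that for all oriented leaves $\ell,\ell'$ with $\partial^+\ell'\subsetneq\partial^+\ell$: $\overline{D_{\ell'}}\subset D_\ell$ and the Hilbert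 metrics satisfy $d_{D_{\ell'}}\ge C\,d_{D_\ell}$ on $D_{\ell'}$; and $\overline{D_\ell^\star}\subset D_{\ell'}^\star$ and $d_{D_\ell^\star}\ge C\,d_{D_{\ell'}^\star}$ on $D_\ell^\star$. 4. For every oriented geodesic $c$ with tail $c_-$ and head $c_+$ in $\Lambda$, $$\bigcap_\ell D_\ell=\{\varphi_\lambda(c_+)\},\qquad \bigcap_\ell D_\ell^\star=\{\varphi_\lambda^*(c_-)\},\qquad \varphi^*_\lambda(c_-)\in\bigcap_\ell D_\ell^*,$$ where $\ell$ runs over the oriented leaves that $c$ crosses from the right to the left. -/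

import Mathlib

open scoped MatrixGroups LinearAlgebra.Projectivization UpperHalfPlane OnePoint

noncomputable section

namespace PappusAnosov

/-! ### The projective plane, its dual, and the flag variety

The three-dimensional real vector space `V` is `ℝ³`, and `V*` is identified with `ℝ³` through the
dual basis: `[X] ∈ P(V*)` is the line of all `[x] ∈ P(V)` with `x ⬝ᵥ X = 0`. -/

/-- The real projective plane; its points also serve as homogeneous coordinates of lines. -/
abbrev Plane : Type := ℙ ℝ (Fin 3 → ℝ)

/-- The quotient topology of the projective plane. -/
instance : TopologicalSpace Plane :=
  TopologicalSpace.coinduced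
    (fun v : {v : Fin 3 → ℝ // v ≠ 0} => Projectivization.mk ℝ v.1 v.2) inferInstance

/-- `v` is a nonzero vector spanning `x`, i.e. `x = [v]`. -/
def IsLift (v : Fin 3 → ℝ) (x : Plane) : Prop := ∃ h : v ≠ 0, Projectivization.mk ℝ v h = x

/-- The line through two distinct points, and the intersection point of two distinct lines. -/
abbrev join (x y : Plane) : Plane := Projectivization.cross x y

/-- The point `x` lies on the line `X`. -/
abbrev Incident (x X : Plane) : Prop := Projectivization.orthogonal x X

theorem scalar_smul_plane (u : ℝˣ) (x : Plane) :
    Matrix.GeneralLinearGroup.scalar (Fin 3) u • x = x := by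
  induction x using Projectivization.ind with
  | h v hv =>
    rw [Projectivization.smul_mk, Projectivization.mk_eq_mk_iff]
    refine ⟨u, ?_⟩
    rw [Units.smul_def, Units.smul_def, Matrix.smul_eq_mulVec,
      Matrix.GeneralLinearGroup.coe_scalar]
    ext k
    fin_cases k <;> simp

/-- The action of the projective transformations on the points of the plane. -/
instance : MulAction PGL(3, ℝ) Plane := Matrix.ProjGenLinGroup.mulActionOfGL scalar_smul_plane

/-- The inverse transpose. -/
def contragredientGL : GL (Fin 3) ℝ →* GL (Fin 3) ℝ where
  toFun g := ⟨(g⁻¹).1.transpose, g.1.transpose,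
    by rw [← Matrix.transpose_mul, ← Units.val_mul]; simp,
    by rw [← Matrix.transpose_mul, ← Units.val_mul]; simp⟩
  map_one' := by
    ext1
    change ((1 : GL (Fin 3) ℝ)⁻¹).1.transpose = 1
    simp
  map_mul' g h := by ext1; simp [Matrix.transpose_mul]

/-- The inverse transpose on `PGL(3, ℝ)`. -/
def contragredient : PGL(3, ℝ) →* PGL(3, ℝ) :=
  Matrix.ProjGenLinGroup.lift (Matrix.ProjGenLinGroup.mk.comp contragredientGL) (by
    ext u
    have h : contragredientGL (Matrix.GeneralLinearGroup.scalar (Fin 3) u) =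
        Matrix.GeneralLinearGroup.scalar (Fin 3) u⁻¹ := by
      ext1
      change ((Matrix.GeneralLinearGroup.scalar (Fin 3) u)⁻¹).1.transpose = _
      rw [← map_inv, Matrix.GeneralLinearGroup.coe_scalar]
      simp
    simp [h])

/-- The image of the line `X` under the projective transformation `g`. -/
def mapLine (g : PGL(3, ℝ)) (X : Plane) : Plane := contragredient g • X

theorem incident_map (g : PGL(3, ℝ)) (x X : Plane) (h : Incident x X) :
    Incident (g • x) (mapLine g X) := by
  induction g using Matrix.ProjGenLinGroup.induction_on with
  | mk g =>
    induction x using Projectivization.ind with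
    | h v hv =>
      induction X using Projectivization.ind with
      | h w hw =>
        change Projectivization.orthogonal (g • Projectivization.mk ℝ v hv)
          (contragredientGL g • Projectivization.mk ℝ w hw)
        rw [Projectivization.smul_mk, Projectivization.smul_mk, Projectivization.orthogonal_mk]
        have h' : v ⬝ᵥ w = 0 := h
        rw [Units.smul_def, Units.smul_def, Matrix.smul_eq_mulVec, Matrix.smul_eq_mulVec]
        change (g.1.mulVec v) ⬝ᵥ ((g⁻¹).1.transpose.mulVec w) = 0
        rw [Matrix.mulVec_transpose, dotProduct_comm, ← Matrix.dotProduct_mulVec,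
          Matrix.mulVec_mulVec, ← Units.val_mul]
        simp [dotProduct_comm, h']

/-- The flag variety: pairs of a point and a line through it. -/
abbrev Flag : Type := {f : Plane × Plane // Incident f.1 f.2}

/-- The action of a projective transformation on flags. -/
def mapFlag (g : PGL(3, ℝ)) (f : Flag) : Flag :=
  ⟨(g • f.1.1, mapLine g f.1.2), incident_map g f.1.1 f.1.2 f.2⟩

/-! ### Overmarked boxes -/

/-- The six points of an overmarked box. The six lines are determined by them, see below. -/
@[ext]
structure Box where
  p : Plane
  q : Plane
  r : Plane
  s : Plane
  t : Plane
  b : Plane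

namespace Box

def lineP (Θ : Box) : Plane := join Θ.t Θ.s
def lineQ (Θ : Box) : Plane := join Θ.t Θ.r
def lineR (Θ : Box) : Plane := join Θ.b Θ.q
def lineS (Θ : Box) : Plane := join Θ.b Θ.p
def lineT (Θ : Box) : Plane := join Θ.p Θ.q
def lineB (Θ : Box) : Plane := join Θ.r Θ.s

/-- The incidence relations of an overmarked box: `p, q, t` are distinct points of a line `T`,
`r, s, b` are distinct points of a line `B ≠ T`, and none of the six points is `T ∩ B`. -/
structure IsOvermarked (Θ : Box) : Prop where
  p_ne_q : Θ.p ≠ Θ.q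
  p_ne_t : Θ.p ≠ Θ.t
  q_ne_t : Θ.q ≠ Θ.t
  r_ne_s : Θ.r ≠ Θ.s
  r_ne_b : Θ.r ≠ Θ.b
  s_ne_b : Θ.s ≠ Θ.b
  t_mem : Incident Θ.t Θ.lineT
  b_mem : Incident Θ.b Θ.lineB
  T_ne_B : Θ.lineT ≠ Θ.lineB
  p_ne : join Θ.lineT Θ.lineB ≠ Θ.p
  q_ne : join Θ.lineT Θ.lineB ≠ Θ.q
  r_ne : join Θ.lineT Θ.lineB ≠ Θ.r
  s_ne : join Θ.lineT Θ.lineB ≠ Θ.s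
  t_ne : join Θ.lineT Θ.lineB ≠ Θ.t
  b_ne : join Θ.lineT Θ.lineB ≠ Θ.b

end Box

/-- The distinct points `x, y` of a projective line separate the points `z, w` of that line. -/
def Separates (x y z w : Plane) : Prop :=
  x ≠ y ∧ ∃ (u v : Fin 3 → ℝ) (k : ℝ), 0 < k ∧
    IsLift u x ∧ IsLift v y ∧ IsLift (u + v) z ∧ IsLift (u - k • v) w

namespace Box

/-- Convexity of an overmarked box. -/
def IsConvex (Θ : Box) : Prop :=
  Separates Θ.p Θ.q Θ.t (join Θ.lineT Θ.lineB) ∧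
    Separates Θ.r Θ.s Θ.b (join Θ.lineT Θ.lineB)

/-- The convex interior: the interior of the convex quadrilateral with vertices `p, q, r, s` in this
cyclic order whose side `pq` contains `t` and whose side `rs` contains `b`. The vertices have lifts
`v₁, v₂, v₃, v₄` such that `t`, `b` are spanned by positive combinations of `v₁, v₂` and of
`v₃, v₄`, the diagonals `v₁v₃` and `v₂v₄` cross, and the points of the interior are spanned by the
combinations of `v₁, v₂, v₃, v₄` with positive coefficients (absorbed into the lifts below). -/
def convexInterior (Θ : Box) : Set Plane :=
  {x | ∃ v₁ v₂ v₃ v₄ : Fin 3 → ℝ,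
    IsLift v₁ Θ.p ∧ IsLift v₂ Θ.q ∧ IsLift v₃ Θ.r ∧ IsLift v₄ Θ.s ∧
    (∃ k : ℝ, 0 < k ∧ IsLift (v₁ + k • v₂) Θ.t) ∧
    (∃ k : ℝ, 0 < k ∧ IsLift (v₃ + k • v₄) Θ.b) ∧
    (∃ k₁ k₂ k₃ k₄ : ℝ, 0 < k₁ ∧ 0 < k₂ ∧ 0 < k₃ ∧ 0 < k₄ ∧
      k₁ • v₁ + k₃ • v₃ = k₂ • v₂ + k₄ • v₄) ∧
    IsLift (v₁ + v₂ + v₃ + v₄) x}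

/-- The image of a box under a projective transformation. -/
def map (g : PGL(3, ℝ)) (Θ : Box) : Box :=
  ⟨g • Θ.p, g • Θ.q, g • Θ.r, g • Θ.s, g • Θ.t, g • Θ.b⟩

/-- The involution whose orbits are the marked boxes. -/
def j (Θ : Box) : Box := ⟨Θ.q, Θ.p, Θ.s, Θ.r, Θ.t, Θ.b⟩

/-- Two overmarked boxes define the same marked box. -/
def SameMarked (Θ Θ' : Box) : Prop := Θ = Θ' ∨ Θ = Θ'.j

/-- The dual box: its points are the lines `P, Q, R, S, T, B`, seen as points of the dual plane. -/
def dual (Θ : Box) : Box := ⟨Θ.lineP, Θ.lineQ, Θ.lineR, Θ.lineS, Θ.lineT, Θ.lineB⟩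

/-- The elementary transformation `i`. -/
def i (Θ : Box) : Box := ⟨Θ.s, Θ.r, Θ.p, Θ.q, Θ.b, Θ.t⟩

/-- The elementary transformation `τ₁`, given by the theorem of Pappus. -/
def tau1 (Θ : Box) : Box :=
  ⟨Θ.p, Θ.q, join Θ.lineQ Θ.lineR, join Θ.lineP Θ.lineS, Θ.t,
    join (join Θ.p Θ.r) (join Θ.q Θ.s)⟩

/-- The columns of `M` form a `Θ`-basis: in this basis `p = [-1 : 1 : 0]`, `q = [1 : 1 : 0]`,
`r = [1 : 0 : 1]` and `s = [-1 : 0 : 1]`. -/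
def IsBasis (Θ : Box) (M : GL (Fin 3) ℝ) : Prop :=
  IsLift (M.1.mulVec ![-1, 1, 0]) Θ.p ∧ IsLift (M.1.mulVec ![1, 1, 0]) Θ.q ∧
    IsLift (M.1.mulVec ![1, 0, 1]) Θ.r ∧ IsLift (M.1.mulVec ![-1, 0, 1]) Θ.s

end Box

/-- The matrix `Σ_(ε, δ)`, where `lam = (ε, δ)`. -/
def sigmaMatrix (lam : ℝ × ℝ) : GL (Fin 3) ℝ :=
  Matrix.GeneralLinearGroup.mkOfDetNeZero
    !![1, 0, 0;
       0, Real.exp (-lam.2) * Real.cosh lam.1, -Real.sinh lam.1;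
       0, -Real.sinh lam.1, Real.exp lam.2 * Real.cosh lam.1] (by
    have h : Real.exp (-lam.2) * Real.exp lam.2 = 1 := by rw [← Real.exp_add]; simp
    have h2 := Real.cosh_sq lam.1
    simp [Matrix.det_fin_three]
    nlinarith)

open scoped Classical in
/-- The transformation `σ_(ε, δ)`: apply the projective transformation whose matrix in a `Θ`-basis
is `Σ_(ε, δ)`. A `Θ`-basis of an overmarked box exists and is unique up to scaling. -/
def Box.sigma (lam : ℝ × ℝ) (Θ : Box) : Box :=
  if h : ∃ M : GL (Fin 3) ℝ, Θ.IsBasis M then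
    Θ.map (Matrix.ProjGenLinGroup.mk (h.choose * sigmaMatrix lam * h.choose⁻¹))
  else Θ

/-- `i^λ = σ_λ i`. -/
def Box.newI (lam : ℝ × ℝ) (Θ : Box) : Box := Θ.i.sigma lam

/-- `τ₁^λ = σ_λ τ₁`. -/
def Box.newTau1 (lam : ℝ × ℝ) (Θ : Box) : Box := Θ.tau1.sigma lam

/-- `f(ε, δ) = e^{-δ} cosh ε - sinh ε - 1`. -/
def regionFun (ε δ : ℝ) : ℝ := Real.exp (-δ) * Real.cosh ε - Real.sinh ε - 1

/-- The region `𝓡`. -/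
def region : Set (ℝ × ℝ) := {lam | 0 ≤ regionFun lam.1 lam.2 ∧ 0 ≤ regionFun lam.1 (-lam.2)}

/-! ### The Fuchsian groups and the lamination -/

theorem scalar_smul_onePoint (u : ℝˣ) (x : OnePoint ℝ) :
    Matrix.GeneralLinearGroup.scalar (Fin 2) u • x = x := by
  have hu : (u : ℝ) ≠ 0 := u.ne_zero
  induction x using OnePoint.rec with
  | infty => simp [OnePoint.smul_infty_eq_ite]
  | coe x => simp [OnePoint.smul_some_eq_ite, hu]

/-- The action of `PGL(2, ℝ)` on the boundary `ℝ ∪ {∞}` of the hyperbolic plane. -/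
instance : MulAction PGL(2, ℝ) (OnePoint ℝ) :=
  Matrix.ProjGenLinGroup.mulActionOfGL scalar_smul_onePoint

/-- The action of `PSL(2, ℝ)` on the boundary of the hyperbolic plane. -/
instance : MulAction PSL(2, ℝ) (OnePoint ℝ) :=
  MulAction.compHom _ (Matrix.ProjectiveSpecialLinearGroup.toPGL (n := Fin 2) (R := ℝ))

/-- The action of `PSL(2, ℝ)` on the upper half plane. -/
instance : MulAction PSL(2, ℝ) ℍ :=
  MulAction.compHom _ (Matrix.ProjectiveSpecialLinearGroup.toPGL (n := Fin 2) (R := ℝ))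

/-- The rotation `I` of order two about the point `i`. -/
def rotI : PSL(2, ℝ) :=
  QuotientGroup.mk (⟨!![0, 1; -1, 0], by simp [Matrix.det_fin_two]⟩ : SL(2, ℝ))

/-- The clockwise rotation of order three preserving the ideal triangle `0, 1, ∞`. -/
def rotR : PSL(2, ℝ) :=
  QuotientGroup.mk (⟨!![-1, 1; -1, 0], by simp [Matrix.det_fin_two]⟩ : SL(2, ℝ))

/-- The translation by `2a` along the geodesic from `-1` to `1`, which is perpendicular to
`[∞, 0]` at the point `i`. -/
def boost (a : ℝ) : PSL(2, ℝ) :=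
  QuotientGroup.mk (⟨!![Real.cosh a, Real.sinh a; Real.sinh a, Real.cosh a], by
    have := Real.cosh_sq a
    simp [Matrix.det_fin_two]
    nlinarith⟩ : SL(2, ℝ))

/-- The rotation `R_*`: for `a > 0` the clockwise rotation of order three whose center is pushed
away from `[∞, 0]` along the perpendicular at `i`, so that the images of `[∞, 0]` bound a
hyperideal triangle. -/
def rotRstar (a : ℝ) : PSL(2, ℝ) := boost a * rotR * (boost a)⁻¹

/-- The group `Γ = ⟨I, R_*⟩`. -/
def Gam (a : ℝ) : Subgroup PSL(2, ℝ) := Subgroup.closure {rotI, rotRstar a}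

/-- The subgroup `Γ_o = ⟨R_*, I R_* I⟩`. -/
def GamO (a : ℝ) : Subgroup PSL(2, ℝ) :=
  Subgroup.closure {rotRstar a, rotI * rotRstar a * rotI}

/-- The limit set: the boundary points that are limits, in the Riemann sphere, of points of the
orbit of `i`. -/
def limitSet (G : Subgroup PSL(2, ℝ)) : Set (OnePoint ℝ) :=
  {ξ | OnePoint.map Complex.ofReal ξ ∈
    closure {z : OnePoint ℂ | ∃ g ∈ G, z = (((g • UpperHalfPlane.I : ℍ) : ℂ) : OnePoint ℂ)}}

/-- An oriented geodesic of the hyperbolic plane, given by its endpoints. -/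
@[ext]
structure Geodesic where
  tail : OnePoint ℝ
  head : OnePoint ℝ
  ne : tail ≠ head

/-- The image of an oriented geodesic under an isometry. -/
def Geodesic.map (g : PSL(2, ℝ)) (c : Geodesic) : Geodesic :=
  ⟨g • c.tail, g • c.head, fun h => c.ne (smul_left_cancel g h)⟩

/-- The oriented geodesic `e₀ = [∞, 0]`. -/
def e0 : Geodesic := ⟨∞, ((0 : ℝ) : OnePoint ℝ), OnePoint.infty_ne_coe 0⟩

/-- The boundary points strictly to the left of an oriented geodesic. Those of `[∞, 0]` are the
positive real numbers. -/
def Geodesic.leftSide (c : Geodesic) : Set (OnePoint ℝ) :=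
  {ξ | ∃ g : PSL(2, ℝ), c = e0.map g ∧ ∃ x : ℝ, 0 < x ∧ ξ = g • (x : OnePoint ℝ)}

/-- The boundary points strictly to the right of an oriented geodesic. -/
def Geodesic.rightSide (c : Geodesic) : Set (OnePoint ℝ) :=
  {ξ | ∃ g : PSL(2, ℝ), c = e0.map g ∧ ∃ x : ℝ, x < 0 ∧ ξ = g • (x : OnePoint ℝ)}

/-- The geodesic `c` crosses the oriented geodesic `ℓ` from the right to the left. -/
def Geodesic.Crosses (c ℓ : Geodesic) : Prop := c.tail ∈ ℓ.rightSide ∧ c.head ∈ ℓ.leftSide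

/-- The oriented leaves of the lamination: the images of `e₀` under `Γ`. -/
def leaves (a : ℝ) : Set Geodesic := {ℓ | ∃ g ∈ Gam a, ℓ = e0.map g}

/-! ### Labels and representations -/

/-- `L` labels the oriented leaves by the orbit of the marked box `[Θ]` under the group generated by
`i^λ` and `i^λ τ₁^λ` (labels are marked boxes, given by representatives): `e₀` has the label `[Θ]`,
and applying the generator `I` (resp. `R_*`) of the `*`-action to a leaf changes the label by
`i^λ` (resp. `i^λ τ₁^λ`). The `*`-action commutes with the isometric action of `Γ`, and
`I * e₀ = I e₀`, `R_* * e₀ = R_* e₀`, so these generators map `g e₀` to `g I e₀` and `g R_* e₀`. -/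
structure IsLabeling (a : ℝ) (lam : ℝ × ℝ) (Θ : Box) (L : Geodesic → Box) : Prop where
  base : (L e0).SameMarked Θ
  stepI : ∀ g ∈ Gam a, (L (e0.map (g * rotI))).SameMarked ((L (e0.map g)).newI lam)
  stepR : ∀ g ∈ Gam a,
    (L (e0.map (g * rotRstar a))).SameMarked (((L (e0.map g)).newTau1 lam).newI lam)

/-- The projective transformation `A_Θ^λ`. -/
def IsA (lam : ℝ × ℝ) (Θ : Box) (A : PGL(3, ℝ)) : Prop :=
  let rho : Box → Box := fun Ψ => (Ψ.newTau1 lam).newI lam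
  Θ.map A = (rho Θ).j ∧ (rho Θ).j.map A = rho (rho Θ) ∧ (rho (rho Θ)).map A = Θ

/-- The projective transformation `B_Θ^λ`. -/
def IsB (lam : ℝ × ℝ) (Θ : Box) (B : PGL(3, ℝ)) : Prop :=
  let rho : Box → Box := fun Ψ => (Ψ.newI lam).newTau1 lam
  Θ.map B = (rho Θ).j ∧ (rho Θ).j.map B = rho (rho Θ) ∧ (rho (rho Θ)).map B = Θ

/-- The representation `ρ_Θ^λ` of `Γ_o`: it maps `R_*` to `A_Θ^λ` and `I R_* I` to `B_Θ^λ`. -/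
def IsNewRepresentation (a : ℝ) (lam : ℝ × ℝ) (Θ : Box) (ρ : GamO a →* PGL(3, ℝ)) : Prop :=
  IsA lam Θ (ρ ⟨rotRstar a, Subgroup.subset_closure (by simp)⟩) ∧
    IsB lam Θ (ρ ⟨rotI * rotRstar a * rotI, Subgroup.subset_closure (by simp)⟩)

/-! ### Convex domains -/

/-- The domain of the dual plane dual to `D`: the lines that do not meet the closure of `D`. -/
def dualDomain (D : Set Plane) : Set Plane := {X | ∀ x ∈ closure D, ¬ Incident x X}

/-- The Hilbert distance of a properly convex domain: for `x ≠ y` in `D` let `a, x, y, b` be in this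
order on the line `xy`, where `a, b` are on the boundary of `D`, and take half the logarithm of
the cross-ratio `[a : x : y : b]`. For lifts `u, v` of `x, y` such that the segment of `D` between
`x` and `y` is spanned by the positive combinations of `u` and `v`, one has `a = [u - α v]` and
`b = [v - β u]` with `α, β > 0`, `α β < 1`, and the cross-ratio is `1 / (α β)`.
(The set has one element if `x ≠ y` and is empty if `x = y`, which gives the distance `0`.) -/
def hilbertDist (D : Set Plane) (x y : Plane) : ℝ :=
  sSup {d : ℝ | x ≠ y ∧ ∃ (u v : Fin 3 → ℝ) (α β : ℝ), IsLift u x ∧ IsLift v y ∧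
    (∀ k : ℝ, 0 < k → ∀ z : Plane, IsLift (u + k • v) z → z ∈ D) ∧
    0 < α ∧ 0 < β ∧ α * β < 1 ∧
    (∃ w ∈ frontier D, IsLift (u - α • v) w) ∧ (∃ w ∈ frontier D, IsLift (v - β • u) w) ∧
    d = 1 / 2 * Real.log (1 / (α * β))}

/-- `D'` is relatively compact in `D` and its Hilbert distance is at least `C` times that of `D`. -/
def ExpandsInto (C : ℝ) (D' D : Set Plane) : Prop :=
  closure D' ⊆ D ∧ ∀ x ∈ D', ∀ y ∈ D', C * hilbertDist D x y ≤ hilbertDist D' x y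

end PappusAnosov

end

open PappusAnosov

/-!
Every convex overmarked box is the image of a standard box, with `p, q, r, s` at
`[∓1 : 1 : 0]`, `[±1 : 0 : 1]`, under a unique projective transformation (`exists_eq_std_map`,
`eq_of_std_map_eq`). In these coordinates `i`, `j`, `τ₁` and `σ_λ` act by multiplication on the
right with explicit matrices `N`, `J`, `K`, `Σ` (`std_map_newI`, `std_map_newTau1`), and the
relations needed for the group actions become matrix identities in `PGL(3, ℝ)`: `Σ N Σ = N` and
`(K N J)³ = 1`, the latter being a form of Pappus' theorem (`sigma_N_sigma`, `KNJ_cube`).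

**The group.** The elements `R_* I` and `R_*² I` are represented by matrices with positive entries,
so they map the closed arc `[0, ∞]` into its interior. A ping-pong argument gives normal forms for
the elements of `Γ`, whence `Γ` is the free product of `⟨I⟩` and `⟨R_*⟩`
(`exists_monoidHom_Gam`), and the leaves to the left of `[∞, 0]` are its images under the semigroup
generated by `R_* I` and `R_*² I` (`exists_eq_word`). A homomorphism from `Γ` to the wreath product
of `PGL(3, ℝ)` with the group of order two yields `ρ` and a labeling at once
(`exists_representation`); labelings are unique up to the choice of representatives
(`IsLabelMap.sameMarked`).

**Contraction.** Passing from a leaf to the next one on its left multiplies the frame of the label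
by `K Σ` or `L Σ`, where `L` belongs to the second Pappus transformation. For `λ` in the interior
of the region these matrices map the closed standard box into the open one
(`facet_sigma_pos`, `contracts_matK`, `contracts_matL`); equivalently, they express facets through
facets and vertices through vertices with positive coefficients. Only finitely many matrices occur,
because the coordinates of `t` and `b` are permuted up to sign, so the coefficients lie in a
fixed interval `[m, M]` with `m > 0`. Birkhoff's argument (`one_sub_affinity_le`) then shows that
`1 - α β` contracts by the factor `1 - (m / M)²`, where `- log (α β)` is twice the Hilbert distance.
This gives the expansion of the Hilbert metrics (`Refines.expandsInto`), and it shows that nested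
sequences of boxes and of dual domains shrink to points (`exists_iInter_projCone_eq`). The dual
domain of a box is the polyhedron whose facets are the vertices of the box (`dualDomain_facets`),
so both cases are the same.

**Limit maps.** Each point `ξ` of the limit set lies to the left of all leaves of a nested sequence
of consecutive leaves, and this sequence is cofinal among the leaves having `ξ` on their left
(`IsChain.exists_eq_mul_word`). Hence `φ(ξ)` is the point shared by all boxes of leaves with `ξ` on
the left, and `φ*(ξ)` the line shared by the dual domains of the same leaves with reversed
orientation (`IsShrinking.exists_isLimitMap`). Continuity, equivariance and incidence follow by
approximation along these sequences. The arcs of a nested sequence also shrink to points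
(`IsChain.eq_of_forall`), so the leaves separating two limit points determine `φ` and `φ*`
(`IsLimitMap.forall_mem_iff`).
-/

namespace PappusAnosov

open Matrix

/-! ### Lifts of points of the plane -/

theorem IsLift.ne_zero {v : Fin 3 → ℝ} {x : Plane} (h : IsLift v x) : v ≠ 0 := h.1

theorem isLift_mk {v : Fin 3 → ℝ} (h : v ≠ 0) : IsLift v (Projectivization.mk ℝ v h) := ⟨h, rfl⟩

theorem exists_isLift (x : Plane) : ∃ v, IsLift v x := by
  induction x using Projectivization.ind with
  | h v hv => exact ⟨v, hv, rfl⟩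

theorem IsLift.smul {v : Fin 3 → ℝ} {x : Plane} (h : IsLift v x) {c : ℝ} (hc : c ≠ 0) :
    IsLift (c • v) x := by
  obtain ⟨hv, rfl⟩ := h
  exact ⟨smul_ne_zero hc hv, (Projectivization.mk_eq_mk_iff' _ _ _ _ _).2 ⟨c, rfl⟩⟩

theorem IsLift.unique {v : Fin 3 → ℝ} {x y : Plane} (h : IsLift v x) (h' : IsLift v y) :
    x = y := by
  obtain ⟨hv, rfl⟩ := h
  obtain ⟨_, rfl⟩ := h'
  rfl

theorem IsLift.exists_smul {v w : Fin 3 → ℝ} {x : Plane} (h : IsLift v x) (h' : IsLift w x) :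
    ∃ c : ℝ, c ≠ 0 ∧ w = c • v := by
  obtain ⟨hv, rfl⟩ := h
  obtain ⟨hw, h'⟩ := h'
  obtain ⟨c, hc⟩ := (Projectivization.mk_eq_mk_iff' _ _ _ _ _).1 h'
  exact ⟨c, by rintro rfl; exact hw (by simp [← hc]), hc.symm⟩

theorem IsLift.incident_iff {v w : Fin 3 → ℝ} {x X : Plane} (h : IsLift v x) (h' : IsLift w X) :
    Incident x X ↔ v ⬝ᵥ w = 0 := by
  obtain ⟨hv, rfl⟩ := h
  obtain ⟨hw, rfl⟩ := h'
  exact Projectivization.orthogonal_mk hv hw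

theorem IsLift.cross_ne_zero {v w : Fin 3 → ℝ} {x y : Plane} (h : IsLift v x) (h' : IsLift w y)
    (hxy : x ≠ y) : crossProduct v w ≠ 0 := by
  obtain ⟨hv, rfl⟩ := h
  obtain ⟨hw, rfl⟩ := h'
  exact mt (Projectivization.mk_eq_mk_iff_crossProduct_eq_zero hv hw).2 hxy

theorem IsLift.ne_of_cross_ne_zero {v w : Fin 3 → ℝ} {x y : Plane} (h : IsLift v x)
    (h' : IsLift w y) (hc : crossProduct v w ≠ 0) : x ≠ y := by
  obtain ⟨hv, rfl⟩ := h
  obtain ⟨hw, rfl⟩ := h'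
  exact mt (Projectivization.mk_eq_mk_iff_crossProduct_eq_zero hv hw).1 hc

theorem IsLift.join {v w : Fin 3 → ℝ} {x y : Plane} (h : IsLift v x) (h' : IsLift w y)
    (hc : crossProduct v w ≠ 0) : IsLift (crossProduct v w) (join x y) := by
  obtain ⟨hv, rfl⟩ := h
  obtain ⟨hw, rfl⟩ := h'
  exact ⟨hc, (Projectivization.cross_mk_of_cross_ne_zero hv hw hc).symm⟩

theorem join_comm (x y : Plane) : join x y = join y x := Projectivization.cross_comm x y

/-- A point on two distinct lines is their intersection. -/
theorem join_eq_of_incident {x X Y : Plane} (hXY : X ≠ Y) (hX : Incident x X)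
    (hY : Incident x Y) : PappusAnosov.join X Y = x := by
  obtain ⟨v, hv⟩ := exists_isLift x
  obtain ⟨w, hw⟩ := exists_isLift X
  obtain ⟨w', hw'⟩ := exists_isLift Y
  have hc := hw.cross_ne_zero hw' hXY
  have h1 := (hv.incident_iff hw).1 hX
  have h2 := (hv.incident_iff hw').1 hY
  by_contra hne
  refine (hw.join hw' hc).cross_ne_zero hv hne ?_
  rw [cross_cross_eq_smul_sub_smul, dotProduct_comm w, dotProduct_comm w', h1, h2]
  simp

/-! ### Projective transformations -/

/-- The class of a matrix in the projective group. -/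
abbrev cls (M : GL (Fin 3) ℝ) : PGL(3, ℝ) := Matrix.ProjGenLinGroup.mk M

theorem cls_mul (M N : GL (Fin 3) ℝ) : cls (M * N) = cls M * cls N := map_mul _ _ _

theorem cls_inv (M : GL (Fin 3) ℝ) : cls M⁻¹ = (cls M)⁻¹ := map_inv _ _

theorem cls_surjective (g : PGL(3, ℝ)) : ∃ M, cls M = g := Matrix.ProjGenLinGroup.mk_surjective g

theorem IsLift.map {v : Fin 3 → ℝ} {x : Plane} (M : GL (Fin 3) ℝ) (h : IsLift v x) :
    IsLift (M.1 *ᵥ v) (cls M • x) := by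
  obtain ⟨hv, rfl⟩ := h
  have : M • v ≠ 0 := (smul_ne_zero_iff_ne M).2 hv
  exact ⟨this, rfl⟩

theorem IsLift.of_map {v : Fin 3 → ℝ} {x : Plane} (M : GL (Fin 3) ℝ)
    (h : IsLift (M.1 *ᵥ v) (cls M • x)) : IsLift v x := by
  have := h.map M⁻¹
  rwa [Matrix.mulVec_mulVec, ← Units.val_mul, inv_mul_cancel, Units.val_one, Matrix.one_mulVec,
    cls_inv, inv_smul_smul] at this

theorem IsLift.mapLine {w : Fin 3 → ℝ} {X : Plane} (M : GL (Fin 3) ℝ) (h : IsLift w X) :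
    IsLift ((M⁻¹).1ᵀ *ᵥ w) (mapLine (cls M) X) := by
  have := h.map (contragredientGL M)
  exact this

theorem mapLine_mul (g h : PGL(3, ℝ)) (X : Plane) :
    mapLine (g * h) X = mapLine g (mapLine h X) := by
  simp [PappusAnosov.mapLine, mul_smul]

theorem mapLine_one (X : Plane) : mapLine 1 X = X := by
  simp [PappusAnosov.mapLine]

theorem dotProduct_inv_transpose (M : GL (Fin 3) ℝ) (v w : Fin 3 → ℝ) :
    (M.1 *ᵥ v) ⬝ᵥ ((M⁻¹).1ᵀ *ᵥ w) = v ⬝ᵥ w := by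
  rw [Matrix.mulVec_transpose, dotProduct_comm, ← Matrix.dotProduct_mulVec,
    Matrix.mulVec_mulVec, ← Units.val_mul, inv_mul_cancel, Units.val_one, Matrix.one_mulVec,
    dotProduct_comm]

theorem incident_map_iff (g : PGL(3, ℝ)) (x X : Plane) :
    Incident (g • x) (mapLine g X) ↔ Incident x X := by
  refine ⟨fun h => ?_, incident_map g x X⟩
  have := incident_map g⁻¹ _ _ h
  rwa [inv_smul_smul, ← mapLine_mul, inv_mul_cancel, mapLine_one] at this

theorem mapLine_injective (g : PGL(3, ℝ)) : Function.Injective (mapLine g) :=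
  MulAction.injective (contragredient g)

theorem join_map (g : PGL(3, ℝ)) {x y : Plane} (h : x ≠ y) :
    join (g • x) (g • y) = mapLine g (join x y) := by
  have h' : g • x ≠ g • y := fun e => h (smul_left_cancel g e)
  by_contra hne
  -- both points are on both lines, which would make them equal
  have a := join_eq_of_incident hne (Projectivization.orthogonal_cross_left h')
    ((incident_map_iff g _ _).2 (Projectivization.orthogonal_cross_left h))
  have b := join_eq_of_incident hne (Projectivization.orthogonal_cross_right h')
    ((incident_map_iff g _ _).2 (Projectivization.orthogonal_cross_right h))
  exact h' (a.symm.trans b)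

theorem join_mapLine (g : PGL(3, ℝ)) {X Y : Plane} (h : X ≠ Y) :
    join (mapLine g X) (mapLine g Y) = g • join X Y :=
  join_eq_of_incident (fun e => h (mapLine_injective g e))
    ((incident_map_iff g _ _).2 (Projectivization.cross_orthogonal_left h))
    ((incident_map_iff g _ _).2 (Projectivization.cross_orthogonal_right h))

/-! ### Topology of the plane -/

theorem isOpen_plane_iff {s : Set Plane} :
    IsOpen s ↔ IsOpen {v : {v : Fin 3 → ℝ // v ≠ 0} | Projectivization.mk ℝ v.1 v.2 ∈ s} :=
  isOpen_coinduced

theorem continuous_mk :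
    Continuous (fun v : {v : Fin 3 → ℝ // v ≠ 0} => Projectivization.mk ℝ v.1 v.2) :=
  continuous_coinduced_rng

theorem isOpenMap_mk :
    IsOpenMap (fun v : {v : Fin 3 → ℝ // v ≠ 0} => Projectivization.mk ℝ v.1 v.2) := by
  intro s hs
  rw [isOpen_plane_iff]
  have : {v : {v : Fin 3 → ℝ // v ≠ 0} | Projectivization.mk ℝ v.1 v.2 ∈
      (fun v : {v : Fin 3 → ℝ // v ≠ 0} => Projectivization.mk ℝ v.1 v.2) '' s} =
      ⋃ c : ℝˣ, (fun v : {v : Fin 3 → ℝ // v ≠ 0} =>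
        (⟨c.1 • v.1, smul_ne_zero c.ne_zero v.2⟩ : {v : Fin 3 → ℝ // v ≠ 0})) ⁻¹' s := by
    ext v
    simp only [Set.mem_ofPred_eq, Set.mem_image, Set.mem_iUnion, Set.mem_preimage]
    constructor
    · rintro ⟨w, hw, h⟩
      obtain ⟨c, hc⟩ := (Projectivization.mk_eq_mk_iff _ _ _ _ _).1 h
      refine ⟨c, ?_⟩
      have : (⟨c.1 • v.1, smul_ne_zero c.ne_zero v.2⟩ : {v : Fin 3 → ℝ // v ≠ 0}) = w :=
        Subtype.ext hc
      rwa [this]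
    · rintro ⟨c, hc⟩
      exact ⟨_, hc, (Projectivization.mk_eq_mk_iff _ _ _ _ _).2 ⟨c, rfl⟩⟩
  rw [this]
  refine isOpen_iUnion fun c => hs.preimage ?_
  exact Continuous.subtype_mk (continuous_subtype_val.const_smul c.1) _

instance : CompactSpace Plane := by
  constructor
  have hs : IsCompact (Metric.sphere (0 : Fin 3 → ℝ) 1) := isCompact_sphere _ _
  let f : Metric.sphere (0 : Fin 3 → ℝ) 1 → {v : Fin 3 → ℝ // v ≠ 0} :=
    fun v => ⟨v.1, fun h => by have := v.2; simp [h] at this⟩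
  have hf : Continuous f := Continuous.subtype_mk continuous_subtype_val _
  have := isCompact_iff_compactSpace.1 hs
  have := isCompact_range (continuous_mk.comp hf)
  convert this
  symm
  rw [Set.eq_univ_iff_forall]
  intro x
  obtain ⟨v, hv⟩ := exists_isLift x
  have hn : ‖v‖ ≠ 0 := norm_ne_zero_iff.2 hv.ne_zero
  have hl := hv.smul (inv_ne_zero hn)
  refine ⟨⟨‖v‖⁻¹ • v, ?_⟩, ?_⟩
  · simp [norm_smul, hn]
  · exact hl.2

/-- Incidence is a closed relation. -/
theorem exists_open_not_incident {x X : Plane} (h : ¬ Incident x X) :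
    ∃ O O' : Set Plane, IsOpen O ∧ IsOpen O' ∧ x ∈ O ∧ X ∈ O' ∧
      ∀ y ∈ O, ∀ Y ∈ O', ¬ Incident y Y := by
  obtain ⟨v, hv⟩ := exists_isLift x
  obtain ⟨w, hw⟩ := exists_isLift X
  rw [hv.incident_iff hw] at h
  have ho : IsOpen {q : {v : Fin 3 → ℝ // v ≠ 0} × {v : Fin 3 → ℝ // v ≠ 0} |
      q.1.1 ⬝ᵥ q.2.1 ≠ 0} := by
    refine isOpen_ne_fun ?_ continuous_const
    refine continuous_finsetSum _ fun i _ => ?_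
    exact ((continuous_apply i).comp (continuous_subtype_val.comp continuous_fst)).mul
      ((continuous_apply i).comp (continuous_subtype_val.comp continuous_snd))
  obtain ⟨s, t, hs, ht, hvs, hwt, hst⟩ := isOpen_prod_iff.1 ho ⟨v, hv.1⟩ ⟨w, hw.1⟩ h
  refine ⟨_, _, isOpenMap_mk s hs, isOpenMap_mk t ht, ⟨_, hvs, hv.2⟩, ⟨_, hwt, hw.2⟩, ?_⟩
  rintro _ ⟨v', hv', rfl⟩ _ ⟨w', hw', rfl⟩
  rw [(isLift_mk v'.2).incident_iff (isLift_mk w'.2)]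
  exact hst (Set.mk_mem_prod hv' hw')

/-! ### Birkhoff's contraction for positive matrices -/

section Birkhoff

variable {ι : Type*} [Fintype ι] [Nonempty ι]

/-- The largest `α` such that `a - α b` has nonnegative coordinates, for `b` positive. -/
noncomputable def minRatio (a b : ι → ℝ) : ℝ :=
  Finset.univ.inf' Finset.univ_nonempty fun i => a i / b i

/-- The number `e^(-2d)`, where `d` is the Hilbert distance of the lines spanned by two positive
vectors. It lies in `(0, 1]`, and it is `1` only if the vectors are proportional. -/
noncomputable def affinity (a b : ι → ℝ) : ℝ := minRatio a b * minRatio b a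

theorem minRatio_mul_le (a : ι → ℝ) {b : ι → ℝ} (hb : ∀ i, 0 < b i) (i : ι) :
    minRatio a b * b i ≤ a i := by
  rw [← le_div_iff₀ (hb i)]
  exact Finset.inf'_le (fun i => a i / b i) (Finset.mem_univ i)

theorem exists_minRatio_mul_eq (a : ι → ℝ) {b : ι → ℝ} (hb : ∀ i, 0 < b i) :
    ∃ i, minRatio a b * b i = a i := by
  obtain ⟨i, -, hi⟩ := Finset.exists_mem_eq_inf' (Finset.univ_nonempty (α := ι))
    fun i => a i / b i
  refine ⟨i, ?_⟩
  rw [minRatio, hi]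
  exact div_mul_cancel₀ _ (hb i).ne'

theorem minRatio_pos {a b : ι → ℝ} (ha : ∀ i, 0 < a i) (hb : ∀ i, 0 < b i) :
    0 < minRatio a b := by
  obtain ⟨i, hi⟩ := exists_minRatio_mul_eq a hb
  have := ha i
  rw [← hi] at this
  exact pos_of_mul_pos_left this (hb i).le

theorem minRatio_eq_of {a b : ι → ℝ} {α : ℝ} (hb : ∀ i, 0 < b i) (h : ∀ i, α * b i ≤ a i)
    (h' : ∃ i, α * b i = a i) : α = minRatio a b := by
  obtain ⟨i, hi⟩ := h'
  obtain ⟨j, hj⟩ := exists_minRatio_mul_eq a hb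
  refine le_antisymm ?_ ?_
  · exact le_of_mul_le_mul_right (hj ▸ h j) (hb j)
  · exact le_of_mul_le_mul_right (hi ▸ minRatio_mul_le a hb i) (hb i)

theorem affinity_pos {a b : ι → ℝ} (ha : ∀ i, 0 < a i) (hb : ∀ i, 0 < b i) :
    0 < affinity a b := mul_pos (minRatio_pos ha hb) (minRatio_pos hb ha)

theorem affinity_le_one {a b : ι → ℝ} (ha : ∀ i, 0 < a i) (hb : ∀ i, 0 < b i) :
    affinity a b ≤ 1 := by
  obtain ⟨i⟩ := ‹Nonempty ι›
  have h1 := minRatio_mul_le a hb i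
  have h2 := minRatio_mul_le b ha i
  have h3 := minRatio_pos ha hb
  refine le_of_mul_le_mul_right (a := a i) ?_ (ha i)
  rw [affinity, mul_assoc, one_mul]
  exact (mul_le_mul_of_nonneg_left h2 h3.le).trans h1

theorem eq_minRatio_smul {a b : ι → ℝ} (ha : ∀ i, 0 < a i) (hb : ∀ i, 0 < b i)
    (h : affinity a b = 1) (i : ι) : a i = minRatio a b * b i := by
  refine le_antisymm ?_ (minRatio_mul_le a hb i)
  have h2 := mul_le_mul_of_nonneg_left (minRatio_mul_le b ha i) (minRatio_pos ha hb).le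
  rwa [← mul_assoc, ← affinity, h, one_mul] at h2

theorem le_affinity {a b : ι → ℝ} {μ : ℝ} (ha : ∀ i, 0 < a i) (hb : ∀ i, 0 < b i)
    (h : ∀ i j, μ * (b i * a j) ≤ a i * b j) : μ ≤ affinity a b := by
  obtain ⟨i, hi⟩ := exists_minRatio_mul_eq a hb
  obtain ⟨j, hj⟩ := exists_minRatio_mul_eq b ha
  have := h i j
  rw [← hi, ← hj] at this
  refine le_of_mul_le_mul_right (a := b i * a j) ?_ (mul_pos (hb i) (ha j))
  rw [affinity]
  linarith

theorem affinity_smul {a b : ι → ℝ} {s t : ℝ} (hs : 0 < s) (ht : 0 < t) (ha : ∀ i, 0 < a i)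
    (hb : ∀ i, 0 < b i) : affinity (s • a) (t • b) = affinity a b := by
  have key : ∀ (a b : ι → ℝ) (s t : ℝ), 0 < s → 0 < t → (∀ i, 0 < a i) → (∀ i, 0 < b i) →
      minRatio (s • a) (t • b) = s / t * minRatio a b := by
    intro a b s t hs ht ha hb
    symm
    refine minRatio_eq_of (fun i => mul_pos ht (hb i)) (fun i => ?_) ?_
    · have := minRatio_mul_le a hb i
      simp only [Pi.smul_apply, smul_eq_mul]
      have h2 : s / t * minRatio a b * (t * b i) = s * (minRatio a b * b i) := by field_simp
      rw [h2]
      exact mul_le_mul_of_nonneg_left this hs.le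
    · obtain ⟨i, hi⟩ := exists_minRatio_mul_eq a hb
      refine ⟨i, ?_⟩
      simp only [Pi.smul_apply, smul_eq_mul]
      rw [← hi]
      field_simp
  rw [affinity, key a b s t hs ht ha hb, key b a t s ht hs hb ha, affinity]
  field_simp

/-- Birkhoff's contraction: a matrix with entries in `[m, M]`, where `0 < m`, contracts the Hilbert
metric of the positive orthant. -/
theorem one_sub_affinity_le {c : ι → ι → ℝ} {m M : ℝ} (hm : 0 < m)
    (hc : ∀ i j, m ≤ c i j ∧ c i j ≤ M) {a b a' b' : ι → ℝ} (ha' : ∀ i, 0 < a' i)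
    (hb' : ∀ i, 0 < b' i) (ha : ∀ i, a i = ∑ j, c i j * a' j)
    (hb : ∀ i, b i = ∑ j, c i j * b' j) :
    1 - affinity a b ≤ (1 - (m / M) ^ 2) * (1 - affinity a' b') := by
  have hmM : m ≤ M := by
    obtain ⟨i⟩ := ‹Nonempty ι›
    exact (hc i i).1.trans (hc i i).2
  have hM : 0 < M := hm.trans_le hmM
  have hcpos : ∀ i j, 0 < c i j := fun i j => hm.trans_le (hc i j).1
  have hapos : ∀ i, 0 < a i := fun i => by
    rw [ha]; exact Finset.sum_pos (fun j _ => mul_pos (hcpos i j) (ha' j)) Finset.univ_nonempty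
  have hbpos : ∀ i, 0 < b i := fun i => by
    rw [hb]; exact Finset.sum_pos (fun j _ => mul_pos (hcpos i j) (hb' j)) Finset.univ_nonempty
  set α := minRatio a' b' with hα
  set β := minRatio b' a' with hβ
  have hP : affinity a' b' = α * β := rfl
  have hα0 : 0 < α := minRatio_pos ha' hb'
  have hβ0 : 0 < β := minRatio_pos hb' ha'
  set θ := (m / M) ^ 2 with hθ
  have hθ0 : 0 ≤ θ := sq_nonneg _
  have hθ1 : θ ≤ 1 := by
    rw [hθ]; exact pow_le_one₀ (div_nonneg hm.le hM.le) ((div_le_one hM).2 hmM)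
  have hθM : θ * M ^ 2 = m ^ 2 := by rw [hθ]; field_simp
  have hP1 : α * β ≤ 1 := affinity_le_one ha' hb'
  -- the coordinates of the images of the two boundary vectors `a' - α b'` and `b' - β a'`
  have comb : ∀ (x y : ι → ℝ) (s : ℝ), (∀ j, s * y j ≤ x j) → ∀ i,
      m * ∑ j, (x j - s * y j) ≤ ∑ j, c i j * x j - s * ∑ j, c i j * y j ∧
      ∑ j, c i j * x j - s * ∑ j, c i j * y j ≤ M * ∑ j, (x j - s * y j) := by
    intro x y s h i
    have e : ∑ j, c i j * x j - s * ∑ j, c i j * y j = ∑ j, c i j * (x j - s * y j) := by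
      rw [Finset.mul_sum, ← Finset.sum_sub_distrib]
      exact Finset.sum_congr rfl fun j _ => by ring
    rw [e, Finset.mul_sum, Finset.mul_sum]
    exact ⟨Finset.sum_le_sum fun j _ =>
        mul_le_mul_of_nonneg_right (hc i j).1 (sub_nonneg.2 (h j)),
      Finset.sum_le_sum fun j _ => mul_le_mul_of_nonneg_right (hc i j).2 (sub_nonneg.2 (h j))⟩
  have hX := comb a' b' α (minRatio_mul_le a' hb')
  have hY := comb b' a' β (minRatio_mul_le b' ha')
  simp only [← ha, ← hb] at hX hY
  have hφ : 0 ≤ ∑ j, (a' j - α * b' j) :=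
    Finset.sum_nonneg fun j _ => sub_nonneg.2 (minRatio_mul_le a' hb' j)
  have hψ : 0 ≤ ∑ j, (b' j - β * a' j) :=
    Finset.sum_nonneg fun j _ => sub_nonneg.2 (minRatio_mul_le b' ha' j)
  set φ := ∑ j, (a' j - α * b' j)
  set ψ := ∑ j, (b' j - β * a' j)
  rw [hP]
  suffices h : α * β + θ * (1 - α * β) ≤ affinity a b by linarith
  refine le_affinity hapos hbpos fun i j => ?_
  have hXY : ∀ i j, θ * ((a j - α * b j) * (b i - β * a i)) ≤
      (a i - α * b i) * (b j - β * a j) := by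
    intro i j
    calc θ * ((a j - α * b j) * (b i - β * a i)) ≤ θ * ((M * φ) * (M * ψ)) := by
          refine mul_le_mul_of_nonneg_left ?_ hθ0
          exact mul_le_mul (hX j).2 (hY i).2 ((mul_nonneg hm.le hψ).trans (hY i).1)
            (mul_nonneg hM.le hφ)
      _ = (m * φ) * (m * ψ) := by linear_combination (φ * ψ) * hθM
      _ ≤ _ := mul_le_mul (hX i).1 (hY j).1 (mul_nonneg hm.le hψ)
          ((mul_nonneg hm.le hφ).trans (hX i).1)
  rcases hP1.lt_or_eq with hlt | heq
  · have hX0 : ∀ i, 0 ≤ a i - α * b i := fun i => (mul_nonneg hm.le hφ).trans (hX i).1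
    have hY0 : ∀ i, 0 ≤ b i - β * a i := fun i => (mul_nonneg hm.le hψ).trans (hY i).1
    have hq : 0 < 1 - α * β := sub_pos.2 hlt
    have hμ : α * β + θ * (1 - α * β) ≤ 1 := by nlinarith
    have h1 := hXY i j
    have e1 : 0 ≤ (a i - α * b i) * (a j - α * b j) := mul_nonneg (hX0 i) (hX0 j)
    have e2 : 0 ≤ (b i - β * a i) * (b j - β * a j) := mul_nonneg (hY0 i) (hY0 j)
    have e3 : 0 ≤ (a i - α * b i) * (b j - β * a j) := mul_nonneg (hX0 i) (hY0 j)
    -- express `a` and `b` through the two boundary vectors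
    have key : (1 - α * β) ^ 2 * (a i * b j - (α * β + θ * (1 - α * β)) * (b i * a j)) =
        (1 - (α * β + θ * (1 - α * β))) * (β * ((a i - α * b i) * (a j - α * b j)) +
          α * ((b i - β * a i) * (b j - β * a j)) +
          α * β * ((a i - α * b i) * (b j - β * a j))) +
        (1 - α * β) * ((a i - α * b i) * (b j - β * a j) -
          θ * ((a j - α * b j) * (b i - β * a i))) := by ring
    have hpos : 0 ≤ (1 - α * β) ^ 2 *
        (a i * b j - (α * β + θ * (1 - α * β)) * (b i * a j)) := by
      rw [key]
      refine add_nonneg (mul_nonneg (sub_nonneg.2 hμ) ?_) (mul_nonneg hq.le (sub_nonneg.2 h1))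
      have := mul_nonneg hβ0.le e1
      have := mul_nonneg hα0.le e2
      have := mul_nonneg (mul_pos hα0 hβ0).le e3
      linarith
    have := nonneg_of_mul_nonneg_right hpos (pow_pos hq 2)
    linarith
  · have hab : ∀ i, a i = α * b i := fun i => by
      rw [ha, hb, Finset.mul_sum]
      refine Finset.sum_congr rfl fun j _ => ?_
      rw [eq_minRatio_smul ha' hb' (hP.trans heq) j]
      ring
    rw [heq, hab i, hab j]
    apply le_of_eq
    ring

/-- A sequence in `[0, 1]` that grows at least geometrically vanishes at the start. -/
theorem eq_zero_of_le_mul_succ {κ : ℝ} (h0 : 0 ≤ κ) (h1 : κ < 1) {d : ℕ → ℝ}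
    (hd : ∀ n, 0 ≤ d n) (hd1 : ∀ n, d n ≤ 1) (h : ∀ n, d n ≤ κ * d (n + 1)) : d 0 = 0 := by
  have hn : ∀ n, d 0 ≤ κ ^ n * d n := by
    intro n
    induction n with
    | zero => simp
    | succ n ih =>
      refine ih.trans ?_
      rw [pow_succ, mul_assoc]
      exact mul_le_mul_of_nonneg_left (h n) (pow_nonneg h0 n)
  have hn' : ∀ n, d 0 ≤ κ ^ n := fun n =>
    (hn n).trans (mul_le_of_le_one_right (pow_nonneg h0 n) (hd1 n))
  exact le_antisymm (ge_of_tendsto' (tendsto_pow_atTop_nhds_zero_of_lt_one h0 h1) hn') (hd 0)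

end Birkhoff

/-! ### Polyhedral domains of the plane and their Hilbert distance -/

section Cones

variable {ι : Type*}

/-- The domain of all points that have a lift on which the functionals `F i` are positive. -/
def projCone (F : ι → Fin 3 → ℝ) : Set Plane :=
  {x | ∃ v, (∀ i, 0 < F i ⬝ᵥ v) ∧ IsLift v x}

/-- The functionals `F i` define a nonempty open cone whose closure contains no line. -/
structure IsProper (F : ι → Fin 3 → ℝ) : Prop where
  salient : ∀ v, (∀ i, F i ⬝ᵥ v = 0) → v = 0
  nonempty : ∃ v, ∀ i, 0 < F i ⬝ᵥ v

theorem isOpen_projCone [Finite ι] (F : ι → Fin 3 → ℝ) : IsOpen (projCone F) := by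
  have ho : IsOpen {v : {v : Fin 3 → ℝ // v ≠ 0} | ∀ i, 0 < F i ⬝ᵥ v.1} := by
    rw [Set.ofPred_forall]
    refine isOpen_iInter_of_finite fun i => isOpen_lt continuous_const ?_
    exact (continuous_const.dotProduct continuous_id).comp continuous_subtype_val
  convert isOpenMap_mk _ ho
  ext x
  constructor
  · rintro ⟨v, hv, hx⟩
    exact ⟨⟨v, hx.1⟩, hv, hx.2⟩
  · rintro ⟨v, hv, rfl⟩
    exact ⟨v, hv, isLift_mk v.2⟩

theorem mem_projCone_of_neg {F : ι → Fin 3 → ℝ} {x : Plane} {v : Fin 3 → ℝ} (h : IsLift v x)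
    (hv : ∀ i, F i ⬝ᵥ v < 0) : x ∈ projCone F :=
  ⟨(-1 : ℝ) • v, fun i => by rw [dotProduct_smul]; simpa using hv i, h.smul (by norm_num)⟩

/-- A lift of a point of the domain at which one functional is positive is in the cone. -/
theorem pos_of_mem_projCone {F : ι → Fin 3 → ℝ} {x : Plane} (hx : x ∈ projCone F)
    {v : Fin 3 → ℝ} (h : IsLift v x) {i : ι} (hi : 0 ≤ F i ⬝ᵥ v) (j : ι) : 0 < F j ⬝ᵥ v := by
  obtain ⟨w, hw, hwx⟩ := hx
  obtain ⟨c, hc, rfl⟩ := hwx.exists_smul h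
  rw [dotProduct_smul, smul_eq_mul] at hi ⊢
  have : 0 ≤ c := nonneg_of_mul_nonneg_left hi (hw i)
  exact mul_pos (lt_of_le_of_ne this hc.symm) (hw j)

theorem IsProper.closure_eq [Finite ι] {F : ι → Fin 3 → ℝ} (hF : IsProper F) :
    closure (projCone F) = {x | ∃ v, (∀ i, 0 ≤ F i ⬝ᵥ v) ∧ IsLift v x} := by
  apply subset_antisymm
  · refine closure_minimal ?_ ?_
    · rintro x ⟨v, hv, hx⟩
      exact ⟨v, fun i => (hv i).le, hx⟩
    · rw [← isOpen_compl_iff, isOpen_plane_iff]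
      have hc : ∀ i, Continuous fun v : {v : Fin 3 → ℝ // v ≠ 0} => F i ⬝ᵥ v.1 := fun i =>
        (continuous_const.dotProduct continuous_id).comp continuous_subtype_val
      have ho : IsOpen ({v : {v : Fin 3 → ℝ // v ≠ 0} | ∃ i, F i ⬝ᵥ v.1 < 0} ∩
          {v : {v : Fin 3 → ℝ // v ≠ 0} | ∃ i, 0 < F i ⬝ᵥ v.1}) := by
        rw [Set.ofPred_exists, Set.ofPred_exists]
        exact (isOpen_iUnion fun i => isOpen_lt (hc i) continuous_const).inter
          (isOpen_iUnion fun i => isOpen_lt continuous_const (hc i))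
      convert ho using 1
      ext v
      simp only [Set.mem_compl_iff, Set.mem_ofPred_eq, Set.mem_inter_iff]
      constructor
      · intro h
        constructor
        · by_contra! h'
          exact h ⟨v.1, h', isLift_mk v.2⟩
        · by_contra! h'
          refine h ⟨(-1 : ℝ) • v.1, fun i => ?_, (isLift_mk v.2).smul (by norm_num)⟩
          rw [dotProduct_smul]
          simpa using h' i
      · rintro ⟨⟨i, hi⟩, ⟨j, hj⟩⟩ ⟨w, hw, hwl⟩
        obtain ⟨c, hc, hvc⟩ := hwl.exists_smul (isLift_mk v.2)
        rw [hvc, dotProduct_smul, smul_eq_mul] at hi hj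
        have h1 : c < 0 := by
          by_contra! h'
          exact absurd (mul_nonneg h' (hw i)) (not_le.2 hi)
        exact absurd (mul_nonpos_of_nonpos_of_nonneg h1.le (hw j)) (not_le.2 hj)
  · rintro x ⟨v, hv, hx⟩
    obtain ⟨v₀, hv₀⟩ := hF.nonempty
    -- `x` is the limit of the points `[v + s v₀]` of the domain, as `s` tends to `0`
    have hne : ∀ s : ℝ, 0 ≤ s → v + s • v₀ ≠ 0 := by
      intro s hs h
      have h0 : ∀ i, F i ⬝ᵥ v + s * (F i ⬝ᵥ v₀) = 0 := fun i => by
        rw [← smul_eq_mul, ← dotProduct_smul, ← dotProduct_add, h, dotProduct_zero]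
      refine hx.ne_zero (hF.salient v fun i => ?_)
      have := mul_nonneg hs (hv₀ i).le
      linarith [h0 i, hv i]
    let f : Set.Ici (0 : ℝ) → Plane := fun s => Projectivization.mk ℝ _ (hne s.1 s.2)
    have hf : Continuous f := by
      refine continuous_mk.comp (Continuous.subtype_mk (f := fun s : Set.Ici (0 : ℝ) =>
        v + s.1 • v₀) ?_ fun s => hne s.1 s.2)
      exact continuous_const.add (continuous_subtype_val.smul continuous_const)
    have h0 : f ⟨0, Set.self_mem_Ici⟩ = x := by
      refine IsLift.unique (isLift_mk _) ?_
      simpa using hx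
    let g : ℕ → Set.Ici (0 : ℝ) := fun n => ⟨1 / ((n : ℝ) + 1), Set.mem_Ici.2 (by positivity)⟩
    have hg : Filter.Tendsto g Filter.atTop (nhds ⟨0, Set.self_mem_Ici⟩) :=
      tendsto_subtype_rng.2 tendsto_one_div_add_atTop_nhds_zero_nat
    rw [← h0]
    refine mem_closure_of_tendsto ((hf.tendsto _).comp hg) (Filter.Eventually.of_forall fun n => ?_)
    refine ⟨v + (1 / ((n : ℝ) + 1)) • v₀, fun i => ?_, isLift_mk _⟩
    rw [dotProduct_add, dotProduct_smul, smul_eq_mul]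
    have : 0 < 1 / ((n : ℝ) + 1) := by positivity
    linarith [hv i, mul_pos this (hv₀ i)]

theorem IsProper.mem_frontier_iff [Finite ι] {F : ι → Fin 3 → ℝ} (hF : IsProper F) {v : Fin 3 → ℝ}
    {x : Plane} (hx : IsLift v x) :
    x ∈ frontier (projCone F) ↔ ((∀ i, 0 ≤ F i ⬝ᵥ v) ∨ (∀ i, F i ⬝ᵥ v ≤ 0)) ∧
      ∃ i, F i ⬝ᵥ v = 0 := by
  rw [(isOpen_projCone F).frontier_eq, hF.closure_eq]
  constructor
  · rintro ⟨⟨w, hw, hwx⟩, hn⟩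
    obtain ⟨c, hc, rfl⟩ := hwx.exists_smul hx
    have hz : ∃ i, F i ⬝ᵥ w = 0 := by
      by_contra! h
      exact hn ⟨w, fun i => lt_of_le_of_ne (hw i) (h i).symm, hwx⟩
    simp only [dotProduct_smul, smul_eq_mul]
    constructor
    · rcases lt_or_gt_of_ne hc with h | h
      · exact Or.inr fun i => mul_nonpos_of_nonpos_of_nonneg h.le (hw i)
      · exact Or.inl fun i => mul_nonneg h.le (hw i)
    · obtain ⟨i, hi⟩ := hz
      exact ⟨i, by rw [hi, mul_zero]⟩
  · rintro ⟨h, i, hi⟩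
    constructor
    · rcases h with h | h
      · exact ⟨v, h, hx⟩
      · refine ⟨(-1 : ℝ) • v, fun i => ?_, hx.smul (by norm_num)⟩
        rw [dotProduct_smul]
        simpa using h i
    · intro hm
      exact (pos_of_mem_projCone hm hx hi.ge i).ne' hi


/-- The Hilbert distance of a polyhedral domain. -/
theorem IsProper.hilbertDist_eq [Fintype ι] [Nonempty ι] {F : ι → Fin 3 → ℝ} (hF : IsProper F)
    {x y : Plane} (hxy : x ≠ y) {u v : Fin 3 → ℝ} (hu : IsLift u x) (hv : IsLift v y)
    (hu0 : ∀ i, 0 < F i ⬝ᵥ u) (hv0 : ∀ i, 0 < F i ⬝ᵥ v) :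
    hilbertDist (projCone F) x y =
      1 / 2 * Real.log (1 / affinity (fun i => F i ⬝ᵥ u) (fun i => F i ⬝ᵥ v)) := by
  set a : ι → ℝ := fun i => F i ⬝ᵥ u with ha
  set b : ι → ℝ := fun i => F i ⬝ᵥ v with hb
  have hnp : ∀ s : ℝ, u - s • v ≠ 0 := by
    intro s h
    rw [sub_eq_zero] at h
    have hs : s ≠ 0 := by
      rintro rfl
      exact hu.ne_zero (by simpa using h)
    exact hxy (hu.unique (h ▸ hv.smul hs))
  have hnp' : ∀ s : ℝ, v - s • u ≠ 0 := by
    intro s h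
    rw [sub_eq_zero] at h
    have hs : s ≠ 0 := by
      rintro rfl
      exact hv.ne_zero (by simpa using h)
    exact hxy (hv.unique (h ▸ hu.smul hs)).symm
  have hev : ∀ (u v : Fin 3 → ℝ) (s : ℝ) i, F i ⬝ᵥ (u - s • v) = F i ⬝ᵥ u - s * F i ⬝ᵥ v :=
    fun u v s i => by rw [dotProduct_sub, dotProduct_smul, smul_eq_mul]
  -- the intersection points of the line with the frontier, except that `α` could belong to the
  -- end of the segment beyond `v`
  have front : ∀ (u v : Fin 3 → ℝ), (∀ i, 0 < F i ⬝ᵥ u) → (∀ i, 0 < F i ⬝ᵥ v) →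
      (∀ s : ℝ, u - s • v ≠ 0) → ∀ α : ℝ, 0 < α →
      ((∃ w ∈ frontier (projCone F), IsLift (u - α • v) w) ↔
        α = minRatio (fun i => F i ⬝ᵥ u) (fun i => F i ⬝ᵥ v) ∨
        1 = α * minRatio (fun i => F i ⬝ᵥ v) (fun i => F i ⬝ᵥ u)) := by
    intro u v hu0 hv0 hnp α hα
    constructor
    · rintro ⟨w, hw, hl⟩
      obtain ⟨h, i, hi⟩ := (hF.mem_frontier_iff hl).1 hw
      simp only [hev] at h hi
      rcases h with h | h
      · exact Or.inl (minRatio_eq_of hv0 (fun i => by linarith [h i]) ⟨i, by linarith⟩)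
      · right
        have : α⁻¹ = minRatio (fun i => F i ⬝ᵥ v) (fun i => F i ⬝ᵥ u) := by
          refine minRatio_eq_of hu0 (fun i => ?_) ⟨i, ?_⟩
          · rw [inv_mul_le_iff₀ hα]; linarith [h i]
          · rw [inv_mul_eq_iff_eq_mul₀ hα.ne']; linarith
        rw [← this, mul_inv_cancel₀ hα.ne']
    · intro h
      refine ⟨_, (hF.mem_frontier_iff (isLift_mk (hnp α))).2 ?_, isLift_mk (hnp α)⟩
      simp only [hev]
      rcases h with rfl | h
      · obtain ⟨i, hi⟩ := exists_minRatio_mul_eq (fun i => F i ⬝ᵥ u) hv0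
        exact ⟨Or.inl fun i => by linarith [minRatio_mul_le (fun i => F i ⬝ᵥ u) hv0 i],
          i, by linarith⟩
      · obtain ⟨i, hi⟩ := exists_minRatio_mul_eq (fun i => F i ⬝ᵥ v) hu0
        have e : ∀ t : ℝ, α * (minRatio (fun i => F i ⬝ᵥ v) (fun i => F i ⬝ᵥ u) * t) = t :=
          fun t => by rw [← mul_assoc, ← h, one_mul]
        refine ⟨Or.inr fun i => ?_, i, ?_⟩
        · have := mul_le_mul_of_nonneg_left (minRatio_mul_le (fun i => F i ⬝ᵥ v) hu0 i) hα.le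
          rw [e] at this
          linarith
        · have := e (F i ⬝ᵥ u)
          rw [hi] at this
          linarith
  have hα0 : 0 < minRatio a b := minRatio_pos hu0 hv0
  have hβ0 : 0 < minRatio b a := minRatio_pos hv0 hu0
  have hlt : minRatio a b * minRatio b a < 1 := by
    refine lt_of_le_of_ne (affinity_le_one hu0 hv0) fun h => hnp (minRatio a b) ?_
    refine hF.salient _ fun i => ?_
    rw [hev]
    linarith [eq_minRatio_smul hu0 hv0 h i]
  suffices hset : {d : ℝ | x ≠ y ∧ ∃ (u v : Fin 3 → ℝ) (α β : ℝ), IsLift u x ∧ IsLift v y ∧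
      (∀ k : ℝ, 0 < k → ∀ z : Plane, IsLift (u + k • v) z → z ∈ projCone F) ∧
      0 < α ∧ 0 < β ∧ α * β < 1 ∧
      (∃ w ∈ frontier (projCone F), IsLift (u - α • v) w) ∧
      (∃ w ∈ frontier (projCone F), IsLift (v - β • u) w) ∧
      d = 1 / 2 * Real.log (1 / (α * β))} = {1 / 2 * Real.log (1 / affinity a b)} by
    rw [hilbertDist, hset, csSup_singleton]
  ext d
  simp only [Set.mem_ofPred_eq, Set.mem_singleton_iff]
  constructor
  · rintro ⟨-, u', v', α, β, hu', hv', hseg, hα, hβ, hαβ, hw, hw', rfl⟩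
    obtain ⟨c, hc, rfl⟩ := hu.exists_smul hu'
    obtain ⟨e, he, rfl⟩ := hv.exists_smul hv'
    -- the segment condition excludes lifts of different signs
    have hce : 0 < c * e := by
      by_contra! hneg
      have hneg' : c * e < 0 := lt_of_le_of_ne hneg (mul_ne_zero hc he)
      obtain ⟨i⟩ := ‹Nonempty ι›
      have hai := hu0 i
      have hbi := hv0 i
      have hk : 0 < -(c * e) * (F i ⬝ᵥ u) / (e ^ 2 * (F i ⬝ᵥ v)) := by
        have := sq_pos_of_ne_zero he
        have := neg_pos.2 hneg'
        positivity
      set k := -(c * e) * (F i ⬝ᵥ u) / (e ^ 2 * (F i ⬝ᵥ v)) with hkdef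
      have hne : c • u + k • e • v ≠ 0 := by
        intro h0
        have : c • (u - (-(k * e) / c) • v) = 0 := by
          rw [← h0, smul_sub, smul_smul, smul_smul, sub_eq_add_neg, ← neg_smul]
          congr 2
          field_simp
        exact (smul_ne_zero hc (hnp _)) this
      have h0 : F i ⬝ᵥ (c • u + k • e • v) = 0 := by
        simp only [dotProduct_add, dotProduct_smul, smul_eq_mul]
        rw [hkdef]
        field_simp
        ring
      exact (pos_of_mem_projCone (hseg k hk _ (isLift_mk hne)) (isLift_mk hne) h0.ge i).ne' h0
    have hec : 0 < e / c := by
      have : e / c = (c * e) / c ^ 2 := by field_simp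
      rw [this]
      exact div_pos hce (sq_pos_of_ne_zero hc)
    have hα' : 0 < α * (e / c) := mul_pos hα hec
    have hβ' : 0 < β * (c / e) := by
      rw [← inv_div]
      exact mul_pos hβ (inv_pos.2 hec)
    have hαβ' : α * β = (α * (e / c)) * (β * (c / e)) := by field_simp
    have hw1 : ∃ w ∈ frontier (projCone F), IsLift (u - (α * (e / c)) • v) w := by
      obtain ⟨w, hw, hl⟩ := hw
      refine ⟨w, hw, ?_⟩
      have := hl.smul (inv_ne_zero hc)
      rwa [smul_sub, smul_smul, inv_mul_cancel₀ hc, one_smul, smul_smul, smul_smul,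
        show c⁻¹ * α * e = α * (e / c) by ring] at this
    have hw2 : ∃ w ∈ frontier (projCone F), IsLift (v - (β * (c / e)) • u) w := by
      obtain ⟨w, hw, hl⟩ := hw'
      refine ⟨w, hw, ?_⟩
      have := hl.smul (inv_ne_zero he)
      rwa [smul_sub, smul_smul, inv_mul_cancel₀ he, one_smul, smul_smul, smul_smul,
        show e⁻¹ * β * c = β * (c / e) by ring] at this
    rw [front u v hu0 hv0 hnp _ hα'] at hw1
    rw [front v u hv0 hu0 hnp' _ hβ'] at hw2
    rw [hαβ'] at hαβ ⊢
    -- the wrong ends are excluded by `α β < 1`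
    have h1 : α * (e / c) = minRatio a b := by
      rcases hw1 with h | h
      · exact h
      · rcases hw2 with h' | h'
        · rw [← h'] at h
          linarith
        · exfalso
          have hx1 : (α * (e / c)) * (β * (c / e)) * (minRatio a b * minRatio b a) = 1 := by
            calc _ = (α * (e / c) * minRatio b a) * (β * (c / e) * minRatio a b) := by ring
              _ = 1 := by rw [← h, ← h']; ring
          have := mul_lt_one_of_nonneg_of_lt_one_left (mul_pos hα' hβ').le hαβ hlt.le
          linarith
    have h2 : β * (c / e) = minRatio b a := by
      rcases hw2 with h | h
      · exact h
      · rw [← h1] at h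
        linarith
    rw [h1, h2, affinity]
  · rintro rfl
    refine ⟨hxy, u, v, minRatio a b, minRatio b a, hu, hv, ?_, hα0, hβ0, hlt, ?_, ?_, rfl⟩
    · intro k hk z hz
      refine ⟨_, fun i => ?_, hz⟩
      rw [dotProduct_add, dotProduct_smul, smul_eq_mul]
      exact add_pos (hu0 i) (mul_pos hk (hv0 i))
    · exact (front u v hu0 hv0 hnp _ hα0).2 (Or.inl rfl)
    · exact (front v u hv0 hu0 hnp' _ hβ0).2 (Or.inl rfl)

end Cones

/-! ### Nested polyhedral domains -/

section Nested

variable {ι : Type*} [Fintype ι]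

/-- The functionals `F` are combinations of the functionals `F'` with coefficients in `[m, M]`.
For `0 < m` this says, with quantitative control, that the closed domain of `F'` is contained in
the open domain of `F`. -/
def Refines (m M : ℝ) (F F' : ι → Fin 3 → ℝ) : Prop :=
  ∃ c : ι → ι → ℝ, (∀ i j, m ≤ c i j ∧ c i j ≤ M) ∧ ∀ i, F i = ∑ j, c i j • F' j

theorem Refines.mono {m M m' M' : ℝ} {F F' : ι → Fin 3 → ℝ} (h : Refines m M F F')
    (hm : m' ≤ m) (hM : M ≤ M') : Refines m' M' F F' := by
  obtain ⟨c, hc, h⟩ := h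
  exact ⟨c, fun i j => ⟨hm.trans (hc i j).1, (hc i j).2.trans hM⟩, h⟩

theorem sum_smul_dotProduct (c : ι → ℝ) (F : ι → Fin 3 → ℝ) (v : Fin 3 → ℝ) :
    (∑ j, c j • F j) ⬝ᵥ v = ∑ j, c j * (F j ⬝ᵥ v) := by
  rw [sum_dotProduct]
  exact Finset.sum_congr rfl fun j _ => by rw [smul_dotProduct, smul_eq_mul]

theorem Refines.pos {m M : ℝ} (hm : 0 < m) {F F' : ι → Fin 3 → ℝ} (h : Refines m M F F')
    {v : Fin 3 → ℝ} (hv : ∀ i, 0 ≤ F' i ⬝ᵥ v) (hv' : ∃ i, F' i ⬝ᵥ v ≠ 0) (i : ι) :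
    0 < F i ⬝ᵥ v := by
  obtain ⟨c, hc, h⟩ := h
  rw [h i, sum_smul_dotProduct]
  obtain ⟨j, hj⟩ := hv'
  have hcp : ∀ j, 0 < c i j := fun j => hm.trans_le (hc i j).1
  exact Finset.sum_pos' (fun j _ => mul_nonneg (hcp j).le (hv j))
    ⟨j, Finset.mem_univ j, mul_pos (hcp j) (lt_of_le_of_ne (hv j) hj.symm)⟩

theorem Refines.closure_subset {m M : ℝ} (hm : 0 < m) {F F' : ι → Fin 3 → ℝ}
    (h : Refines m M F F') (hF' : IsProper F') : closure (projCone F') ⊆ projCone F := by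
  rw [hF'.closure_eq]
  rintro x ⟨v, hv, hx⟩
  refine ⟨v, h.pos hm hv ?_, hx⟩
  by_contra! h0
  exact hx.ne_zero (hF'.salient v h0)

/-- Each neighbourhood of the limit point contains one of the domains. -/
theorem exists_projCone_subset {m M : ℝ} (hm : 0 < m) {F : ℕ → ι → Fin 3 → ℝ}
    (hF : ∀ n, IsProper (F n)) (h : ∀ n, Refines m M (F n) (F (n + 1))) {x : Plane}
    (hx : ⋂ n, projCone (F n) = {x}) {O : Set Plane} (hO : IsOpen O) (hxO : x ∈ O) :
    ∃ n, projCone (F n) ⊆ O := by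
  by_contra! hcon
  have hsub : ∀ n, closure (projCone (F (n + 1))) ⊆ projCone (F n) := fun n =>
    (h n).closure_subset hm (hF _)
  have hne : (⋂ n, closure (projCone (F n)) ∩ Oᶜ).Nonempty := by
    refine IsCompact.nonempty_iInter_of_sequence_nonempty_isCompact_isClosed _
      (fun n => Set.inter_subset_inter_left _ ((hsub n).trans subset_closure)) (fun n => ?_)
      (isClosed_closure.inter hO.isClosed_compl).isCompact
      fun n => isClosed_closure.inter hO.isClosed_compl
    obtain ⟨z, hz, hz'⟩ := Set.not_subset.1 (hcon n)
    exact ⟨z, subset_closure hz, hz'⟩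
  obtain ⟨z, hz⟩ := hne
  rw [Set.mem_iInter] at hz
  have : z ∈ ⋂ n, projCone (F n) := Set.mem_iInter.2 fun n => hsub n (hz (n + 1)).1
  rw [hx, Set.mem_singleton_iff] at this
  exact (hz 0).2 (this ▸ hxO)

variable [Nonempty ι]

theorem Refines.one_sub_affinity_le {m M : ℝ} (hm : 0 < m) {F F' : ι → Fin 3 → ℝ}
    (h : Refines m M F F') {u v : Fin 3 → ℝ} (hu : ∀ i, 0 < F' i ⬝ᵥ u)
    (hv : ∀ i, 0 < F' i ⬝ᵥ v) :
    1 - affinity (fun i => F i ⬝ᵥ u) (fun i => F i ⬝ᵥ v) ≤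
      (1 - (m / M) ^ 2) * (1 - affinity (fun i => F' i ⬝ᵥ u) (fun i => F' i ⬝ᵥ v)) := by
  obtain ⟨c, hc, h⟩ := h
  exact PappusAnosov.one_sub_affinity_le hm hc hu hv
    (fun i => by rw [h i, sum_smul_dotProduct]) (fun i => by rw [h i, sum_smul_dotProduct])

theorem hilbertDist_nonneg (D : Set Plane) (x y : Plane) : 0 ≤ hilbertDist D x y := by
  refine Real.sSup_nonneg ?_
  rintro d ⟨-, u, v, α, β, -, -, -, hα, hβ, hαβ, -, -, rfl⟩
  refine mul_nonneg (by norm_num) (Real.log_nonneg ?_)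
  rw [one_div]
  exact (one_le_inv₀ (mul_pos hα hβ)).2 hαβ.le

theorem hilbertDist_self (D : Set Plane) (x : Plane) : hilbertDist D x x = 0 := by
  simp [hilbertDist]

theorem ExpandsInto.trans {C : ℝ} (hC : 1 < C) {D D' D'' : Set Plane}
    (h : ExpandsInto C D'' D') (h' : ExpandsInto C D' D) : ExpandsInto C D'' D := by
  have hs : D'' ⊆ D' := subset_closure.trans h.1
  refine ⟨h.1.trans (subset_closure.trans h'.1), fun x hx y hy => ?_⟩
  refine le_trans (h'.2 x (hs hx) y (hs hy)) (le_trans ?_ (h.2 x hx y hy))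
  exact le_mul_of_one_le_left (hilbertDist_nonneg _ _ _) hC.le

theorem one_div_one_sub_sq_gt_one {m M : ℝ} (hm : 0 < m) (hM : m < M) :
    1 < 1 / (1 - (m / M) ^ 2) := by
  have hM0 : 0 < M := hm.trans hM
  have h1 : 0 < (m / M) ^ 2 := by positivity
  have h2 : (m / M) ^ 2 < 1 :=
    pow_lt_one₀ (div_nonneg hm.le hM0.le) ((div_lt_one hM0).2 hM) two_ne_zero
  rw [lt_div_iff₀ (by linarith)]
  linarith

/-- Birkhoff's contraction as an inequality of Hilbert distances. The contraction of
`1 - e^(-2d)` by the factor `κ` gives that of `d` by Bernoulli's inequality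
`p ^ κ ≤ 1 - κ (1 - p)`. -/
theorem Refines.expandsInto {m M : ℝ} (hm : 0 < m) (hM : m < M) {F F' : ι → Fin 3 → ℝ}
    (h : Refines m M F F') (hF : IsProper F) (hF' : IsProper F') :
    ExpandsInto (1 / (1 - (m / M) ^ 2)) (projCone F') (projCone F) := by
  refine ⟨h.closure_subset hm hF', fun x hx y hy => ?_⟩
  rcases eq_or_ne x y with rfl | hxy
  · simp [hilbertDist_self]
  obtain ⟨u, hu, hux⟩ := hx
  obtain ⟨v, hv, hvy⟩ := hy
  obtain ⟨i₀⟩ := ‹Nonempty ι›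
  have huF := h.pos hm (fun i => (hu i).le) ⟨i₀, (hu i₀).ne'⟩
  have hvF := h.pos hm (fun i => (hv i).le) ⟨i₀, (hv i₀).ne'⟩
  rw [hF.hilbertDist_eq hxy hux hvy huF hvF, hF'.hilbertDist_eq hxy hux hvy hu hv]
  have hκ := h.one_sub_affinity_le hm hu hv
  have hC := one_div_one_sub_sq_gt_one hm hM
  set p := affinity (fun i => F i ⬝ᵥ u) (fun i => F i ⬝ᵥ v)
  set q := affinity (fun i => F' i ⬝ᵥ u) (fun i => F' i ⬝ᵥ v)
  have hp0 : 0 < p := affinity_pos huF hvF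
  have hq0 : 0 < q := affinity_pos hu hv
  set κ := 1 - (m / M) ^ 2
  have hκ0 : 0 < κ := by
    by_contra! h'
    have := div_nonpos_of_nonneg_of_nonpos zero_le_one h'
    linarith
  have hκ1 : κ ≤ 1 := sub_le_self _ (sq_nonneg _)
  have hB := rpow_one_add_le_one_add_mul_self (s := q - 1) (by linarith) hκ0.le hκ1
  have h1 : q ^ κ ≤ p := by
    rw [add_sub_cancel] at hB
    linarith
  have h2 : κ * Real.log q ≤ Real.log p := by
    rw [← Real.log_rpow hq0]
    exact Real.log_le_log (Real.rpow_pos_of_pos hq0 _) h1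
  rw [one_div p, one_div q, Real.log_inv, Real.log_inv, one_div κ, inv_mul_le_iff₀ hκ0]
  linarith

/-- A uniformly nested sequence of polyhedral domains shrinks to a point. -/
theorem exists_iInter_projCone_eq {m M : ℝ} (hm : 0 < m) (hM : m < M) {F : ℕ → ι → Fin 3 → ℝ}
    (hF : ∀ n, IsProper (F n)) (h : ∀ n, Refines m M (F n) (F (n + 1))) :
    ∃ x, ⋂ n, projCone (F n) = {x} := by
  have hsub : ∀ n, closure (projCone (F (n + 1))) ⊆ projCone (F n) := fun n =>
    (h n).closure_subset hm (hF _)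
  have hne : (⋂ n, closure (projCone (F n))).Nonempty := by
    refine IsCompact.nonempty_iInter_of_sequence_nonempty_isCompact_isClosed _
      (fun n => (hsub n).trans subset_closure) (fun n => ?_) isClosed_closure.isCompact
      fun n => isClosed_closure
    obtain ⟨v, hv⟩ := (hF n).nonempty
    obtain ⟨i⟩ := ‹Nonempty ι›
    have hv0 : v ≠ 0 := by
      rintro rfl
      simpa using hv i
    exact ⟨_, subset_closure ⟨v, hv, isLift_mk hv0⟩⟩
  obtain ⟨x, hx⟩ := hne
  rw [Set.mem_iInter] at hx
  have hx' : ∀ n, x ∈ projCone (F n) := fun n => hsub n (hx (n + 1))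
  refine ⟨x, subset_antisymm (fun y hy => ?_) (by simpa using hx')⟩
  rw [Set.mem_iInter] at hy
  -- a lift that is positive for `F 0` is positive for all `F n`
  have lift : ∀ z : Plane, (∀ n, z ∈ projCone (F n)) →
      ∃ w, IsLift w z ∧ ∀ n i, 0 < F n i ⬝ᵥ w := by
    intro z hz
    obtain ⟨w, hw, hwz⟩ := hz 0
    refine ⟨w, hwz, fun n => ?_⟩
    induction n with
    | zero => exact hw
    | succ n ih =>
      obtain ⟨w', hw', hwz'⟩ := hz (n + 1)
      obtain ⟨i⟩ := ‹Nonempty ι›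
      have hpos := (h n).pos hm (fun i => (hw' i).le) ⟨i, (hw' i).ne'⟩ i
      obtain ⟨c, hc, rfl⟩ := hwz'.exists_smul hwz
      have hi := ih i
      rw [dotProduct_smul, smul_eq_mul] at hi
      have hc0 : 0 < c := pos_of_mul_pos_left hi hpos.le
      intro j
      rw [dotProduct_smul, smul_eq_mul]
      exact mul_pos hc0 (hw' j)
  obtain ⟨u, hu, huF⟩ := lift x hx'
  obtain ⟨v, hv, hvF⟩ := lift y hy
  have hC := one_div_one_sub_sq_gt_one hm hM
  have hκ0 : 0 < 1 - (m / M) ^ 2 := by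
    by_contra! h'
    have := div_nonpos_of_nonneg_of_nonpos zero_le_one h'
    linarith
  have hz := eq_zero_of_le_mul_succ (κ := 1 - (m / M) ^ 2)
    (d := fun n => 1 - affinity (fun i => F n i ⬝ᵥ v) (fun i => F n i ⬝ᵥ u)) hκ0.le
    (sub_lt_self _ (pow_pos (div_pos hm (hm.trans hM)) 2))
    (fun n => sub_nonneg.2 (affinity_le_one (hvF n) (huF n)))
    (fun n => sub_le_self _ (affinity_pos (hvF n) (huF n)).le)
    (fun n => (h n).one_sub_affinity_le hm (hvF _) (huF _))
  have heq := eq_minRatio_smul (hvF 0) (huF 0) (sub_eq_zero.1 hz).symm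
  set r := minRatio (fun i => F 0 i ⬝ᵥ v) (fun i => F 0 i ⬝ᵥ u)
  have hr : v = r • u := by
    rw [← sub_eq_zero]
    refine (hF 0).salient _ fun i => ?_
    rw [dotProduct_sub, dotProduct_smul, smul_eq_mul, heq i, sub_self]
  have hr0 : r ≠ 0 := by
    intro h0
    exact hv.ne_zero (by rw [hr, h0, zero_smul])
  exact (hr ▸ hv).unique (hu.smul hr0)

end Nested

/-! ### Normal form of convex overmarked boxes -/

/-- The coordinates of `t` and `b` in a basis adapted to a convex overmarked box. -/
@[ext]
structure Param where
  t : ℝ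
  b : ℝ
  ht : |t| < 1
  hb : |b| < 1

/-- The effect of the elementary transformations on the coordinates of `t` and `b`. -/
def Param.rot (p : Param) : Param := ⟨p.b, -p.t, p.hb, by rw [abs_neg]; exact p.ht⟩

theorem Param.t_lt (p : Param) : p.t < 1 := (abs_lt.1 p.ht).2
theorem Param.lt_t (p : Param) : -1 < p.t := (abs_lt.1 p.ht).1
theorem Param.b_lt (p : Param) : p.b < 1 := (abs_lt.1 p.hb).2
theorem Param.lt_b (p : Param) : -1 < p.b := (abs_lt.1 p.hb).1

@[simp] theorem Param.rot_t (p : Param) : p.rot.t = p.b := rfl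
@[simp] theorem Param.rot_b (p : Param) : p.rot.b = -p.t := rfl

theorem Param.rot_rot_rot_rot (p : Param) : p.rot.rot.rot.rot = p := by
  ext <;> simp

/-- The point with the given nonzero homogeneous coordinates. -/
noncomputable abbrev pt (v : Fin 3 → ℝ) (h : v ≠ 0) : Plane := Projectivization.mk ℝ v h

theorem vec_ne_zero {x y z : ℝ} (h : x ≠ 0 ∨ y ≠ 0 ∨ z ≠ 0) : ![x, y, z] ≠ 0 := by
  intro h0
  have h1 := congrFun h0 0
  have h2 := congrFun h0 1
  have h3 := congrFun h0 2
  simp at h1 h2 h3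
  simp [h1, h2, h3] at h

/-- The standard convex overmarked box. -/
noncomputable def std (p : Param) : Box where
  p := pt ![-1, 1, 0] (vec_ne_zero (by simp))
  q := pt ![1, 1, 0] (vec_ne_zero (by simp))
  r := pt ![1, 0, 1] (vec_ne_zero (by simp))
  s := pt ![-1, 0, 1] (vec_ne_zero (by simp))
  t := pt ![p.t, 1, 0] (vec_ne_zero (by simp))
  b := pt ![p.b, 0, 1] (vec_ne_zero (by simp))

section lifts
variable (p : Param)
theorem std_p : IsLift ![-1, 1, 0] (std p).p := isLift_mk _
theorem std_q : IsLift ![1, 1, 0] (std p).q := isLift_mk _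
theorem std_r : IsLift ![1, 0, 1] (std p).r := isLift_mk _
theorem std_s : IsLift ![-1, 0, 1] (std p).s := isLift_mk _
theorem std_t : IsLift ![p.t, 1, 0] (std p).t := isLift_mk _
theorem std_b : IsLift ![p.b, 0, 1] (std p).b := isLift_mk _

theorem IsLift.of_eq_smul {v w : Fin 3 → ℝ} {x : Plane} (h : IsLift v x) (c : ℝ) (hc : c ≠ 0)
    (e : w = c • v) : IsLift w x := e ▸ h.smul hc

theorem cross_vec (a b c d e f : ℝ) :
    crossProduct ![a, b, c] ![d, e, f] = ![b * f - c * e, c * d - a * f, a * e - b * d] := by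
  simp [cross_apply]

theorem IsLift.join_vec {a b c d e f u v w : ℝ} {x y : Plane} (h : IsLift ![a, b, c] x)
    (h' : IsLift ![d, e, f] y) (k : ℝ) (hk : k ≠ 0) (hne : u ≠ 0 ∨ v ≠ 0 ∨ w ≠ 0)
    (h1 : b * f - c * e = k * u) (h2 : c * d - a * f = k * v) (h3 : a * e - b * d = k * w) :
    IsLift ![u, v, w] (PappusAnosov.join x y) ∧ x ≠ y := by
  have hc : crossProduct ![a, b, c] ![d, e, f] = k • ![u, v, w] := by
    rw [cross_vec, h1, h2, h3]
    simp
  have hn : crossProduct ![a, b, c] ![d, e, f] ≠ 0 := by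
    rw [hc]
    exact smul_ne_zero hk (vec_ne_zero hne)
  refine ⟨(h.join h' hn).of_eq_smul k⁻¹ (inv_ne_zero hk) ?_, h.ne_of_cross_ne_zero h' hn⟩
  rw [hc, smul_smul, inv_mul_cancel₀ hk, one_smul]

theorem std_T : IsLift ![0, 0, 1] (std p).lineT ∧ (std p).p ≠ (std p).q :=
  (std_p p).join_vec (std_q p) (-2) (by norm_num) (by simp) (by norm_num) (by norm_num)
    (by norm_num)
theorem std_B : IsLift ![0, 1, 0] (std p).lineB ∧ (std p).r ≠ (std p).s :=
  (std_r p).join_vec (std_s p) (-2) (by norm_num) (by simp) (by norm_num) (by norm_num)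
    (by norm_num)
theorem std_P : IsLift ![1, -p.t, 1] (std p).lineP ∧ (std p).t ≠ (std p).s :=
  (std_t p).join_vec (std_s p) 1 (by norm_num) (by simp) (by norm_num) (by norm_num)
    (by norm_num)
theorem std_Q : IsLift ![1, -p.t, -1] (std p).lineQ ∧ (std p).t ≠ (std p).r :=
  (std_t p).join_vec (std_r p) 1 (by norm_num) (by simp) (by norm_num) (by norm_num)
    (by norm_num)
theorem std_R : IsLift ![-1, 1, p.b] (std p).lineR ∧ (std p).b ≠ (std p).q :=
  (std_b p).join_vec (std_q p) 1 (by norm_num) (by simp) (by norm_num) (by norm_num)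
    (by norm_num)
theorem std_S : IsLift ![-1, -1, p.b] (std p).lineS ∧ (std p).b ≠ (std p).p :=
  (std_b p).join_vec (std_p p) 1 (by norm_num) (by simp) (by norm_num) (by norm_num)
    (by norm_num)
theorem std_TB : IsLift ![1, 0, 0] (join (std p).lineT (std p).lineB) ∧
    (std p).lineT ≠ (std p).lineB :=
  (std_T p).1.join_vec (std_B p).1 (-1) (by norm_num) (by simp) (by norm_num) (by norm_num)
    (by norm_num)
theorem std_QR : IsLift ![1 - p.t * p.b, 1 - p.b, 1 - p.t] (join (std p).lineQ (std p).lineR) ∧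
    (std p).lineQ ≠ (std p).lineR :=
  (std_Q p).1.join_vec (std_R p).1 1 (by norm_num)
    (Or.inr (Or.inl (sub_pos.2 p.b_lt).ne')) (by ring) (by ring) (by ring)
theorem std_PS : IsLift ![p.t * p.b - 1, 1 + p.b, 1 + p.t] (join (std p).lineP (std p).lineS) ∧
    (std p).lineP ≠ (std p).lineS :=
  (std_P p).1.join_vec (std_S p).1 (-1) (by norm_num)
    (Or.inr (Or.inl (by linarith [p.lt_b]))) (by ring) (by ring) (by ring)
theorem std_pr : IsLift ![1, 1, -1] (join (std p).p (std p).r) ∧ (std p).p ≠ (std p).r :=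
  (std_p p).join_vec (std_r p) 1 (by norm_num) (by simp) (by norm_num) (by norm_num)
    (by norm_num)
theorem std_qs : IsLift ![1, -1, 1] (join (std p).q (std p).s) ∧ (std p).q ≠ (std p).s :=
  (std_q p).join_vec (std_s p) 1 (by norm_num) (by simp) (by norm_num) (by norm_num)
    (by norm_num)
theorem std_prqs : IsLift ![0, 1, 1] (join (join (std p).p (std p).r) (join (std p).q (std p).s)) ∧
    join (std p).p (std p).r ≠ join (std p).q (std p).s :=
  (std_pr p).1.join_vec (std_qs p).1 (-2) (by norm_num) (by simp) (by norm_num) (by norm_num)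
    (by norm_num)

theorem std_isOvermarked : (std p).IsOvermarked where
  p_ne_q := (std_T p).2
  p_ne_t := by
    refine (std_p p).ne_of_cross_ne_zero (std_t p) ?_
    rw [cross_vec]
    exact vec_ne_zero (Or.inr (Or.inr (by linarith [p.lt_t])))
  q_ne_t := by
    refine (std_q p).ne_of_cross_ne_zero (std_t p) ?_
    rw [cross_vec]
    exact vec_ne_zero (Or.inr (Or.inr (by linarith [p.t_lt])))
  r_ne_s := (std_B p).2
  r_ne_b := by
    refine (std_r p).ne_of_cross_ne_zero (std_b p) ?_
    rw [cross_vec]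
    exact vec_ne_zero (Or.inr (Or.inl (by linarith [p.b_lt])))
  s_ne_b := by
    refine (std_s p).ne_of_cross_ne_zero (std_b p) ?_
    rw [cross_vec]
    exact vec_ne_zero (Or.inr (Or.inl (by linarith [p.lt_b])))
  t_mem := ((std_t p).incident_iff (std_T p).1).2 (by simp)
  b_mem := ((std_b p).incident_iff (std_B p).1).2 (by simp)
  T_ne_B := (std_TB p).2
  p_ne := (std_TB p).1.ne_of_cross_ne_zero (std_p p)
    (by rw [cross_vec]; exact vec_ne_zero (by norm_num))
  q_ne := (std_TB p).1.ne_of_cross_ne_zero (std_q p)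
    (by rw [cross_vec]; exact vec_ne_zero (by norm_num))
  r_ne := (std_TB p).1.ne_of_cross_ne_zero (std_r p)
    (by rw [cross_vec]; exact vec_ne_zero (by norm_num))
  s_ne := (std_TB p).1.ne_of_cross_ne_zero (std_s p)
    (by rw [cross_vec]; exact vec_ne_zero (by norm_num))
  t_ne := (std_TB p).1.ne_of_cross_ne_zero (std_t p)
    (by rw [cross_vec]; exact vec_ne_zero (by norm_num))
  b_ne := (std_TB p).1.ne_of_cross_ne_zero (std_b p)
    (by rw [cross_vec]; exact vec_ne_zero (by norm_num))

theorem std_isConvex : (std p).IsConvex := by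
  have h1 := p.t_lt
  have h2 := p.lt_t
  have h3 := p.b_lt
  have h4 := p.lt_b
  constructor
  · refine ⟨(std_T p).2, ((1 - p.t) / 2) • ![-1, 1, 0], ((1 + p.t) / 2) • ![1, 1, 0],
      (1 - p.t) / (1 + p.t), div_pos (by linarith) (by linarith),
      (std_p p).smul (by linarith), (std_q p).smul (by linarith),
      (std_t p).of_eq_smul 1 one_ne_zero ?_,
      (std_TB p).1.of_eq_smul (-(1 - p.t)) (by linarith) ?_⟩
    · ext k; fin_cases k <;> simp <;> ring
    · have : (1 + p.t) ≠ 0 := by linarith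
      ext k; fin_cases k <;> simp <;> field_simp <;> ring
  · refine ⟨(std_B p).2, ((1 + p.b) / 2) • ![1, 0, 1], ((1 - p.b) / 2) • ![-1, 0, 1],
      (1 + p.b) / (1 - p.b), div_pos (by linarith) (by linarith),
      (std_r p).smul (by linarith), (std_s p).smul (by linarith),
      (std_b p).of_eq_smul 1 one_ne_zero ?_,
      (std_TB p).1.of_eq_smul (1 + p.b) (by linarith) ?_⟩
    · ext k; fin_cases k <;> simp <;> ring
    · have : (1 - p.b) ≠ 0 := by linarith
      ext k; fin_cases k <;> simp <;> field_simp <;> ring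

end lifts

namespace Box

theorem map_map (g h : PGL(3, ℝ)) (Θ : Box) : (Θ.map h).map g = Θ.map (g * h) := by
  simp [Box.map, mul_smul]

theorem map_one (Θ : Box) : Θ.map 1 = Θ := by simp [Box.map]

theorem i_map (g : PGL(3, ℝ)) (Θ : Box) : (Θ.map g).i = Θ.i.map g := rfl

theorem j_map (g : PGL(3, ℝ)) (Θ : Box) : (Θ.map g).j = Θ.j.map g := rfl

theorem j_j (Θ : Box) : Θ.j.j = Θ := rfl

theorem IsOvermarked.map {Θ : Box} (h : Θ.IsOvermarked) (g : PGL(3, ℝ)) :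
    (Θ.map g).IsOvermarked := by
  have hT : (Θ.map g).lineT = mapLine g Θ.lineT := join_map g h.p_ne_q
  have hB : (Θ.map g).lineB = mapLine g Θ.lineB := join_map g h.r_ne_s
  have hTB : join (Θ.map g).lineT (Θ.map g).lineB = g • join Θ.lineT Θ.lineB := by
    rw [hT, hB, join_mapLine g h.T_ne_B]
  have inj : ∀ {x y : Plane}, x ≠ y → g • x ≠ g • y := fun h e => h (smul_left_cancel g e)
  exact
  { p_ne_q := inj h.p_ne_q
    p_ne_t := inj h.p_ne_t
    q_ne_t := inj h.q_ne_t
    r_ne_s := inj h.r_ne_s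
    r_ne_b := inj h.r_ne_b
    s_ne_b := inj h.s_ne_b
    t_mem := by rw [hT]; exact incident_map g _ _ h.t_mem
    b_mem := by rw [hB]; exact incident_map g _ _ h.b_mem
    T_ne_B := by rw [hT, hB]; exact fun e => h.T_ne_B (mapLine_injective g e)
    p_ne := by rw [hTB]; exact inj h.p_ne
    q_ne := by rw [hTB]; exact inj h.q_ne
    r_ne := by rw [hTB]; exact inj h.r_ne
    s_ne := by rw [hTB]; exact inj h.s_ne
    t_ne := by rw [hTB]; exact inj h.t_ne
    b_ne := by rw [hTB]; exact inj h.b_ne }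

end Box

theorem Separates.map {x y z w : Plane} (h : Separates x y z w) (g : PGL(3, ℝ)) :
    Separates (g • x) (g • y) (g • z) (g • w) := by
  obtain ⟨M, rfl⟩ := cls_surjective g
  obtain ⟨hne, u, v, k, hk, h1, h2, h3, h4⟩ := h
  refine ⟨fun e => hne (smul_left_cancel _ e), _, _, k, hk, h1.map M, h2.map M, ?_, ?_⟩
  · rw [← Matrix.mulVec_add]; exact h3.map M
  · rw [← Matrix.mulVec_smul, ← Matrix.mulVec_sub]; exact h4.map M

theorem Box.IsConvex.map {Θ : Box} (h : Θ.IsConvex) (ho : Θ.IsOvermarked) (g : PGL(3, ℝ)) :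
    (Θ.map g).IsConvex := by
  have hTB : join (Θ.map g).lineT (Θ.map g).lineB = g • join Θ.lineT Θ.lineB := by
    rw [show (Θ.map g).lineT = mapLine g Θ.lineT from join_map g ho.p_ne_q,
      show (Θ.map g).lineB = mapLine g Θ.lineB from join_map g ho.r_ne_s,
      join_mapLine g ho.T_ne_B]
  refine ⟨?_, ?_⟩
  · rw [hTB]; exact h.1.map g
  · rw [hTB]; exact h.2.map g

/-- Every convex overmarked box is projectively equivalent to a standard one. -/
theorem exists_eq_std_map {Θ : Box} (ho : Θ.IsOvermarked) (h : Θ.IsConvex) :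
    ∃ (g : PGL(3, ℝ)) (p : Param), Θ = (std p).map g := by
  obtain ⟨⟨-, u, v, k, hk, hu, hv, huv, hw⟩, ⟨-, u', v', k', hk', hu', hv', huv', hw'⟩⟩ := h
  obtain ⟨μ, hμ, hw2⟩ := hw'.exists_smul hw
  -- the columns of the matrix are chosen so that `p`, `q`, `r`, `s` have the lifts
  -- `u`, `k v`, `μ u'`, `μ k' v'` up to sign
  have hr : u' ⬝ᵥ crossProduct u v ≠ 0 := by
    intro h0
    have hT := hu.join hv (hu.cross_ne_zero hv ho.p_ne_q)
    have h1 : Incident Θ.r Θ.lineT := (hu'.incident_iff hT).2 h0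
    have h2 : Incident Θ.r Θ.lineB := Projectivization.orthogonal_cross_left ho.r_ne_s
    exact ho.r_ne (join_eq_of_incident ho.T_ne_B h1 h2)
  let M : Matrix (Fin 3) (Fin 3) ℝ := Matrix.of fun i =>
    ![(k * v i - u i) / 2, (k * v i + u i) / 2, -(μ * (u' i + k' * v' i)) / 2]
  have hw3 : ∀ i, u i - k * v i = μ * (u' i - k' * v' i) := fun i => by
    have := congrFun hw2 i
    simpa using this
  have hdet : M.det = μ * k / 2 * (u' ⬝ᵥ crossProduct u v) := by
    have e : ∀ i, μ * (u' i + k' * v' i) = 2 * μ * u' i - (u i - k * v i) := fun i => by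
      rw [hw3]; ring
    simp only [M, Matrix.det_fin_three, Matrix.of_apply, e, cross_apply, vec3_dotProduct]
    simp
    ring
  have hdet0 : M.det ≠ 0 := by
    rw [hdet]
    exact mul_ne_zero (div_ne_zero (mul_ne_zero hμ hk.ne') two_ne_zero) hr
  let G : GL (Fin 3) ℝ := Matrix.GeneralLinearGroup.mkOfDetNeZero M hdet0
  have hG : ∀ x y z : ℝ, G.1 *ᵥ ![x, y, z] = fun i => (k * v i - u i) / 2 * x +
      (k * v i + u i) / 2 * y + -(μ * (u' i + k' * v' i)) / 2 * z := by
    intro x y z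
    change M *ᵥ _ = _
    ext i
    simp [M, Matrix.mulVec, dotProduct, Fin.sum_univ_three]
  have hk1 : 1 + k ≠ 0 := by positivity
  have hk2 : 1 + k' ≠ 0 := by positivity
  refine ⟨cls G, ⟨(1 - k) / (1 + k), (k' - 1) / (1 + k'), ?_, ?_⟩, ?_⟩
  · rw [abs_div, abs_of_pos (by positivity : 0 < 1 + k), div_lt_one (by positivity), abs_lt]
    constructor <;> linarith
  · rw [abs_div, abs_of_pos (by positivity : 0 < 1 + k'), div_lt_one (by positivity), abs_lt]
    constructor <;> linarith
  · have lift : ∀ {x y : Plane} {a b c s : ℝ} {w : Fin 3 → ℝ}, IsLift w x →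
        IsLift ![a, b, c] y → s ≠ 0 → (∀ i, (k * v i - u i) / 2 * a +
      (k * v i + u i) / 2 * b + -(μ * (u' i + k' * v' i)) / 2 * c = s * w i) →
        x = cls G • y := by
      intro x y a b c s w hx hy hs h
      refine (hx.of_eq_smul (w := G.1 *ᵥ ![a, b, c]) s hs ?_).unique (hy.map G)
      rw [hG]
      ext i
      simpa using h i
    ext1
    · exact lift hu (std_p _) one_ne_zero fun i => by ring
    · exact lift hv (std_q _) hk.ne' fun i => by ring
    · exact lift hu' (std_r _) (neg_ne_zero.2 hμ) fun i => by linear_combination (-1/2) * hw3 i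
    · exact lift hv' (std_s _) (neg_ne_zero.2 (mul_ne_zero hμ hk'.ne')) fun i => by
        linear_combination (1/2) * hw3 i
    · refine lift huv (std_t _) (s := k / (1 + k)) (by positivity) fun i => ?_
      simp only [Pi.add_apply]
      field_simp
      ring
    · refine lift huv' (std_b _) (s := -(μ * k' / (1 + k')))
        (neg_ne_zero.2 (by positivity)) fun i => ?_
      simp only [Pi.add_apply]
      field_simp
      linear_combination ((1 - k')) * hw3 i

/-! ### The elementary transformations in normal form -/

/-- The invertible matrix with the given rows. -/
noncomputable abbrev gl (M : Matrix (Fin 3) (Fin 3) ℝ) (h : M.det ≠ 0) : GL (Fin 3) ℝ :=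
  Matrix.GeneralLinearGroup.mkOfDetNeZero M h

/-- The basis change of the elementary transformation `i`. -/
noncomputable def matN : GL (Fin 3) ℝ :=
  gl !![1, 0, 0; 0, 0, -1; 0, 1, 0] (by simp [Matrix.det_fin_three])

/-- The basis change of the involution `j`. -/
noncomputable def matJ : GL (Fin 3) ℝ :=
  gl !![-1, 0, 0; 0, 1, 0; 0, 0, 1] (by simp [Matrix.det_fin_three])

theorem Param.one_sub_sq_pos (p : Param) : 0 < 1 - p.t ^ 2 ∧ 0 < 1 - p.b ^ 2 :=
  ⟨by nlinarith [p.t_lt, p.lt_t], by nlinarith [p.b_lt, p.lt_b]⟩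

/-- The basis change of the elementary transformation `τ₁`. -/
noncomputable def matK (p : Param) : GL (Fin 3) ℝ :=
  gl !![1 - p.t * p.b, p.t - p.b, p.t * (1 - p.t * p.b);
        p.t - p.b, 1 - p.t * p.b, 1 - p.t * p.b;
        0, 0, 1 - p.t ^ 2] (by
    have h := p.one_sub_sq_pos
    have e : Matrix.det !![1 - p.t * p.b, p.t - p.b, p.t * (1 - p.t * p.b);
        p.t - p.b, 1 - p.t * p.b, 1 - p.t * p.b;
        0, 0, 1 - p.t ^ 2] = (1 - p.t ^ 2) ^ 2 * (1 - p.b ^ 2) := by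
      simp [Matrix.det_fin_three]; ring
    rw [e]
    exact (mul_pos (pow_pos h.1 2) h.2).ne')

/-- The basis change of the second Pappus transformation `i τ₁⁻¹ i`, up to a scalar. -/
noncomputable def matL (p : Param) : GL (Fin 3) ℝ :=
  gl !![1 - p.t * p.b, -(1 - p.t * p.b) * p.b, p.t - p.b;
        0, 1 - p.b ^ 2, 0;
        p.t - p.b, 1 - p.t * p.b, 1 - p.t * p.b] (by
    have h := p.one_sub_sq_pos
    have e : Matrix.det !![1 - p.t * p.b, -(1 - p.t * p.b) * p.b, p.t - p.b;
        0, 1 - p.b ^ 2, 0;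
        p.t - p.b, 1 - p.t * p.b, 1 - p.t * p.b] = (1 - p.b ^ 2) ^ 2 * (1 - p.t ^ 2) := by
      simp [Matrix.det_fin_three]; ring
    rw [e]
    exact (mul_pos (pow_pos h.2 2) h.1).ne')

theorem coe_matN : (matN : Matrix _ _ ℝ) = !![1, 0, 0; 0, 0, -1; 0, 1, 0] := rfl
theorem coe_matJ : (matJ : Matrix _ _ ℝ) = !![-1, 0, 0; 0, 1, 0; 0, 0, 1] := rfl
theorem coe_matK (p : Param) : (matK p : Matrix _ _ ℝ) =
    !![1 - p.t * p.b, p.t - p.b, p.t * (1 - p.t * p.b);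
       p.t - p.b, 1 - p.t * p.b, 1 - p.t * p.b; 0, 0, 1 - p.t ^ 2] := rfl
theorem coe_matL (p : Param) : (matL p : Matrix _ _ ℝ) =
    !![1 - p.t * p.b, -(1 - p.t * p.b) * p.b, p.t - p.b;
        0, 1 - p.b ^ 2, 0; p.t - p.b, 1 - p.t * p.b, 1 - p.t * p.b] := rfl

theorem mulVec_vec (m₁ m₂ m₃ m₄ m₅ m₆ m₇ m₈ m₉ x y z : ℝ) :
    !![m₁, m₂, m₃; m₄, m₅, m₆; m₇, m₈, m₉] *ᵥ ![x, y, z] =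
      ![m₁ * x + m₂ * y + m₃ * z, m₄ * x + m₅ * y + m₆ * z, m₇ * x + m₈ * y + m₉ * z] := by
  ext i
  fin_cases i <;> simp [Matrix.mulVec, dotProduct, Fin.sum_univ_three]

/-- A point with a lift proportional to the image of a lift. -/
theorem IsLift.eq_smul_of {x y : Plane} {v : Fin 3 → ℝ} {a b c : ℝ} (M : GL (Fin 3) ℝ)
    (hx : IsLift ![a, b, c] x) (hy : IsLift v y) (k : ℝ) (hk : k ≠ 0)
    (h : M.1 *ᵥ v = ![k * a, k * b, k * c]) : x = cls M • y := by
  refine (hx.of_eq_smul k hk ?_).unique (hy.map M)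
  rw [h]
  simp

theorem std_i (p : Param) : (std p).i = (std p.rot).map (cls matN) := by
  ext1
  · exact (std_s p).eq_smul_of matN (std_p p.rot) 1 one_ne_zero
      (by rw [coe_matN, mulVec_vec]; simp)
  · exact (std_r p).eq_smul_of matN (std_q p.rot) 1 one_ne_zero
      (by rw [coe_matN, mulVec_vec]; simp)
  · exact (std_p p).eq_smul_of matN (std_r p.rot) (-1) (by norm_num)
      (by rw [coe_matN, mulVec_vec]; simp)
  · exact (std_q p).eq_smul_of matN (std_s p.rot) (-1) (by norm_num)
      (by rw [coe_matN, mulVec_vec]; simp)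
  · exact (std_b p).eq_smul_of matN (std_t p.rot) 1 one_ne_zero
      (by rw [coe_matN, mulVec_vec]; simp)
  · exact (std_t p).eq_smul_of matN (std_b p.rot) (-1) (by norm_num)
      (by rw [coe_matN, mulVec_vec]; simp)

theorem std_j (p : Param) : (std p).j = (std p.rot.rot).map (cls matJ) := by
  ext1
  · exact (std_q p).eq_smul_of matJ (std_p p.rot.rot) 1 one_ne_zero
      (by rw [coe_matJ, mulVec_vec]; simp)
  · exact (std_p p).eq_smul_of matJ (std_q p.rot.rot) 1 one_ne_zero
      (by rw [coe_matJ, mulVec_vec]; simp)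
  · exact (std_s p).eq_smul_of matJ (std_r p.rot.rot) 1 one_ne_zero
      (by rw [coe_matJ, mulVec_vec]; simp)
  · exact (std_r p).eq_smul_of matJ (std_s p.rot.rot) 1 one_ne_zero
      (by rw [coe_matJ, mulVec_vec]; simp)
  · exact (std_t p).eq_smul_of matJ (std_t p.rot.rot) 1 one_ne_zero
      (by rw [coe_matJ, mulVec_vec]; simp)
  · exact (std_b p).eq_smul_of matJ (std_b p.rot.rot) 1 one_ne_zero
      (by rw [coe_matJ, mulVec_vec]; simp)

theorem std_tau1 (p : Param) : (std p).tau1 = (std p.rot).map (cls (matK p)) := by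
  have h1 := p.t_lt
  have h2 := p.lt_t
  have h3 := p.b_lt
  have h4 := p.lt_b
  ext1
  · refine (std_p p).eq_smul_of (matK p) (std_p p.rot) ((1 - p.t) * (1 + p.b))
      (mul_pos (by linarith) (by linarith)).ne' ?_
    rw [coe_matK, mulVec_vec]; congrm ![?_, ?_, ?_] <;> ring
  · refine (std_q p).eq_smul_of (matK p) (std_q p.rot) ((1 + p.t) * (1 - p.b))
      (mul_pos (by linarith) (by linarith)).ne' ?_
    rw [coe_matK, mulVec_vec]; congrm ![?_, ?_, ?_] <;> ring
  · refine (std_QR p).1.eq_smul_of (matK p) (std_r p.rot) (1 + p.t) (by linarith) ?_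
    rw [coe_matK, mulVec_vec]; congrm ![?_, ?_, ?_] <;> ring
  · refine (std_PS p).1.eq_smul_of (matK p) (std_s p.rot) (1 - p.t) (by linarith) ?_
    rw [coe_matK, mulVec_vec]; congrm ![?_, ?_, ?_] <;> ring
  · refine (std_t p).eq_smul_of (matK p) (std_t p.rot) (1 - p.b ^ 2) p.one_sub_sq_pos.2.ne' ?_
    rw [coe_matK, mulVec_vec, p.rot_t]; congrm ![?_, ?_, ?_] <;> ring
  · refine (std_prqs p).1.eq_smul_of (matK p) (std_b p.rot) (1 - p.t ^ 2)
      p.one_sub_sq_pos.1.ne' ?_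
    rw [coe_matK, mulVec_vec, p.rot_b]; congrm ![?_, ?_, ?_] <;> ring

theorem std_map_tau1 (g : PGL(3, ℝ)) (p : Param) :
    ((std p).map g).tau1 = (std p).tau1.map g := by
  have hP : ((std p).map g).lineP = mapLine g (std p).lineP := join_map g (std_P p).2
  have hQ : ((std p).map g).lineQ = mapLine g (std p).lineQ := join_map g (std_Q p).2
  have hR : ((std p).map g).lineR = mapLine g (std p).lineR := join_map g (std_R p).2
  have hS : ((std p).map g).lineS = mapLine g (std p).lineS := join_map g (std_S p).2
  ext1
  · rfl
  · rfl
  · exact (congrArg₂ join hQ hR).trans (join_mapLine g (std_QR p).2)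
  · exact (congrArg₂ join hP hS).trans (join_mapLine g (std_PS p).2)
  · rfl
  · exact (congrArg₂ join (join_map g (std_pr p).2) (join_map g (std_qs p).2)).trans
      (join_mapLine g (std_prqs p).2)

theorem std_map_dual (g : PGL(3, ℝ)) (p : Param) :
    ((std p).map g).dual = (std p).dual.map (contragredient g) := by
  ext1
  · exact join_map g (std_P p).2
  · exact join_map g (std_Q p).2
  · exact join_map g (std_R p).2
  · exact join_map g (std_S p).2
  · exact join_map g (std_T p).2
  · exact join_map g (std_B p).2

/-- A projective transformation that fixes the four vertices of the standard box is trivial. -/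
theorem cls_eq_one_of_vertices (X : GL (Fin 3) ℝ)
    (hp : ∃ k : ℝ, X.1 *ᵥ ![-1, 1, 0] = k • ![-1, 1, 0])
    (hq : ∃ k : ℝ, X.1 *ᵥ ![1, 1, 0] = k • ![1, 1, 0])
    (hr : ∃ k : ℝ, X.1 *ᵥ ![1, 0, 1] = k • ![1, 0, 1])
    (hs : ∃ k : ℝ, X.1 *ᵥ ![-1, 0, 1] = k • ![-1, 0, 1]) : cls X = 1 := by
  obtain ⟨a, ha⟩ := hp
  obtain ⟨b, hb⟩ := hq
  obtain ⟨c, hc⟩ := hr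
  obtain ⟨d, hd⟩ := hs
  have ev : ∀ i, ∀ x y z : ℝ, (X.1 *ᵥ ![x, y, z]) i = X.1 i 0 * x + X.1 i 1 * y + X.1 i 2 * z :=
    fun i x y z => by simp [Matrix.mulVec, dotProduct, Fin.sum_univ_three]
  have h0 : ∀ i, _ := fun i => (ev i (-1) 1 0).symm.trans (congrFun ha i)
  have h1 : ∀ i, _ := fun i => (ev i 1 1 0).symm.trans (congrFun hb i)
  have h2 : ∀ i, _ := fun i => (ev i 1 0 1).symm.trans (congrFun hc i)
  have h3 : ∀ i, _ := fun i => (ev i (-1) 0 1).symm.trans (congrFun hd i)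
  have e00 := h0 0
  have e01 := h0 1
  have e02 := h0 2
  have e10 := h1 0
  have e11 := h1 1
  have e12 := h1 2
  have e20 := h2 0
  have e21 := h2 1
  have e22 := h2 2
  have e30 := h3 0
  have e31 := h3 1
  have e32 := h3 2
  simp at e00 e01 e02 e10 e11 e12 e20 e21 e22 e30 e31 e32
  have hdiag : X.1 = a • (1 : Matrix (Fin 3) (Fin 3) ℝ) := by
    ext i k
    fin_cases i <;> fin_cases k <;> simp <;> linarith
  have ha0 : a ≠ 0 := by
    rintro rfl
    have := X.det_ne_zero
    rw [hdiag] at this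
    simp at this
  have : X = Matrix.GeneralLinearGroup.scalar (Fin 3) (Units.mk0 a ha0) := by
    ext1
    rw [hdiag, Matrix.GeneralLinearGroup.coe_scalar]
    ext i k
    fin_cases i <;> fin_cases k <;> simp
  rw [cls, this, Matrix.ProjGenLinGroup.mk_scalar]

theorem exists_smul_of_smul_eq {v : Fin 3 → ℝ} {x : Plane} (hx : IsLift v x) {M : GL (Fin 3) ℝ}
    (h : cls M • x = x) : ∃ k : ℝ, M.1 *ᵥ v = k • v := by
  have h1 := hx.map M
  rw [h] at h1
  obtain ⟨k, -, hk⟩ := hx.exists_smul h1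
  exact ⟨k, hk⟩

theorem eq_of_std_map_eq {g g' : PGL(3, ℝ)} {p p' : Param}
    (h : (std p).map g = (std p').map g') : g = g' := by
  obtain ⟨M, hM⟩ := cls_surjective (g'⁻¹ * g)
  rw [eq_comm, ← inv_mul_eq_one, ← hM]
  have key : ∀ {x : Plane}, g • x = g' • x → cls M • x = x := by
    intro x hx
    rw [hM, mul_smul, hx, inv_smul_smul]
  exact cls_eq_one_of_vertices M
    (exists_smul_of_smul_eq (std_p p) (key (congrArg Box.p h)))
    (exists_smul_of_smul_eq (std_q p) (key (congrArg Box.q h)))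
    (exists_smul_of_smul_eq (std_r p) (key (congrArg Box.r h)))
    (exists_smul_of_smul_eq (std_s p) (key (congrArg Box.s h)))

theorem std_map_sigma (lam : ℝ × ℝ) (g : PGL(3, ℝ)) (p : Param) :
    ((std p).map g).sigma lam = (std p).map (g * cls (sigmaMatrix lam)) := by
  have hex : ∃ M : GL (Fin 3) ℝ, ((std p).map g).IsBasis M := by
    obtain ⟨M, rfl⟩ := cls_surjective g
    exact ⟨M, (std_p p).map M, (std_q p).map M, (std_r p).map M, (std_s p).map M⟩
  rw [Box.sigma, dif_pos hex, Box.map_map]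
  congr 1
  obtain ⟨h1, h2, h3, h4⟩ := hex.choose_spec
  -- the chosen basis agrees with the one given by `g` up to a scalar
  have hg : cls hex.choose = g := by
    obtain ⟨X, hX⟩ := cls_surjective (g⁻¹ * cls hex.choose)
    have key : ∀ {v : Fin 3 → ℝ} {x : Plane}, IsLift v x →
        IsLift (hex.choose.1 *ᵥ v) (g • x) → ∃ k : ℝ, X.1 *ᵥ v = k • v := by
      intro v x hv h
      refine exists_smul_of_smul_eq hv ?_
      rw [hX, mul_smul, (hv.map _).unique h, inv_smul_smul]
    have := cls_eq_one_of_vertices X (key (std_p p) h1) (key (std_q p) h2) (key (std_r p) h3)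
      (key (std_s p) h4)
    rw [hX, inv_mul_eq_one] at this
    exact this.symm
  change cls (hex.choose * sigmaMatrix lam * hex.choose⁻¹) * g = _
  rw [cls_mul, cls_mul, cls_inv, hg, inv_mul_cancel_right]

theorem std_map_newI (lam : ℝ × ℝ) (g : PGL(3, ℝ)) (p : Param) :
    ((std p).map g).newI lam = (std p.rot).map (g * cls matN * cls (sigmaMatrix lam)) := by
  rw [Box.newI, Box.i_map, std_i, Box.map_map, std_map_sigma]

theorem std_map_newTau1 (lam : ℝ × ℝ) (g : PGL(3, ℝ)) (p : Param) :
    ((std p).map g).newTau1 lam =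
      (std p.rot).map (g * cls (matK p) * cls (sigmaMatrix lam)) := by
  rw [Box.newTau1, std_map_tau1, std_tau1, Box.map_map, std_map_sigma]

theorem std_map_j (g : PGL(3, ℝ)) (p : Param) :
    ((std p).map g).j = (std p.rot.rot).map (g * cls matJ) := by
  rw [Box.j_map, std_j, Box.map_map]

/-! ### Relations between the basis changes -/

theorem cls_eq_of_eq_smul {M N : GL (Fin 3) ℝ} (c : ℝ) (hc : c ≠ 0) (h : N.1 = c • M.1) :
    cls M = cls N := by
  rw [cls, cls, Matrix.ProjGenLinGroup.mk_eq_mk_iff]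
  refine ⟨Units.mk0 c hc, ?_⟩
  ext1
  rw [h, Units.val_mul, Matrix.GeneralLinearGroup.coe_scalar]
  ext i k
  simp [Matrix.mul_apply, Matrix.scalar_apply, Matrix.diagonal_apply, mul_comm]

theorem coe_sigmaMatrix (lam : ℝ × ℝ) : (sigmaMatrix lam : Matrix _ _ ℝ) =
    !![1, 0, 0;
       0, Real.exp (-lam.2) * Real.cosh lam.1, -Real.sinh lam.1;
       0, -Real.sinh lam.1, Real.exp lam.2 * Real.cosh lam.1] := rfl

theorem exp_mul_cosh_relation (lam : ℝ × ℝ) :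
    Real.exp (-lam.2) * Real.cosh lam.1 * (Real.exp lam.2 * Real.cosh lam.1) -
      Real.sinh lam.1 * Real.sinh lam.1 = 1 := by
  have h : Real.exp (-lam.2) * Real.exp lam.2 = 1 := by rw [← Real.exp_add]; simp
  have h2 := Real.cosh_sq lam.1
  linear_combination Real.cosh lam.1 ^ 2 * h + h2

/-- The reparametrization `σ` cancels along `i`, because the lower block of `Σ` is symmetric with
determinant one. -/
theorem sigma_N_sigma (lam : ℝ × ℝ) :
    cls (sigmaMatrix lam) * cls matN * cls (sigmaMatrix lam) = cls matN := by
  rw [← cls_mul, ← cls_mul]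
  refine cls_eq_of_eq_smul 1 one_ne_zero ?_
  have h := exp_mul_cosh_relation lam
  rw [Units.val_mul, Units.val_mul, coe_matN, coe_sigmaMatrix, one_smul]
  ext i k
  fin_cases i <;> fin_cases k <;> simp [Matrix.mul_apply, Fin.sum_univ_three] <;>
    first | ring1 | linear_combination h | linear_combination -h

theorem N_mul_N : cls matN * cls matN = cls matJ := by
  rw [← cls_mul]
  refine cls_eq_of_eq_smul (-1) (by norm_num) ?_
  rw [Units.val_mul, coe_matN, coe_matJ]
  ext i k
  fin_cases i <;> fin_cases k <;> simp [Matrix.mul_apply, Fin.sum_univ_three]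

theorem J_mul_J : cls matJ * cls matJ = 1 := by
  rw [← cls_mul, ← map_one Matrix.ProjGenLinGroup.mk]
  refine cls_eq_of_eq_smul 1 one_ne_zero ?_
  rw [Units.val_mul, coe_matJ, Units.val_one, one_smul]
  ext i k
  fin_cases i <;> fin_cases k <;> simp

theorem J_comm_sigma (lam : ℝ × ℝ) :
    cls matJ * cls (sigmaMatrix lam) = cls (sigmaMatrix lam) * cls matJ := by
  rw [← cls_mul, ← cls_mul]
  refine cls_eq_of_eq_smul 1 one_ne_zero ?_
  rw [Units.val_mul, Units.val_mul, coe_matJ, coe_sigmaMatrix, one_smul]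
  ext i k
  fin_cases i <;> fin_cases k <;> simp [Matrix.mul_apply, Fin.sum_univ_three]

theorem J_comm_N : cls matJ * cls matN = cls matN * cls matJ := by
  rw [← N_mul_N, mul_assoc]

theorem K_rot_rot (p : Param) : cls (matK p.rot.rot) = cls matJ * cls (matK p) * cls matJ := by
  rw [← cls_mul, ← cls_mul]
  refine cls_eq_of_eq_smul 1 one_ne_zero ?_
  rw [Units.val_mul, Units.val_mul, coe_matJ, coe_matK, coe_matK, one_smul]
  ext i k
  fin_cases i <;> fin_cases k <;> simp [Matrix.mul_apply, Fin.sum_univ_three] <;> ring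

/-- The square of `K N J` gives the second Pappus transformation. -/
theorem KNJ_sq_N (p : Param) :
    (cls (matK p) * cls matN * cls matJ) ^ 2 * cls matN = cls (matL p.rot.rot) * cls matJ := by
  have h := p.one_sub_sq_pos
  rw [← cls_mul, ← cls_mul, ← map_pow, ← map_mul, ← cls_mul]
  symm
  refine cls_eq_of_eq_smul (-(1 - p.t ^ 2)) (neg_ne_zero.2 h.1.ne') ?_
  rw [pow_two, Units.val_mul, Units.val_mul, Units.val_mul, Units.val_mul, Units.val_mul, coe_matJ,
    coe_matK, coe_matN, coe_matL]
  ext i k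
  fin_cases i <;> fin_cases k <;> simp [Matrix.mul_apply, Fin.sum_univ_three] <;> ring

theorem L_N_K (p : Param) : cls (matL p.rot.rot) * cls matN * cls (matK p) = cls matN := by
  have h := p.one_sub_sq_pos
  rw [← cls_mul, ← cls_mul]
  symm
  refine cls_eq_of_eq_smul ((1 - p.t ^ 2) * (1 - p.b ^ 2)) (mul_pos h.1 h.2).ne' ?_
  rw [Units.val_mul, Units.val_mul, coe_matK, coe_matN, coe_matL]
  ext i k
  fin_cases i <;> fin_cases k <;> simp [Matrix.mul_apply, Fin.sum_univ_three] <;> ring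

/-- The matrix `K N J` has order three, which is a form of Pappus' theorem. -/
theorem KNJ_cube (p : Param) : (cls (matK p) * cls matN * cls matJ) ^ 3 = 1 := by
  have hN : cls matJ * (cls matN)⁻¹ = cls matN := by rw [← N_mul_N]; group
  calc (cls (matK p) * cls matN * cls matJ) ^ 3
      = ((cls (matK p) * cls matN * cls matJ) ^ 2 * cls matN) * (cls matN)⁻¹ *
          (cls (matK p) * cls matN * cls matJ) := by
        rw [mul_inv_cancel_right, pow_succ]
    _ = (cls (matL p.rot.rot) * (cls matJ * (cls matN)⁻¹) * cls (matK p)) *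
          (cls matN * cls matJ) := by
        rw [KNJ_sq_N]
        group
    _ = 1 := by rw [hN, L_N_K, ← mul_assoc, N_mul_N, J_mul_J]

/-! ### The convex interior of a box and its dual domain -/

/-- The functionals defining the interior of the standard box. -/
def facet : Fin 4 → Fin 3 → ℝ := ![![1, 1, 1], ![-1, 1, 1], ![0, 1, 0], ![0, 0, 1]]

/-- Lifts of the vertices of the standard box. -/
def vertex : Fin 4 → Fin 3 → ℝ := ![![-1, 1, 0], ![1, 1, 0], ![1, 0, 1], ![-1, 0, 1]]

/-- The functionals defining the image of the interior of the standard box. -/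
noncomputable def facets (M : GL (Fin 3) ℝ) (i : Fin 4) : Fin 3 → ℝ := (M⁻¹).1ᵀ *ᵥ facet i

/-- The vertices of the image of the standard box, which are the functionals defining the domain
dual to its interior. -/
def vertices (M : GL (Fin 3) ℝ) (i : Fin 4) : Fin 3 → ℝ := M.1 *ᵥ vertex i

theorem facets_dotProduct (M : GL (Fin 3) ℝ) (i : Fin 4) (v : Fin 3 → ℝ) :
    facets M i ⬝ᵥ (M.1 *ᵥ v) = facet i ⬝ᵥ v := by
  rw [facets, dotProduct_comm, dotProduct_inv_transpose, dotProduct_comm]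

theorem vertices_dotProduct (M : GL (Fin 3) ℝ) (i : Fin 4) (v : Fin 3 → ℝ) :
    vertices M i ⬝ᵥ ((M⁻¹).1ᵀ *ᵥ v) = vertex i ⬝ᵥ v := dotProduct_inv_transpose _ _ _

theorem mulVec_inv_mulVec (M : GL (Fin 3) ℝ) (v : Fin 3 → ℝ) : M.1 *ᵥ ((M⁻¹).1 *ᵥ v) = v := by
  rw [Matrix.mulVec_mulVec, ← Units.val_mul, mul_inv_cancel, Units.val_one, Matrix.one_mulVec]

theorem transpose_inv_mulVec (M : GL (Fin 3) ℝ) (v : Fin 3 → ℝ) :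
    (M⁻¹).1ᵀ *ᵥ (M.1ᵀ *ᵥ v) = v := by
  rw [Matrix.mulVec_mulVec, ← Matrix.transpose_mul, ← Units.val_mul, mul_inv_cancel,
    Units.val_one, Matrix.transpose_one, Matrix.one_mulVec]

theorem vec_eta (v : Fin 3 → ℝ) : v = ![v 0, v 1, v 2] := by
  ext i; fin_cases i <;> rfl

theorem forall_facet {P : ℝ → Prop} (v : Fin 3 → ℝ) : (∀ i, P (facet i ⬝ᵥ v)) ↔
    P (v 0 + v 1 + v 2) ∧ P (-v 0 + v 1 + v 2) ∧ P (v 1) ∧ P (v 2) := by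
  rw [Fin.forall_fin_succ, Fin.forall_fin_succ, Fin.forall_fin_succ, Fin.forall_fin_succ]
  simp [facet, dotProduct, Fin.sum_univ_three]

theorem forall_vertex {P : ℝ → Prop} (v : Fin 3 → ℝ) : (∀ i, P (vertex i ⬝ᵥ v)) ↔
    P (-v 0 + v 1) ∧ P (v 0 + v 1) ∧ P (v 0 + v 2) ∧ P (-v 0 + v 2) := by
  rw [Fin.forall_fin_succ, Fin.forall_fin_succ, Fin.forall_fin_succ, Fin.forall_fin_succ]
  simp [vertex, dotProduct, Fin.sum_univ_three]

theorem isProper_facets (M : GL (Fin 3) ℝ) : IsProper (facets M) := by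
  constructor
  · intro v hv
    rw [← mulVec_inv_mulVec M v] at hv ⊢
    simp only [facets_dotProduct] at hv
    obtain ⟨h1, h2, h3, h4⟩ := (forall_facet (P := fun x => x = 0) _).1 hv
    set w := (M⁻¹).1 *ᵥ v
    have : w = 0 := by
      rw [vec_eta w]
      ext i
      fin_cases i <;> simp <;> linarith
    rw [this, Matrix.mulVec_zero]
  · refine ⟨M.1 *ᵥ ![0, 1, 1], ?_⟩
    simp only [facets_dotProduct]
    rw [forall_facet (P := fun x => 0 < x)]
    simp

theorem isProper_vertices (M : GL (Fin 3) ℝ) : IsProper (vertices M) := by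
  constructor
  · intro v hv
    rw [← transpose_inv_mulVec M v] at hv ⊢
    simp only [vertices_dotProduct] at hv
    obtain ⟨h1, h2, h3, h4⟩ := (forall_vertex (P := fun x => x = 0) _).1 hv
    set w := M.1ᵀ *ᵥ v
    have : w = 0 := by
      rw [vec_eta w]
      ext i
      fin_cases i <;> simp <;> linarith
    rw [this, Matrix.mulVec_zero]
  · refine ⟨(M⁻¹).1ᵀ *ᵥ ![0, 1, 1], ?_⟩
    simp only [vertices_dotProduct]
    rw [forall_vertex (P := fun x => 0 < x)]
    simp

theorem mem_projCone_facets {M : GL (Fin 3) ℝ} {x : Plane} :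
    cls M • x ∈ projCone (facets M) ↔ x ∈ projCone facet := by
  constructor
  · rintro ⟨v, hv, hx⟩
    rw [← mulVec_inv_mulVec M v] at hv hx
    simp only [facets_dotProduct] at hv
    exact ⟨_, hv, hx.of_map M⟩
  · rintro ⟨v, hv, hx⟩
    refine ⟨_, fun i => ?_, hx.map M⟩
    rw [facets_dotProduct]
    exact hv i

theorem mem_projCone_vertices {M : GL (Fin 3) ℝ} {X : Plane} :
    mapLine (cls M) X ∈ projCone (vertices M) ↔ X ∈ projCone vertex := by
  constructor
  · rintro ⟨v, hv, hx⟩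
    rw [← transpose_inv_mulVec M v] at hv hx
    simp only [vertices_dotProduct] at hv
    refine ⟨_, hv, ?_⟩
    exact IsLift.of_map (contragredientGL M) hx
  · rintro ⟨v, hv, hx⟩
    refine ⟨_, fun i => ?_, hx.mapLine M⟩
    rw [vertices_dotProduct]
    exact hv i

theorem convexInterior_map_subset (M : GL (Fin 3) ℝ) (Θ : Box) {x : Plane}
    (hx : x ∈ Θ.convexInterior) : cls M • x ∈ (Θ.map (cls M)).convexInterior := by
  obtain ⟨v₁, v₂, v₃, v₄, h1, h2, h3, h4, ⟨k, hk, hl⟩, ⟨k', hk', hl'⟩,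
    ⟨k₁, k₂, k₃, k₄, c1, c2, c3, c4, hc⟩, hx⟩ := hx
  refine ⟨_, _, _, _, h1.map M, h2.map M, h3.map M, h4.map M, ⟨k, hk, ?_⟩, ⟨k', hk', ?_⟩,
    ⟨k₁, k₂, k₃, k₄, c1, c2, c3, c4, ?_⟩, ?_⟩
  · rw [← Matrix.mulVec_smul, ← Matrix.mulVec_add]; exact hl.map M
  · rw [← Matrix.mulVec_smul, ← Matrix.mulVec_add]; exact hl'.map M
  · simp only [← Matrix.mulVec_smul, ← Matrix.mulVec_add, hc]
  · simp only [← Matrix.mulVec_add]; exact hx.map M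

theorem mem_convexInterior_map (g : PGL(3, ℝ)) (Θ : Box) {x : Plane} :
    g • x ∈ (Θ.map g).convexInterior ↔ x ∈ Θ.convexInterior := by
  obtain ⟨M, rfl⟩ := cls_surjective g
  refine ⟨fun h => ?_, convexInterior_map_subset M Θ⟩
  have := convexInterior_map_subset M⁻¹ _ h
  rwa [cls_inv, inv_smul_smul, Box.map_map, inv_mul_cancel, Box.map_one] at this

theorem convexInterior_std (p : Param) : (std p).convexInterior = projCone facet := by
  have ht1 := p.t_lt
  have ht2 := p.lt_t
  have hb1 := p.b_lt
  have hb2 := p.lt_b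
  ext x
  constructor
  · rintro ⟨v₁, v₂, v₃, v₄, h1, h2, h3, h4, ⟨k, hk, hl⟩, ⟨k', hk', hl'⟩,
      ⟨k₁, k₂, k₃, k₄, c1, c2, c3, c4, hc⟩, hx⟩
    obtain ⟨a, ha, rfl⟩ := (std_p p).exists_smul h1
    obtain ⟨b, hb, rfl⟩ := (std_q p).exists_smul h2
    obtain ⟨c, hc0, rfl⟩ := (std_r p).exists_smul h3
    obtain ⟨d, hd, rfl⟩ := (std_s p).exists_smul h4
    have e1 := congrFun hc 1
    have e2 := congrFun hc 2
    have e0 := congrFun hc 0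
    simp at e0 e1 e2
    -- the crossing diagonals force the four coefficients to have the same sign
    have hac : k₁ * a = k₃ * c := by linarith
    have same : ∀ s : ℝ, s ≠ 0 → 0 < s * a → 0 < s * b ∧ 0 < s * c ∧ 0 < s * d := by
      intro s hs hsa
      have h2 : 0 < k₂ * (s * b) := by
        have := mul_pos c1 hsa
        calc 0 < k₁ * (s * a) := this
          _ = k₂ * (s * b) := by linear_combination s * e1
      have h3 : 0 < k₃ * (s * c) := by
        have := mul_pos c1 hsa
        calc 0 < k₁ * (s * a) := this
          _ = k₃ * (s * c) := by linear_combination s * hac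
      have h4 : 0 < k₄ * (s * d) := by
        calc 0 < k₃ * (s * c) := h3
          _ = k₄ * (s * d) := by linear_combination s * e2
      exact ⟨pos_of_mul_pos_right h2 c2.le, pos_of_mul_pos_right h3 c3.le,
        pos_of_mul_pos_right h4 c4.le⟩
    have main : ∀ s : ℝ, s ≠ 0 → 0 < s * a → x ∈ projCone facet := by
      intro s hs hsa
      obtain ⟨hb', hc', hd'⟩ := same s hs hsa
      refine ⟨_, ?_, hx.smul hs⟩
      rw [forall_facet (P := fun x => 0 < x)]
      simp
      refine ⟨?_, ?_, ?_, ?_⟩ <;> nlinarith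
    rcases lt_or_gt_of_ne ha with h | h
    · exact main (-1) (by norm_num) (by linarith)
    · exact main 1 one_ne_zero (by linarith)
  · rintro ⟨v, hv, hx⟩
    obtain ⟨h1, h2, h3, h4⟩ := (forall_facet (P := fun x => 0 < x) v).1 hv
    set n := v 1 + v 2 with hn
    have hn0 : 0 < n := by linarith
    -- the first coordinate is distributed among the two sides in proportion to their weights
    set ξ := v 0 / n with hξ
    have hξn : ξ * n = v 0 := by rw [hξ]; field_simp
    have hξ1 : ξ < 1 := by rw [hξ, div_lt_one hn0]; linarith
    have hξ2 : -1 < ξ := by rw [hξ, lt_div_iff₀ hn0]; linarith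
    have pos : ∀ {r s : ℝ}, 0 < r → -1 < s → s < 1 → 0 < r * (1 - s) / 2 ∧ 0 < r * (1 + s) / 2 :=
      fun hr h1 h2 => ⟨div_pos (mul_pos hr (by linarith)) two_pos,
        div_pos (mul_pos hr (by linarith)) two_pos⟩
    obtain ⟨a1, a2⟩ := pos h3 hξ2 hξ1
    obtain ⟨a4, a3⟩ := pos h4 hξ2 hξ1
    obtain ⟨t1, t2⟩ := pos one_pos ht2 ht1
    obtain ⟨b4, b3⟩ := pos one_pos hb2 hb1
    set A1 := v 1 * (1 - ξ) / 2
    set A2 := v 1 * (1 + ξ) / 2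
    set A3 := v 2 * (1 + ξ) / 2
    set A4 := v 2 * (1 - ξ) / 2
    refine ⟨A1 • ![-1, 1, 0], A2 • ![1, 1, 0], A3 • ![1, 0, 1], A4 • ![-1, 0, 1],
      (std_p p).smul a1.ne', (std_q p).smul a2.ne', (std_r p).smul a3.ne', (std_s p).smul a4.ne',
      ⟨(1 + p.t) / 2 / A2 / ((1 - p.t) / 2 / A1), by
        have : 0 < 1 - p.t := by linarith
        have : 0 < 1 + p.t := by linarith
        positivity, ?_⟩,
      ⟨(1 - p.b) / 2 / A4 / ((1 + p.b) / 2 / A3), by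
        have : 0 < 1 - p.b := by linarith
        have : 0 < 1 + p.b := by linarith
        positivity, ?_⟩,
      ⟨1 / A1, 1 / A2, 1 / A3, 1 / A4, by positivity, by positivity, by positivity, by positivity,
        ?_⟩, ?_⟩
    · refine (std_t p).of_eq_smul (A1 / ((1 - p.t) / 2))
        (div_ne_zero a1.ne' (by linarith)) ?_
      have : 1 - p.t ≠ 0 := by linarith
      ext i
      fin_cases i <;> simp <;> field_simp <;> ring
    · refine (std_b p).of_eq_smul (A3 / ((1 + p.b) / 2))
        (div_ne_zero a3.ne' (by linarith)) ?_
      have : 1 + p.b ≠ 0 := by linarith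
      ext i
      fin_cases i <;> simp <;> field_simp <;> ring
    · rw [smul_smul, smul_smul, smul_smul, smul_smul, one_div_mul_cancel a1.ne',
        one_div_mul_cancel a2.ne', one_div_mul_cancel a3.ne', one_div_mul_cancel a4.ne']
      ext i
      fin_cases i <;> simp
    · convert hx using 1
      rw [vec_eta v]
      ext i
      fin_cases i
      · simp [A1, A2, A3, A4]
        rw [hn] at hξn
        linear_combination hξn
      · simp [A1, A2, A3, A4]; ring
      · simp [A1, A2, A3, A4]; ring

theorem convexInterior_std_map (M : GL (Fin 3) ℝ) (p : Param) :
    ((std p).map (cls M)).convexInterior = projCone (facets M) := by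
  ext x
  obtain ⟨y, rfl⟩ : ∃ y, cls M • y = x := ⟨(cls M)⁻¹ • x, smul_inv_smul _ _⟩
  rw [mem_convexInterior_map, convexInterior_std, mem_projCone_facets]

/-- The interior of a box is positively spanned by the vertices. -/
theorem sum_vertices_mem_closure (M : GL (Fin 3) ℝ) {a : Fin 4 → ℝ} (ha : ∀ i, 0 ≤ a i)
    {x : Plane} (hx : IsLift (∑ i, a i • vertices M i) x) : x ∈ closure (projCone (facets M)) := by
  rw [(isProper_facets M).closure_eq]
  refine ⟨_, fun i => ?_, hx⟩
  rw [dotProduct_comm, sum_smul_dotProduct]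
  refine Finset.sum_nonneg fun j _ => mul_nonneg (ha j) ?_
  rw [dotProduct_comm, vertices, facets_dotProduct]
  fin_cases i <;> fin_cases j <;> simp [facet, vertex, dotProduct, Fin.sum_univ_three]

/-- A vector on which the facet functionals are nonnegative is a nonnegative combination of the
vertices; strictly positive values give positive coefficients. -/
theorem exists_vertex_sum {v : Fin 3 → ℝ} (hv : ∀ i, 0 ≤ facet i ⬝ᵥ v) :
    ∃ a : Fin 4 → ℝ, (∀ i, 0 ≤ a i) ∧ ((∀ i, 0 < facet i ⬝ᵥ v) → ∀ i, 0 < a i) ∧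
      v = ∑ i, a i • vertex i := by
  obtain ⟨h1, h2, h3, h4⟩ := (forall_facet (P := fun x => 0 ≤ x) v).1 hv
  rcases eq_or_lt_of_le (add_nonneg h3 h4) with h0 | h0
  · refine ⟨0, fun i => le_rfl, fun h => ?_, ?_⟩
    · have := (forall_facet (P := fun x => 0 < x) v).1 h
      linarith [this.1]
    · rw [vec_eta v]
      ext i
      fin_cases i <;> simp <;> linarith
  · set ξ := v 0 / (v 1 + v 2) with hξ
    have hξn : ξ * (v 1 + v 2) = v 0 := by rw [hξ]; field_simp
    refine ⟨![v 1 * (1 - ξ) / 2, v 1 * (1 + ξ) / 2, v 2 * (1 + ξ) / 2, v 2 * (1 - ξ) / 2],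
      ?_, fun h => ?_, ?_⟩
    · have hξ1 : ξ ≤ 1 := by rw [hξ, div_le_one h0]; linarith
      have hξ2 : -1 ≤ ξ := by rw [hξ, le_div_iff₀ h0]; linarith
      have hm : 0 ≤ 1 - ξ := by linarith
      have hp : 0 ≤ 1 + ξ := by linarith
      intro i
      fin_cases i <;> simp <;> positivity
    · obtain ⟨h1, h2, h3, h4⟩ := (forall_facet (P := fun x => 0 < x) v).1 h
      have hξ1 : ξ < 1 := by rw [hξ, div_lt_one h0]; linarith
      have hξ2 : -1 < ξ := by rw [hξ, lt_div_iff₀ h0]; linarith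
      have hm : 0 < 1 - ξ := by linarith
      have hp : 0 < 1 + ξ := by linarith
      intro i
      fin_cases i <;> simp <;> positivity
    · nth_rewrite 1 [vec_eta v]
      ext i
      fin_cases i <;> simp [vertex, Fin.sum_univ_four]
      · linear_combination -hξn
      · ring
      · ring

/-- A functional that is positive on the vertices is a positive combination of the facet
functionals. -/
theorem exists_facet_sum {w : Fin 3 → ℝ} (hw : ∀ i, 0 < vertex i ⬝ᵥ w) :
    ∃ a : Fin 4 → ℝ, (∀ i, 0 < a i) ∧ w = ∑ i, a i • facet i := by
  obtain ⟨h1, h2, h3, h4⟩ := (forall_vertex (P := fun x => 0 < x) w).1 hw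
  obtain ⟨m, hm1, hm2⟩ : ∃ m, |w 0| < m ∧ m < min (w 1) (w 2) := by
    refine exists_between (lt_min ?_ ?_) <;> rw [abs_lt] <;> constructor <;> linarith
  rw [abs_lt] at hm1
  rw [lt_min_iff] at hm2
  refine ⟨![(m + w 0) / 2, (m - w 0) / 2, w 1 - m, w 2 - m], fun i => ?_, ?_⟩
  · fin_cases i <;> simp <;> linarith
  · nth_rewrite 1 [vec_eta w]
    ext i
    fin_cases i <;> simp [facet, Fin.sum_univ_four] <;> ring

theorem dualDomain_facets (M : GL (Fin 3) ℝ) :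
    dualDomain (projCone (facets M)) = projCone (vertices M) := by
  ext X
  constructor
  · intro hX
    obtain ⟨w, hw⟩ := exists_isLift X
    -- the functional does not vanish on nontrivial nonnegative combinations of the vertices
    have hpos : ∀ v ≠ 0, (∃ a : Fin 4 → ℝ, (∀ i, 0 ≤ a i) ∧ v = ∑ i, a i • vertices M i) →
        v ⬝ᵥ w ≠ 0 := by
      rintro v hv0 ⟨a, ha, rfl⟩ h
      exact hX _ (sum_vertices_mem_closure M ha (isLift_mk hv0))
        (((isLift_mk hv0).incident_iff hw).2 h)
    have hvne : ∀ i j (s t : ℝ), 0 ≤ s → 0 < t → s • vertices M i + t • vertices M j ≠ 0 := by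
      intro i j s t hs ht h
      have h1 : M.1 *ᵥ (s • vertex i + t • vertex j) = 0 := by
        rw [Matrix.mulVec_add, Matrix.mulVec_smul, Matrix.mulVec_smul]
        exact h
      have h2 : ∀ k, facet k ⬝ᵥ (s • vertex i + t • vertex j) = 0 := fun k => by
        rw [← facets_dotProduct M, h1, dotProduct_zero]
      obtain ⟨-, -, h3, h4⟩ := (forall_facet (P := fun x => x = 0) _).1 h2
      fin_cases i <;> fin_cases j <;> simp [vertex] at h3 h4 <;> linarith
    have hcomb : ∀ i j (s t : ℝ), 0 ≤ s → 0 < t →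
        s * (vertices M i ⬝ᵥ w) + t * (vertices M j ⬝ᵥ w) ≠ 0 := by
      intro i j s t hs ht
      have := hpos _ (hvne i j s t hs ht) ⟨fun k => (if k = i then s else 0) +
        (if k = j then t else 0), fun k => by dsimp only; split_ifs <;> linarith, by
          simp [add_smul, Finset.sum_add_distrib, ite_smul]⟩
      rwa [add_dotProduct, smul_dotProduct, smul_dotProduct, smul_eq_mul, smul_eq_mul] at this
    have hne : ∀ i, vertices M i ⬝ᵥ w ≠ 0 := fun i => by
      simpa using hcomb i i 0 1 le_rfl one_pos
    have hsame : ∀ i j, 0 < vertices M i ⬝ᵥ w → 0 < vertices M j ⬝ᵥ w := by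
      intro i j hi
      by_contra! hj
      have hj' := lt_of_le_of_ne hj (hne j)
      exact hcomb i j (-(vertices M j ⬝ᵥ w)) (vertices M i ⬝ᵥ w) (by linarith) hi (by ring)
    by_cases h0 : 0 < vertices M 0 ⬝ᵥ w
    · exact ⟨w, fun i => hsame 0 i h0, hw⟩
    · refine mem_projCone_of_neg hw fun i => ?_
      exact lt_of_le_of_ne (not_lt.1 fun hi => h0 (hsame i 0 hi)) (hne i)
  · rintro ⟨w, hw, hwX⟩ x hx hinc
    rw [(isProper_facets M).closure_eq] at hx
    obtain ⟨v, hv, hvx⟩ := hx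
    rw [hvx.incident_iff hwX] at hinc
    rw [← mulVec_inv_mulVec M v] at hv hinc hvx
    simp only [facets_dotProduct] at hv
    obtain ⟨a, ha, -, hs⟩ := exists_vertex_sum hv
    rw [hs, Matrix.mulVec_sum] at hinc hvx
    simp only [Matrix.mulVec_smul] at hinc hvx
    change (∑ i, a i • vertices M i) ⬝ᵥ w = 0 at hinc
    rw [sum_smul_dotProduct, Finset.sum_eq_zero_iff_of_nonneg
      fun i _ => mul_nonneg (ha i) (hw i).le] at hinc
    have ha0 : ∀ i, a i = 0 := fun i =>
      (mul_eq_zero.1 (hinc i (Finset.mem_univ i))).resolve_right (hw i).ne'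
    exact hvx.ne_zero (by simp [ha0])

/-- The lines that avoid the closed box belong to the interior of the dual box. -/
theorem projCone_vertices_subset_dual (M : GL (Fin 3) ℝ) (p : Param) :
    projCone (vertices M) ⊆ ((std p).map (cls M)).dual.convexInterior := by
  intro X hX
  obtain ⟨Y, rfl⟩ : ∃ Y, mapLine (cls M) Y = X :=
    ⟨(contragredient (cls M))⁻¹ • X, smul_inv_smul _ _⟩
  rw [mem_projCone_vertices] at hX
  rw [std_map_dual]
  refine (mem_convexInterior_map _ _).2 ?_
  obtain ⟨v, hv, hvY⟩ := hX
  obtain ⟨h1, h2, h3, h4⟩ := (forall_vertex (P := fun x => 0 < x) v).1 hv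
  have ht1 := p.t_lt
  have ht2 := p.lt_t
  set A := (v 2 + v 0) / 2 with hA
  set B := (v 2 - v 0) / 2 with hB
  set C := (v 1 + p.t * v 0) / 2 with hC
  have a1 : 0 < A := by linarith
  have a2 : 0 < B := by linarith
  have a3 : 0 < C := by
    have : 0 < v 1 + p.t * v 0 := by
      rcases le_total 0 (v 0) with h | h <;> nlinarith
    linarith
  refine ⟨A • ![1, -p.t, 1], (-B) • ![1, -p.t, -1], C • ![-1, 1, p.b], (-C) • ![-1, -1, p.b],
    (std_P p).1.smul a1.ne', (std_Q p).1.smul (neg_ne_zero.2 a2.ne'), (std_R p).1.smul a3.ne',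
    (std_S p).1.smul (neg_ne_zero.2 a3.ne'), ⟨A / B, div_pos a1 a2, ?_⟩, ⟨1, one_pos, ?_⟩,
    ⟨(1 - p.b) / A, (1 + p.b) / B, (1 + p.t) / C, (1 - p.t) / C, ?_, ?_, ?_, ?_, ?_⟩, ?_⟩
  · refine (std_T p).1.of_eq_smul (2 * A) (by positivity) ?_
    ext i
    fin_cases i <;> simp <;> field_simp <;> ring
  · refine (std_B p).1.of_eq_smul (2 * C) (by positivity) ?_
    ext i
    fin_cases i <;> simp <;> ring
  · exact div_pos (by linarith [p.b_lt]) a1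
  · exact div_pos (by linarith [p.lt_b]) a2
  · exact div_pos (by linarith) a3
  · exact div_pos (by linarith) a3
  · ext i
    fin_cases i <;> simp <;> field_simp <;> ring
  · convert hvY using 1
    rw [vec_eta v]
    ext i
    fin_cases i <;> simp [hA, hB, hC] <;> ring

theorem convexInterior_j (Θ : Box) : Θ.j.convexInterior = Θ.convexInterior := by
  have key : ∀ Θ : Box, Θ.convexInterior ⊆ Θ.j.convexInterior := by
    rintro Θ x ⟨v₁, v₂, v₃, v₄, h1, h2, h3, h4, ⟨k, hk, hl⟩, ⟨k', hk', hl'⟩,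
      ⟨k₁, k₂, k₃, k₄, c1, c2, c3, c4, hc⟩, hx⟩
    refine ⟨v₂, v₁, v₄, v₃, h2, h1, h4, h3, ⟨k⁻¹, inv_pos.2 hk, ?_⟩, ⟨k'⁻¹, inv_pos.2 hk', ?_⟩,
      ⟨k₂, k₁, k₄, k₃, c2, c1, c4, c3, hc.symm⟩, ?_⟩
    · refine hl.of_eq_smul k⁻¹ (inv_ne_zero hk.ne') ?_
      rw [smul_add, smul_smul, inv_mul_cancel₀ hk.ne', one_smul, add_comm]
    · refine hl'.of_eq_smul k'⁻¹ (inv_ne_zero hk'.ne') ?_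
      rw [smul_add, smul_smul, inv_mul_cancel₀ hk'.ne', one_smul, add_comm]
    · rwa [add_comm v₂, add_assoc, add_comm v₄, ← add_assoc]
  exact subset_antisymm (key Θ.j) (key Θ)

theorem dual_j (Θ : Box) : Θ.j.dual = Θ.dual.j := by
  simp only [Box.dual, Box.j, Box.lineP, Box.lineQ, Box.lineR, Box.lineS, Box.lineT, Box.lineB]
  rw [join_comm Θ.q Θ.p, join_comm Θ.s Θ.r]

theorem Box.SameMarked.convexInterior_eq {Θ Θ' : Box} (h : Θ.SameMarked Θ') :
    Θ.convexInterior = Θ'.convexInterior := by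
  rcases h with rfl | rfl
  · rfl
  · exact convexInterior_j Θ'

theorem Box.SameMarked.dual_convexInterior_eq {Θ Θ' : Box} (h : Θ.SameMarked Θ') :
    Θ.dual.convexInterior = Θ'.dual.convexInterior := by
  rcases h with rfl | rfl
  · rfl
  · rw [dual_j, convexInterior_j]

/-! ### Strict contraction in the interior of the region -/

theorem regionFun_strictAnti {ε δ δ' : ℝ} (h : δ < δ') : regionFun ε δ' < regionFun ε δ := by
  have : Real.exp (-δ') < Real.exp (-δ) := Real.exp_lt_exp.2 (by linarith)
  have := mul_lt_mul_of_pos_right this (Real.cosh_pos ε)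
  unfold regionFun
  linarith

/-- In the interior of the region both inequalities are strict, as the functions have no local
minima in the direction of `δ`; and they force `ε < 0`. -/
theorem pos_of_mem_interior_region {lam : ℝ × ℝ} (h : lam ∈ interior region) :
    Real.sinh lam.1 < 0 ∧ 0 < regionFun lam.1 lam.2 ∧ 0 < regionFun lam.1 (-lam.2) := by
  have hn : region ∈ nhds lam := mem_interior_iff_mem_nhds.1 h
  have hc : Filter.Tendsto (fun s : ℝ => (lam.1, lam.2 + s)) (nhds 0) (nhds lam) := by
    have : Continuous fun s : ℝ => (lam.1, lam.2 + s) := by fun_prop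
    simpa using this.tendsto 0
  have hev := hc.eventually hn
  obtain ⟨s, hs, hs0⟩ := ((hev.filter_mono nhdsWithin_le_nhds).and
    (self_mem_nhdsWithin (a := (0 : ℝ)) (s := Set.Ioi 0))).exists
  obtain ⟨s', hs', hs0'⟩ := ((hev.filter_mono nhdsWithin_le_nhds).and
    (self_mem_nhdsWithin (a := (0 : ℝ)) (s := Set.Iio 0))).exists
  have h1 : 0 < regionFun lam.1 lam.2 :=
    lt_of_le_of_lt hs.1 (regionFun_strictAnti (lt_add_of_pos_right _ hs0))
  have h2 : 0 < regionFun lam.1 (-lam.2) := by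
    refine lt_of_le_of_lt hs'.2 (regionFun_strictAnti ?_)
    have : s' < 0 := hs0'
    linarith
  refine ⟨?_, h1, h2⟩
  by_contra! hs
  have hrel := exp_mul_cosh_relation lam
  unfold regionFun at h1 h2
  rw [neg_neg] at h2
  have := mul_lt_mul'' (sub_pos.1 h1) (sub_pos.1 h2) zero_le_one zero_le_one
  nlinarith

/-- The transformation maps the closed standard box into the open one. -/
def Contracts (G : GL (Fin 3) ℝ) : Prop := ∀ i j, 0 < facet i ⬝ᵥ (G.1 *ᵥ vertex j)

theorem facet_sigma_pos {lam : ℝ × ℝ} (h : lam ∈ interior region) :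
    Contracts (sigmaMatrix lam) := by
  obtain ⟨h1, h2, h3⟩ := pos_of_mem_interior_region h
  unfold regionFun at h2 h3
  rw [neg_neg] at h3
  have h0 := Real.sinh_neg_iff.1 h1
  have p1 := mul_pos (Real.exp_pos (-lam.2)) (Real.cosh_pos lam.1)
  have p2 := mul_pos (Real.exp_pos lam.2) (Real.cosh_pos lam.1)
  intro i j
  rw [coe_sigmaMatrix]
  revert i
  rw [forall_facet (P := fun x => 0 < x)]
  fin_cases j <;> simp [vertex] <;> refine ⟨?_, ?_, ?_, ?_⟩ <;> linarith

theorem facet_matK_pos (p : Param) {v : Fin 3 → ℝ} (hv : ∀ i, 0 < facet i ⬝ᵥ v) (i : Fin 4) :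
    0 < facet i ⬝ᵥ ((matK p).1 *ᵥ v) := by
  obtain ⟨h1, h2, h3, h4⟩ := (forall_facet (P := fun x => 0 < x) v).1 hv
  have t1 : 0 < 1 - p.t := by linarith [p.t_lt]
  have t2 : 0 < 1 + p.t := by linarith [p.lt_t]
  have b1 : 0 < 1 - p.b := by linarith [p.b_lt]
  have b2 : 0 < 1 + p.b := by linarith [p.lt_b]
  revert i
  rw [forall_facet (P := fun x => 0 < x), coe_matK, vec_eta v, mulVec_vec]
  simp only [Matrix.cons_val]
  have e1 := mul_pos (mul_pos t2 b1) h1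
  have e2 := mul_pos (mul_pos t1 b2) h2
  have e3 := mul_pos (mul_pos (mul_pos t1 t2) b2) h4
  have e4 := mul_pos (mul_pos (mul_pos t1 t2) b1) h4
  have e5 := mul_pos (mul_pos t1 t2) h4
  refine ⟨?_, ?_, ?_, ?_⟩
  · linear_combination e1 + e3
  · linear_combination e2 + e4
  · linear_combination (e1 + e2) / 2
  · linear_combination e5

theorem facet_matL_pos (p : Param) {v : Fin 3 → ℝ} (hv : ∀ i, 0 < facet i ⬝ᵥ v) (i : Fin 4) :
    0 < facet i ⬝ᵥ ((matL p).1 *ᵥ v) := by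
  obtain ⟨h1, h2, h3, h4⟩ := (forall_facet (P := fun x => 0 < x) v).1 hv
  have t1 : 0 < 1 - p.t := by linarith [p.t_lt]
  have t2 : 0 < 1 + p.t := by linarith [p.lt_t]
  have b1 : 0 < 1 - p.b := by linarith [p.b_lt]
  have b2 : 0 < 1 + p.b := by linarith [p.lt_b]
  revert i
  rw [forall_facet (P := fun x => 0 < x), coe_matL, vec_eta v, mulVec_vec]
  simp only [Matrix.cons_val]
  have e1 := mul_pos (mul_pos t2 b1) h1
  have e2 := mul_pos (mul_pos t1 b2) h2
  have e3 := mul_pos (mul_pos (mul_pos b1 b2) t1) h3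
  have e4 := mul_pos (mul_pos (mul_pos b1 b2) t2) h3
  have e5 := mul_pos (mul_pos b1 b2) h3
  refine ⟨?_, ?_, ?_, ?_⟩
  · linear_combination e1 + e3
  · linear_combination e2 + e4
  · linear_combination e5
  · linear_combination (e1 + e2) / 2

theorem contracts_matK (p : Param) {lam : ℝ × ℝ} (h : lam ∈ interior region) :
    Contracts (matK p * sigmaMatrix lam) := by
  intro i j
  rw [Units.val_mul, ← Matrix.mulVec_mulVec]
  exact facet_matK_pos p (fun i => facet_sigma_pos h i j) i

theorem contracts_matL (p : Param) {lam : ℝ × ℝ} (h : lam ∈ interior region) :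
    Contracts (matL p * sigmaMatrix lam) := by
  intro i j
  rw [Units.val_mul, ← Matrix.mulVec_mulVec]
  exact facet_matL_pos p (fun i => facet_sigma_pos h i j) i

/-- Right multiplication by `G` shrinks the interiors of the boxes, and widens their dual domains,
with the given bounds. -/
def ContractsWith (m M : ℝ) (G : GL (Fin 3) ℝ) : Prop :=
  ∀ X : GL (Fin 3) ℝ, Refines m M (facets X) (facets (X * G)) ∧
    Refines m M (vertices (X * G)) (vertices X)

theorem ContractsWith.mono {m M m' M' : ℝ} {G : GL (Fin 3) ℝ} (h : ContractsWith m M G)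
    (hm : m' ≤ m) (hM : M ≤ M') : ContractsWith m' M' G :=
  fun X => ⟨(h X).1.mono hm hM, (h X).2.mono hm hM⟩

theorem exists_bounds {κ : Type*} [Finite κ] [Nonempty κ] (c : κ → ℝ) (hc : ∀ i, 0 < c i) :
    ∃ m M, 0 < m ∧ m < M ∧ ∀ i, m ≤ c i ∧ c i ≤ M := by
  obtain ⟨i, hi⟩ := Finite.exists_min c
  obtain ⟨j, hj⟩ := Finite.exists_max c
  refine ⟨c i, c j + 1, hc i, ?_, fun k => ⟨hi k, ?_⟩⟩
  · linarith [hi j]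
  · linarith [hj k]

theorem Contracts.contractsWith {G : GL (Fin 3) ℝ} (h : Contracts G) :
    ∃ m M, 0 < m ∧ m < M ∧ ContractsWith m M G := by
  have hf : ∀ i, ∃ a : Fin 4 → ℝ, (∀ k, 0 < a k) ∧ G.1ᵀ *ᵥ facet i = ∑ k, a k • facet k := by
    intro i
    refine exists_facet_sum fun j => ?_
    rw [Matrix.mulVec_transpose, dotProduct_comm, ← Matrix.dotProduct_mulVec]
    exact h i j
  have hv : ∀ j, ∃ a : Fin 4 → ℝ, (∀ k, 0 < a k) ∧ G.1 *ᵥ vertex j = ∑ k, a k • vertex k := by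
    intro j
    obtain ⟨a, -, ha, hs⟩ := exists_vertex_sum fun i => (h i j).le
    exact ⟨a, ha fun i => h i j, hs⟩
  choose a ha has using hf
  choose b hb hbs using hv
  obtain ⟨m, M, hm, hM, hab⟩ := exists_bounds
    (fun q : Fin 4 × Fin 4 × Bool => if q.2.2 then a q.1 q.2.1 else b q.1 q.2.1)
    (by rintro ⟨i, j, _ | _⟩ <;> simp [ha, hb])
  refine ⟨m, M, hm, hM, fun X => ⟨⟨a, fun i j => ?_, fun i => ?_⟩, ⟨b, fun i j => ?_, fun i => ?_⟩⟩⟩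
  · simpa using hab (i, j, true)
  · have e : facets X i = ((X * G)⁻¹).1ᵀ *ᵥ (G.1ᵀ *ᵥ facet i) := by
      rw [facets, Matrix.mulVec_mulVec, ← Matrix.transpose_mul, ← Units.val_mul]
      congr 4
      group
    rw [e, has i, Matrix.mulVec_sum]
    simp only [Matrix.mulVec_smul, facets]
  · simpa using hab (i, j, false)
  · rw [vertices, Units.val_mul, ← Matrix.mulVec_mulVec, hbs i, Matrix.mulVec_sum]
    simp only [Matrix.mulVec_smul, vertices]

/-- The bases of the Pappus transformations of boxes that occur as labels contract uniformly. -/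
theorem exists_uniform_contraction (p : Param) {lam : ℝ × ℝ} (h : lam ∈ interior region) :
    ∃ m M, 0 < m ∧ m < M ∧ ∀ n : ℕ,
      ContractsWith m M (matK (Param.rot^[n] p) * sigmaMatrix lam) ∧
      ContractsWith m M (matL (Param.rot^[n] p).rot.rot * sigmaMatrix lam) := by
  have hex : ∀ q : Fin 4 × Bool, ∃ m M, 0 < m ∧ m < M ∧ ContractsWith m M
      ((if q.2 then matK (Param.rot^[q.1] p) else matL (Param.rot^[q.1] p).rot.rot) *
        sigmaMatrix lam) := by
    rintro ⟨n, _ | _⟩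
    · exact (contracts_matL _ h).contractsWith
    · exact (contracts_matK _ h).contractsWith
  choose m M hm hM hc using hex
  obtain ⟨i, hi⟩ := Finite.exists_min m
  obtain ⟨j, hj⟩ := Finite.exists_max M
  have hper : ∀ n : ℕ, Param.rot^[n] p = Param.rot^[n % 4] p := by
    intro n
    have h4 : Param.rot^[4] = id := by
      ext1 q
      exact q.rot_rot_rot_rot
    conv_lhs => rw [← Nat.mod_add_div n 4, Function.iterate_add, Function.iterate_mul, h4,
      Function.iterate_id]
    rfl
  refine ⟨m i, M j, hm i, (hM i).trans_le (hj i), fun n => ?_⟩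
  rw [hper n]
  have hlt := Nat.mod_lt n (show 4 > 0 by norm_num)
  exact ⟨(hc (⟨n % 4, hlt⟩, true)).mono (hi _) (hj _),
    (hc (⟨n % 4, hlt⟩, false)).mono (hi _) (hj _)⟩

/-! ### Labels in normal form -/

namespace Box

theorem sameMarked_j (Θ : Box) : Θ.j.SameMarked Θ := Or.inr rfl

theorem SameMarked.symm {Θ Θ' : Box} (h : Θ.SameMarked Θ') : Θ'.SameMarked Θ := by
  rcases h with rfl | rfl
  · exact Or.inl rfl
  · exact Or.inr Θ'.j_j.symm

theorem SameMarked.trans {Θ Θ' Θ'' : Box} (h : Θ.SameMarked Θ') (h' : Θ'.SameMarked Θ'') :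
    Θ.SameMarked Θ'' := by
  rcases h with rfl | rfl
  · exact h'
  · rcases h' with rfl | rfl
    · exact Or.inr rfl
    · exact Or.inl rfl

theorem SameMarked.map {Θ Θ' : Box} (h : Θ.SameMarked Θ') (g : PGL(3, ℝ)) :
    (Θ.map g).SameMarked (Θ'.map g) := by
  rcases h with rfl | rfl
  · exact Or.inl rfl
  · exact Or.inr rfl

end Box

theorem newI_j_std (lam : ℝ × ℝ) (g : PGL(3, ℝ)) (p : Param) :
    ((std p).map g).j.newI lam = (((std p).map g).newI lam).j := by
  rw [std_map_newI, std_map_j, std_map_newI, std_map_j, mul_assoc g, J_comm_N, ← mul_assoc g,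
    mul_assoc (g * cls matN), J_comm_sigma, ← mul_assoc]

theorem newTau1_j_std (lam : ℝ × ℝ) (g : PGL(3, ℝ)) (p : Param) :
    ((std p).map g).j.newTau1 lam = (((std p).map g).newTau1 lam).j := by
  have h : cls matJ * cls (matK p.rot.rot) = cls (matK p) * cls matJ := by
    rw [K_rot_rot, ← mul_assoc, ← mul_assoc, J_mul_J, one_mul]
  rw [std_map_newTau1, std_map_j, std_map_newTau1, std_map_j, mul_assoc g, h, ← mul_assoc g,
    mul_assoc (g * cls (matK p)), J_comm_sigma, ← mul_assoc]

theorem Box.SameMarked.newI {Θ : Box} {g : PGL(3, ℝ)} {p : Param} (lam : ℝ × ℝ)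
    (h : Θ.SameMarked ((std p).map g)) :
    (Θ.newI lam).SameMarked (((std p).map g).newI lam) := by
  rcases h with rfl | rfl
  · exact Or.inl rfl
  · exact Or.inr (newI_j_std lam g p)

theorem Box.SameMarked.newTau1 {Θ : Box} {g : PGL(3, ℝ)} {p : Param} (lam : ℝ × ℝ)
    (h : Θ.SameMarked ((std p).map g)) :
    (Θ.newTau1 lam).SameMarked (((std p).map g).newTau1 lam) := by
  rcases h with rfl | rfl
  · exact Or.inl rfl
  · exact Or.inr (newTau1_j_std lam g p)

/-- The transformation `ϱ = i^λ τ₁^λ` in normal form; it does not depend on `λ`. -/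
theorem std_map_rho (lam : ℝ × ℝ) (g : PGL(3, ℝ)) (p : Param) :
    (((std p).map g).newTau1 lam).newI lam =
      (std p.rot.rot).map (g * cls (matK p) * cls matN) := by
  rw [std_map_newTau1, std_map_newI, mul_assoc _ (cls (sigmaMatrix lam)), mul_assoc _ (_ * _),
    sigma_N_sigma]

theorem std_map_newI_newI (lam : ℝ × ℝ) (g : PGL(3, ℝ)) (p : Param) :
    (((std p).map g).newI lam).newI lam = ((std p).map g).j := by
  have : g * cls matN * cls (sigmaMatrix lam) * cls matN * cls (sigmaMatrix lam) =
      g * cls matN * (cls (sigmaMatrix lam) * cls matN * cls (sigmaMatrix lam)) := by group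
  rw [std_map_newI, std_map_newI, this, sigma_N_sigma, std_map_j, mul_assoc, N_mul_N]

/-! ### Continuity of Möbius transformations -/

section Moebius

open Filter Topology

variable {𝕜 : Type*} [NontriviallyNormedField 𝕜]

theorem coclosedCompact_eq_cobounded [ProperSpace 𝕜] :
    coclosedCompact 𝕜 = Bornology.cobounded 𝕜 := by
  rw [coclosedCompact_eq_cocompact, Metric.cobounded_eq_cocompact]

variable [DecidableEq 𝕜]

theorem continuous_smul_of_upper {g : GL (Fin 2) 𝕜} (h : g 1 0 = 0) :
    Continuous fun x : OnePoint 𝕜 => g • x := by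
  have hd : g 0 0 * g 1 1 ≠ 0 := by
    have := g.det_ne_zero
    rw [Matrix.det_fin_two] at this
    change g 0 0 * g 1 1 - g 0 1 * g 1 0 ≠ 0 at this
    rwa [h, mul_zero, sub_zero] at this
  have h0 : g 0 0 / g 1 1 ≠ 0 := div_ne_zero (left_ne_zero_of_mul hd) (right_ne_zero_of_mul hd)
  have hfun : (fun x : OnePoint 𝕜 => g • x) =
      OnePoint.map fun x => (g 0 0 / g 1 1) * x + g 0 1 / g 1 1 := by
    ext1 x
    induction x using OnePoint.rec with
    | infty => rw [OnePoint.smul_infty_eq_ite, if_pos h]; rfl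
    | coe x =>
      rw [OnePoint.smul_some_eq_ite, h, zero_mul, zero_add, if_neg (right_ne_zero_of_mul hd),
        OnePoint.map_some]
      congr 1
      field_simp
  rw [hfun]
  let e : 𝕜 ≃ₜ 𝕜 := (Homeomorph.mulLeft₀ _ h0).trans (Homeomorph.addRight (g 0 1 / g 1 1))
  exact OnePoint.continuous_map e.continuous e.map_coclosedCompact.le

theorem continuous_smul_of_inversion [ProperSpace 𝕜] {g : GL (Fin 2) 𝕜} (h00 : g 0 0 = 0)
    (h01 : g 0 1 = 1) (h10 : g 1 0 = 1) (h11 : g 1 1 = 0) : Continuous fun x : OnePoint 𝕜 => g • x := by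
  have hinf : g • (∞ : OnePoint 𝕜) = ((0 : 𝕜) : OnePoint 𝕜) := by
    rw [OnePoint.smul_infty_eq_ite, h10, h00]; simp
  have hcoe : ∀ x : 𝕜, x ≠ 0 → g • (x : OnePoint 𝕜) = ((x⁻¹ : 𝕜) : OnePoint 𝕜) := by
    intro x hx
    rw [OnePoint.smul_some_eq_ite, h10, h00, h01, h11]; simp [hx]
  have hzero : g • ((0 : 𝕜) : OnePoint 𝕜) = ∞ := by
    rw [OnePoint.smul_some_eq_ite, h10, h11]; simp
  rw [continuous_iff_continuousAt]
  intro x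
  induction x using OnePoint.rec with
  | infty =>
    rw [OnePoint.continuousAt_infty', hinf, coclosedCompact_eq_cobounded]
    have : Tendsto (fun x : 𝕜 => ((x⁻¹ : 𝕜) : OnePoint 𝕜)) (Bornology.cobounded 𝕜)
        (𝓝 ((0 : 𝕜) : OnePoint 𝕜)) :=
      (OnePoint.continuous_coe.tendsto _).comp tendsto_inv₀_cobounded
    refine this.congr' ?_
    filter_upwards [Bornology.eventually_ne_cobounded (0 : 𝕜)] with x hx
    exact (hcoe x hx).symm
  | coe x =>
    rw [OnePoint.continuousAt_coe]
    by_cases hx : x = 0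
    · subst hx
      change Tendsto _ _ _
      rw [Function.comp_apply, hzero]
      have h1 : Tendsto (fun x : 𝕜 => ((x⁻¹ : 𝕜) : OnePoint 𝕜)) (𝓝[≠] 0) (𝓝 ∞) := by
        refine OnePoint.tendsto_coe_infty.comp ?_
        rw [coclosedCompact_eq_cobounded]
        exact tendsto_inv₀_nhdsNE_zero
      rw [← nhdsNE_sup_pure, tendsto_sup]
      refine ⟨h1.congr' ?_, ?_⟩
      · filter_upwards [self_mem_nhdsWithin] with x hx
        exact (hcoe x hx).symm
      · rw [tendsto_pure_left]
        intro s hs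
        rw [Function.comp_apply, hzero]
        exact mem_of_mem_nhds hs
    · have h1 : ContinuousAt (fun x : 𝕜 => ((x⁻¹ : 𝕜) : OnePoint 𝕜)) x :=
        OnePoint.continuous_coe.continuousAt.comp (continuousAt_inv₀ hx)
      refine h1.congr ?_
      filter_upwards [isOpen_ne.mem_nhds hx] with y hy
      exact (hcoe y hy).symm

/-- Möbius transformations are continuous: by the Bruhat decomposition they are composed of affine
maps and the inversion. -/
theorem continuous_moebius [ProperSpace 𝕜] (g : GL (Fin 2) 𝕜) :
    Continuous fun x : OnePoint 𝕜 => g • x := by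
  by_cases h : g 1 0 = 0
  · exact continuous_smul_of_upper h
  have hd : g.1.det ≠ 0 := g.det_ne_zero
  have hd' : g.1.det = g 0 0 * g 1 1 - g 0 1 * g 1 0 := Matrix.det_fin_two _
  let t₁ : GL (Fin 2) 𝕜 := GeneralLinearGroup.mkOfDetNeZero
    !![-g.1.det / g 1 0, g 0 0 / g 1 0; 0, 1]
    (by rw [Matrix.det_fin_two_of]; generalize g.1.det = δ at hd; simp [h, hd])
  let w : GL (Fin 2) 𝕜 := GeneralLinearGroup.mkOfDetNeZero !![0, 1; 1, 0]
    (by simp [Matrix.det_fin_two])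
  let t₂ : GL (Fin 2) 𝕜 := GeneralLinearGroup.mkOfDetNeZero !![g 1 0, g 1 1; 0, 1]
    (by simp [Matrix.det_fin_two, h])
  have hg : g = t₁ * (w * t₂) := by
    ext i k
    change g i k = (!![-g.1.det / g 1 0, g 0 0 / g 1 0; 0, 1] *
      (!![0, 1; 1, 0] * !![g 1 0, g 1 1; 0, 1]) : Matrix (Fin 2) (Fin 2) 𝕜) i k
    rw [hd']
    fin_cases i <;> fin_cases k <;> simp [Matrix.mul_apply, Fin.sum_univ_two] <;> field_simp
    ring
  have c₁ : Continuous fun x : OnePoint 𝕜 => t₁ • x := continuous_smul_of_upper rfl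
  have c₂ : Continuous fun x : OnePoint 𝕜 => w • x := continuous_smul_of_inversion rfl rfl rfl rfl
  have c₃ : Continuous fun x : OnePoint 𝕜 => t₂ • x := continuous_smul_of_upper rfl
  have : (fun x : OnePoint 𝕜 => g • x) = fun x => t₁ • w • t₂ • x := by
    ext1 x
    rw [hg, mul_smul, mul_smul]
  rw [this]
  exact c₁.comp (c₂.comp c₃)

end Moebius

/-! ### Normal forms in groups generated by elements of order two and three -/

section NormalForm

variable {G : Type*} [Group G]

/-- The product `ri` or `r²i`. -/
def syllable (i r : G) (k : Bool) : G := (if k then r else r * r) * i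

/-- The product of a sequence of syllables `ri` and `r²i`. -/
def word (i r : G) (l : List Bool) : G := (l.map (syllable i r)).prod

/-- The element `i^b w r^n`, where `w` is a product of syllables `ri` and `r²i`. -/
def normalForm (i r : G) (b : Bool) (l : List Bool) (n : Fin 3) : G :=
  (if b then i else 1) * word i r l * r ^ (n : ℕ)

theorem map_normalForm {H : Type*} [Group H] (f : G →* H) (i r : G) (b : Bool) (l : List Bool)
    (n : Fin 3) : f (normalForm i r b l n) = normalForm (f i) (f r) b l n := by
  have h : ∀ k, f (syllable i r k) = syllable (f i) (f r) k := by
    intro k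
    cases k <;> simp [syllable]
  have h' : f (word i r l) = word (f i) (f r) l := by
    rw [word, map_list_prod, List.map_map]
    congr 2
    ext1 k
    exact h k
  cases b <;> simp [normalForm, h']

theorem exists_normalForm_mul_left {i r : G} (hi : i * i = 1) (b : Bool)
    (l : List Bool) (n : Fin 3) :
    ∃ b' l' n', normalForm i r b l n * i = normalForm i r b' l' n' := by
  fin_cases n
  · rcases List.eq_nil_or_concat l with rfl | ⟨l', k, rfl⟩
    · refine ⟨!b, [], 0, ?_⟩
      cases b <;> simp [normalForm, word, hi]
    · cases k
      · refine ⟨b, l', 2, ?_⟩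
        simp [normalForm, word, syllable, mul_assoc, hi, pow_two]
      · refine ⟨b, l', 1, ?_⟩
        simp [normalForm, word, syllable, mul_assoc, hi]
  · exact ⟨b, l ++ [true], 0, by simp [normalForm, word, syllable, mul_assoc]⟩
  · exact ⟨b, l ++ [false], 0, by simp [normalForm, word, syllable, mul_assoc, pow_two]⟩

theorem exists_normalForm_mul_right {i r : G} (hr : r * r * r = 1) (b : Bool)
    (l : List Bool) (n : Fin 3) :
    ∃ b' l' n', normalForm i r b l n * r = normalForm i r b' l' n' := by
  fin_cases n
  · exact ⟨b, l, 1, by simp [normalForm]⟩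
  · exact ⟨b, l, 2, by simp [normalForm, mul_assoc, pow_two]⟩
  · refine ⟨b, l, 0, ?_⟩
    simp only [normalForm, mul_assoc]
    congr 2
    simpa [pow_two, mul_assoc] using hr

theorem exists_normalForm {i r : G} (hi : i * i = 1) (hr : r * r * r = 1) {g : G}
    (hg : g ∈ Subgroup.closure {i, r}) : ∃ b l n, g = normalForm i r b l n := by
  have hi' : i⁻¹ = i := inv_eq_of_mul_eq_one_left hi
  have hr' : r⁻¹ = r * r := inv_eq_of_mul_eq_one_left hr
  induction hg using Subgroup.closure_induction_right with
  | one => exact ⟨false, [], 0, by simp [normalForm, word]⟩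
  | mul_right x hx y hy ih =>
    obtain ⟨b, l, n, rfl⟩ := ih
    rcases hy with rfl | rfl
    · exact exists_normalForm_mul_left hi b l n
    · exact exists_normalForm_mul_right hr b l n
  | mul_inv_cancel x hx y hy ih =>
    obtain ⟨b, l, n, rfl⟩ := ih
    rcases hy with rfl | rfl
    · rw [hi']
      exact exists_normalForm_mul_left hi b l n
    · rw [hr', ← mul_assoc]
      obtain ⟨b', l', n', h⟩ := exists_normalForm_mul_right (i := i) hr b l n
      rw [h]
      exact exists_normalForm_mul_right hr b' l' n'

/-- If the only trivial normal form is the empty one, then the group generated by `i` and `r` is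
the free product of groups of order two and three: prescribed images satisfying the relations
extend to a homomorphism. Its graph is generated by the pairs of generators. -/
theorem exists_monoidHom_of_normalForm {i r : G} (hi : i * i = 1) (hr : r * r * r = 1)
    (hinj : ∀ b l n, normalForm i r b l n = 1 → b = false ∧ l = [] ∧ n = 0)
    {K : Type*} [Group K] {x y : K} (hx : x * x = 1) (hy : y * y * y = 1) :
    ∃ f : Subgroup.closure {i, r} →* K,
      f ⟨i, Subgroup.subset_closure (by simp)⟩ = x ∧
        f ⟨r, Subgroup.subset_closure (by simp)⟩ = y := by
  let S : Subgroup (G × K) := Subgroup.closure {(i, x), (r, y)}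
  have hS : ∀ p ∈ S, p.1 = 1 → p = 1 := by
    intro p hp h1
    obtain ⟨b, l, n, h⟩ := exists_normalForm (i := (i, x)) (r := (r, y))
      (by simp [hi, hx]) (by simp [hr, hy]) hp
    have h2 := map_normalForm (MonoidHom.fst G K) (i, x) (r, y) b l n
    rw [← h] at h2
    change p.1 = normalForm i r b l n at h2
    obtain ⟨rfl, rfl, rfl⟩ := hinj b l n (by rw [← h2, h1])
    rw [h]
    simp [normalForm, word]
  have hex : ∀ g ∈ Subgroup.closure {i, r}, ∃ k, (g, k) ∈ S := by
    intro g hg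
    induction hg using Subgroup.closure_induction with
    | mem g hg =>
      rcases hg with rfl | rfl
      · exact ⟨x, Subgroup.subset_closure (by simp)⟩
      · exact ⟨y, Subgroup.subset_closure (by simp)⟩
    | one => exact ⟨1, S.one_mem⟩
    | mul g g' _ _ h h' =>
      obtain ⟨k, hk⟩ := h
      obtain ⟨k', hk'⟩ := h'
      exact ⟨k * k', S.mul_mem hk hk'⟩
    | inv g _ h =>
      obtain ⟨k, hk⟩ := h
      exact ⟨k⁻¹, S.inv_mem hk⟩
  have huniq : ∀ g k k', (g, k) ∈ S → (g, k') ∈ S → k = k' := by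
    intro g k k' h h'
    have := hS _ (S.mul_mem h (S.inv_mem h')) (by simp)
    have h2 : k * k'⁻¹ = 1 := congrArg Prod.snd this
    exact mul_inv_eq_one.1 h2
  choose f hf using hex
  refine ⟨MonoidHom.mk' (fun g => f g.1 g.2) ?_, ?_, ?_⟩
  · intro g g'
    exact huniq _ _ _ (hf _ _) (S.mul_mem (hf _ g.2) (hf _ g'.2))
  · exact huniq _ _ _ (hf _ _) (Subgroup.subset_closure (by simp))
  · exact huniq _ _ _ (hf _ _) (Subgroup.subset_closure (by simp))

end NormalForm

/-! ### The action of the Fuchsian group on the boundary -/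

/-- The element of `PSL(2, ℝ)` represented by a matrix. -/
abbrev psl (S : SL(2, ℝ)) : PSL(2, ℝ) := QuotientGroup.mk S

/-- The matrix with the given entries and determinant one. -/
noncomputable def mkSL (p q r s : ℝ) (h : p * s - q * r = 1) : SL(2, ℝ) :=
  ⟨!![p, q; r, s], by rw [Matrix.det_fin_two_of, h]⟩

theorem mkSL_mul {p q r s p' q' r' s' : ℝ} (h : p * s - q * r = 1) (h' : p' * s' - q' * r' = 1) :
    mkSL p q r s h * mkSL p' q' r' s' h' =
      mkSL (p * p' + q * r') (p * q' + q * s') (r * p' + s * r') (r * q' + s * s')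
        (by linear_combination (p' * s' - q' * r') * h + h') := by
  apply Subtype.ext
  exact Matrix.mul_fin_two _ _ _ _ _ _ _ _

theorem mkSL_inv {p q r s : ℝ} (h : p * s - q * r = 1) :
    (mkSL p q r s h)⁻¹ = mkSL s (-q) (-r) p (by linarith) := by
  apply Subtype.ext
  rw [Matrix.SpecialLinearGroup.coe_inv]
  exact Matrix.adjugate_fin_two_of _ _ _ _

theorem neg_mkSL {p q r s : ℝ} (h : p * s - q * r = 1) :
    -mkSL p q r s h = mkSL (-p) (-q) (-r) (-s) (by linarith) := by
  ext i j
  fin_cases i <;> fin_cases j <;> rfl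

theorem mkSL_one : mkSL 1 0 0 1 (by norm_num) = 1 := by
  ext i j
  fin_cases i <;> fin_cases j <;> rfl

theorem psl_mul (S T : SL(2, ℝ)) : psl S * psl T = psl (S * T) := rfl

theorem psl_inv (S : SL(2, ℝ)) : (psl S)⁻¹ = psl S⁻¹ := rfl

theorem psl_one : psl 1 = 1 := rfl

theorem psl_surjective (g : PSL(2, ℝ)) : ∃ S, psl S = g := QuotientGroup.mk_surjective g

theorem psl_neg (S : SL(2, ℝ)) : psl (-S) = psl S := by
  rw [psl, psl, QuotientGroup.eq, Matrix.SpecialLinearGroup.mem_center_iff]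
  refine ⟨-1, by simp, ?_⟩
  have : (-S)⁻¹ * S = -1 := by
    rw [inv_mul_eq_iff_eq_mul]; simp
  rw [this]
  ext i j
  fin_cases i <;> fin_cases j <;> simp

theorem psl_smul_infty (S : SL(2, ℝ)) : psl S • (∞ : OnePoint ℝ) =
    if S 1 0 = 0 then ∞ else ((S 0 0 / S 1 0 : ℝ) : OnePoint ℝ) :=
  OnePoint.smul_infty_eq_ite (S : GL (Fin 2) ℝ)

theorem psl_smul_coe (S : SL(2, ℝ)) (x : ℝ) : psl S • (x : OnePoint ℝ) =
    if S 1 0 * x + S 1 1 = 0 then ∞ else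
      (((S 0 0 * x + S 0 1) / (S 1 0 * x + S 1 1) : ℝ) : OnePoint ℝ) :=
  OnePoint.smul_some_eq_ite (g := (S : GL (Fin 2) ℝ))

/-- The boundary arc to the left of `[∞, 0]`: the positive real numbers. -/
def posArc : Set (OnePoint ℝ) := {ξ | ∃ x : ℝ, 0 < x ∧ ξ = x}

/-- The closure of the arc `posArc`. -/
def closedArc : Set (OnePoint ℝ) := {ξ | ξ = ∞ ∨ ∃ x : ℝ, 0 ≤ x ∧ ξ = x}

theorem posArc_subset_closedArc : posArc ⊆ closedArc := by
  rintro _ ⟨x, hx, rfl⟩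
  exact Or.inr ⟨x, hx.le, rfl⟩

theorem infty_mem_closedArc : (∞ : OnePoint ℝ) ∈ closedArc := Or.inl rfl

theorem zero_mem_closedArc : ((0 : ℝ) : OnePoint ℝ) ∈ closedArc := Or.inr ⟨0, le_rfl, rfl⟩

theorem infty_notMem_posArc : (∞ : OnePoint ℝ) ∉ posArc := by
  rintro ⟨x, -, h⟩
  exact OnePoint.infty_ne_coe x h

theorem coe_mem_posArc {x : ℝ} : (x : OnePoint ℝ) ∈ posArc ↔ 0 < x := by
  constructor
  · rintro ⟨y, hy, h⟩
    rwa [OnePoint.coe_eq_coe.1 h]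
  · exact fun h => ⟨x, h, rfl⟩

theorem zero_notMem_posArc : ((0 : ℝ) : OnePoint ℝ) ∉ posArc := by
  simp [coe_mem_posArc]

theorem mem_posArc_of_mem_closedArc {ξ : OnePoint ℝ} (h : ξ ∈ closedArc) (h₁ : ξ ≠ ∞)
    (h₂ : ξ ≠ ((0 : ℝ) : OnePoint ℝ)) : ξ ∈ posArc := by
  rcases h with rfl | ⟨x, hx, rfl⟩
  · exact absurd rfl h₁
  · exact ⟨x, lt_of_le_of_ne hx (fun h0 => h₂ (by rw [h0])), rfl⟩

theorem rotI_eq : rotI = psl (mkSL 0 1 (-1) 0 (by norm_num)) := rfl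

theorem rotI_mul_rotI : rotI * rotI = 1 := by
  rw [rotI_eq, psl_mul, mkSL_mul, ← psl_neg, neg_mkSL, ← psl_one, ← mkSL_one]
  congr 2 <;> norm_num

theorem rotI_inv : rotI⁻¹ = rotI := inv_eq_of_mul_eq_one_left rotI_mul_rotI

theorem rotI_smul_rotI_smul {X : Type*} [MulAction PSL(2, ℝ) X] (ξ : X) :
    rotI • rotI • ξ = ξ := by
  rw [← mul_smul, rotI_mul_rotI, one_smul]

theorem rotI_smul_infty : rotI • (∞ : OnePoint ℝ) = ((0 : ℝ) : OnePoint ℝ) := by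
  rw [rotI_eq, psl_smul_infty]
  simp [mkSL]

theorem rotI_smul_zero : rotI • ((0 : ℝ) : OnePoint ℝ) = ∞ := by
  rw [rotI_eq, psl_smul_coe]
  simp [mkSL]

theorem rotI_smul_coe {x : ℝ} (hx : x ≠ 0) :
    rotI • (x : OnePoint ℝ) = ((-x⁻¹ : ℝ) : OnePoint ℝ) := by
  rw [rotI_eq, psl_smul_coe]
  simp [mkSL, hx, ← inv_neg]

theorem mem_posArc_or (ξ : OnePoint ℝ) : ξ ∈ posArc ∨ rotI • ξ ∈ closedArc := by
  induction ξ using OnePoint.rec with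
  | infty => exact Or.inr (by rw [rotI_smul_infty]; exact zero_mem_closedArc)
  | coe x =>
    rcases lt_trichotomy x 0 with h | rfl | h
    · refine Or.inr ?_
      rw [rotI_smul_coe h.ne]
      exact Or.inr ⟨_, by have := inv_lt_zero.2 h; linarith, rfl⟩
    · exact Or.inr (by rw [rotI_smul_zero]; exact infty_mem_closedArc)
    · exact Or.inl (coe_mem_posArc.2 h)

theorem rotI_smul_notMem_closedArc {ξ : OnePoint ℝ} (h : ξ ∈ posArc) : rotI • ξ ∉ closedArc := by
  obtain ⟨x, hx, rfl⟩ := h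
  rw [rotI_smul_coe hx.ne']
  rintro (h | ⟨y, hy, h⟩)
  · exact OnePoint.coe_ne_infty _ h
  · rw [OnePoint.coe_eq_coe] at h
    have := inv_pos.2 hx
    linarith

/-- The matrix of the rotation `R_*`, whose entries are quadratic in `cosh a` and `sinh a`. -/
theorem exists_rotRstar_eq {a : ℝ} (ha : 0 < a) : ∃ x z : ℝ, 0 < x ∧ 0 < z ∧
    ∃ h : -(z + 1) * z - x * -x = 1, rotRstar a = psl (mkSL (-(z + 1)) x (-x) z h) := by
  have hc : 0 < Real.cosh a := Real.cosh_pos a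
  have hs : 0 < Real.sinh a := Real.sinh_pos_iff.2 ha
  have h1 := Real.cosh_sq a
  refine ⟨Real.cosh a ^ 2 + Real.sinh a ^ 2 + Real.cosh a * Real.sinh a,
    Real.sinh a ^ 2 + 2 * (Real.cosh a * Real.sinh a), by positivity, by positivity, ?_, ?_⟩
  · linear_combination (Real.cosh a ^ 2 + 1 + 2 * (Real.cosh a * Real.sinh a)) * h1
  · change psl (mkSL (Real.cosh a) (Real.sinh a) (Real.sinh a) (Real.cosh a) (by linarith)) *
      psl (mkSL (-1) 1 (-1) 0 (by norm_num)) * (psl (mkSL _ _ _ _ (by linarith)))⁻¹ = _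
    rw [psl_inv, mkSL_inv, psl_mul, psl_mul, mkSL_mul, mkSL_mul]
    congr 2 <;> linarith

theorem rotRstar_cube {a : ℝ} (ha : 0 < a) : rotRstar a * rotRstar a * rotRstar a = 1 := by
  obtain ⟨x, z, hx, hz, h2, h⟩ := exists_rotRstar_eq ha
  rw [h, psl_mul, psl_mul, mkSL_mul, mkSL_mul, ← psl_one, ← mkSL_one]
  congr 2
  · linear_combination (z + 2) * h2
  · linear_combination (-x) * h2
  · linear_combination x * h2
  · linear_combination (1 - z) * h2

/-- The elements of `PSL(2, ℝ)` represented by a matrix with positive entries. -/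
def IsPos (g : PSL(2, ℝ)) : Prop := ∃ S : SL(2, ℝ), g = psl S ∧ ∀ i j, 0 < S i j

theorem IsPos.mul {g g' : PSL(2, ℝ)} (h : IsPos g) (h' : IsPos g') : IsPos (g * g') := by
  obtain ⟨S, rfl, hS⟩ := h
  obtain ⟨S', rfl, hS'⟩ := h'
  refine ⟨S * S', rfl, fun i j => ?_⟩
  rw [Matrix.SpecialLinearGroup.coe_mul, Matrix.mul_apply, Fin.sum_univ_two]
  have := mul_pos (hS i 0) (hS' 0 j)
  have := mul_pos (hS i 1) (hS' 1 j)
  linarith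

theorem IsPos.smul_mem {g : PSL(2, ℝ)} (h : IsPos g) {ξ : OnePoint ℝ} (hξ : ξ ∈ closedArc) :
    g • ξ ∈ posArc := by
  obtain ⟨S, rfl, hS⟩ := h
  have h00 := hS 0 0
  have h01 := hS 0 1
  have h10 := hS 1 0
  have h11 := hS 1 1
  rcases hξ with rfl | ⟨x, hx, rfl⟩
  · rw [psl_smul_infty, if_neg h10.ne']
    exact ⟨_, by positivity, rfl⟩
  · have h : 0 < S 1 0 * x + S 1 1 := by positivity
    rw [psl_smul_coe, if_neg h.ne']
    exact ⟨_, by positivity, rfl⟩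

/-- The generators `R_* I` and `R_*² I` of the semigroup of the leaves to the left of `[∞, 0]`. -/
noncomputable abbrev gam (a : ℝ) (k : Bool) : PSL(2, ℝ) := syllable rotI (rotRstar a) k

theorem isPos_gam {a : ℝ} (ha : 0 < a) (k : Bool) : IsPos (gam a k) := by
  obtain ⟨x, z, hx, hz, h2, h⟩ := exists_rotRstar_eq ha
  have hz1 : 0 < z + 1 := by linarith
  cases k
  · refine ⟨mkSL x z (z + 1) x (by linarith), ?_, ?_⟩
    · simp only [gam, syllable, Bool.false_eq_true, if_false]
      rw [h, rotI_eq, psl_mul, psl_mul, mkSL_mul, mkSL_mul]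
      congr 2 <;> linarith
    · intro i j
      fin_cases i <;> fin_cases j <;> simpa [mkSL]
  · refine ⟨mkSL x (z + 1) z x (by linarith), ?_, ?_⟩
    · rw [← psl_neg]
      simp only [gam, syllable, if_true]
      rw [h, rotI_eq, psl_mul, mkSL_mul, neg_mkSL]
      congr 2 <;> linarith
    · intro i j
      fin_cases i <;> fin_cases j <;> simpa [mkSL]

theorem isPos_word {a : ℝ} (ha : 0 < a) (k : Bool) (l : List Bool) :
    IsPos (word rotI (rotRstar a) (k :: l)) := by
  induction l generalizing k with
  | nil => simpa [word] using isPos_gam ha k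
  | cons k' l ih =>
    have := (isPos_gam ha k).mul (ih k')
    simpa [word] using this

theorem word_smul_mem_posArc {a : ℝ} (ha : 0 < a) (l : List Bool) {ξ : OnePoint ℝ}
    (hξ : ξ ∈ posArc) : word rotI (rotRstar a) l • ξ ∈ posArc := by
  cases l with
  | nil => simpa [word] using hξ
  | cons k l => exact (isPos_word ha k l).smul_mem (posArc_subset_closedArc hξ)

/-- Since `R_*^n = (R_*^n I) I`, the nontrivial powers of `R_*` map the closed arc opposite to that
of `[∞, 0]` into the arc of `[∞, 0]`. -/
theorem rotRstar_pow_smul {a : ℝ} (ha : 0 < a) {n : Fin 3} (hn : n ≠ 0) {ξ : OnePoint ℝ}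
    (hξ : rotI • ξ ∈ closedArc) : rotRstar a ^ (n : ℕ) • ξ ∈ posArc := by
  have h : ∀ k : Bool, (if k then rotRstar a else rotRstar a * rotRstar a) • ξ ∈ posArc := by
    intro k
    have := (isPos_gam ha k).smul_mem hξ
    rwa [gam, syllable, mul_smul, rotI_smul_rotI_smul] at this
  fin_cases n
  · exact absurd rfl hn
  · simpa using h true
  · simpa [pow_two] using h false

/-- Neither the arc of `[∞, 0]` nor its image under `I` contains `0`. -/
theorem prefix_smul_ne {b : Bool} {ξ : OnePoint ℝ} (hξ : ξ ∈ posArc) :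
    (if b then rotI else 1) • ξ ≠ ((0 : ℝ) : OnePoint ℝ) := by
  cases b
  · intro h
    rw [if_neg (by simp), one_smul] at h
    exact zero_notMem_posArc (h ▸ hξ)
  · intro h
    rw [if_pos rfl] at h
    exact rotI_smul_notMem_closedArc hξ (h ▸ zero_mem_closedArc)

/-- The point `0` has a trivial stabilizer, in the strong sense that nontrivial normal forms move
it. -/
theorem normalForm_trivial_of_smul_zero {a : ℝ} (ha : 0 < a) {b : Bool} {l : List Bool} {n : Fin 3}
    (h : normalForm rotI (rotRstar a) b l n • ((0 : ℝ) : OnePoint ℝ) = ((0 : ℝ) : OnePoint ℝ)) :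
    b = false ∧ l = [] ∧ n = 0 := by
  have h0 : rotI • ((0 : ℝ) : OnePoint ℝ) ∈ closedArc := by
    rw [rotI_smul_zero]; exact infty_mem_closedArc
  by_cases hn : n = 0
  · subst hn
    cases l with
    | nil =>
      cases b
      · exact ⟨rfl, rfl, rfl⟩
      · simp [normalForm, word, rotI_smul_zero] at h
    | cons k l =>
      simp only [normalForm, Fin.coe_ofNat_eq_mod, Nat.zero_mod, pow_zero, mul_one, mul_smul] at h
      exact absurd h (prefix_smul_ne ((isPos_word ha k l).smul_mem zero_mem_closedArc))
  · simp only [normalForm, mul_smul] at h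
    exact absurd h (prefix_smul_ne (word_smul_mem_posArc ha l (rotRstar_pow_smul ha hn h0)))

theorem mem_Gam_exists_normalForm {a : ℝ} (ha : 0 < a) {g : PSL(2, ℝ)} (hg : g ∈ Gam a) :
    ∃ b l n, g = normalForm rotI (rotRstar a) b l n :=
  exists_normalForm rotI_mul_rotI (rotRstar_cube ha) hg

theorem eq_one_of_smul_zero {a : ℝ} (ha : 0 < a) {g : PSL(2, ℝ)} (hg : g ∈ Gam a)
    (h : g • ((0 : ℝ) : OnePoint ℝ) = ((0 : ℝ) : OnePoint ℝ)) : g = 1 := by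
  obtain ⟨b, l, n, rfl⟩ := mem_Gam_exists_normalForm ha hg
  obtain ⟨rfl, rfl, rfl⟩ := normalForm_trivial_of_smul_zero ha h
  simp [normalForm, word]

/-- If the arc of a leaf meets the arc of `[∞, 0]` and does not contain `0`, then the leaf is the
image of `[∞, 0]` under the semigroup generated by `R_* I` and `R_*² I`. -/
theorem exists_eq_word {a : ℝ} (ha : 0 < a) {g : PSL(2, ℝ)} (hg : g ∈ Gam a)
    (h0 : g⁻¹ • ((0 : ℝ) : OnePoint ℝ) ∉ posArc) {ξ : OnePoint ℝ} (hξ : ξ ∈ posArc)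
    (hgξ : g • ξ ∈ posArc) : ∃ l, g = word rotI (rotRstar a) l := by
  obtain ⟨b, l, n, rfl⟩ := mem_Gam_exists_normalForm ha hg
  have hn : n = 0 := by
    by_contra hn
    set g := normalForm rotI (rotRstar a) b l n with hgdef
    have h1 := (mem_posArc_or (g⁻¹ • ((0 : ℝ) : OnePoint ℝ))).resolve_left h0
    have h2 := prefix_smul_ne (b := b)
      (word_smul_mem_posArc ha l (rotRstar_pow_smul ha hn h1))
    rw [← mul_smul, ← mul_smul] at h2
    exact h2 (smul_inv_smul g _)
  subst hn
  refine ⟨l, ?_⟩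
  cases b
  · simp [normalForm]
  · exfalso
    have h1 : normalForm rotI (rotRstar a) true l 0 = rotI * word rotI (rotRstar a) l := by
      simp [normalForm]
    rw [h1, mul_smul] at hgξ
    exact rotI_smul_notMem_closedArc (word_smul_mem_posArc ha l hξ)
      (posArc_subset_closedArc hgξ)

theorem exists_monoidHom_Gam {a : ℝ} (ha : 0 < a) {K : Type*} [Group K] {x y : K}
    (hx : x * x = 1) (hy : y * y * y = 1) : ∃ f : Gam a →* K,
      f ⟨rotI, Subgroup.subset_closure (by simp)⟩ = x ∧
        f ⟨rotRstar a, Subgroup.subset_closure (by simp)⟩ = y :=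
  exists_monoidHom_of_normalForm rotI_mul_rotI (rotRstar_cube ha)
    (fun b l n h => normalForm_trivial_of_smul_zero ha (by rw [h, one_smul])) hx hy

/-! ### Sides of leaves -/

theorem exists_smul_eq_of_e0_map_eq {g g' : PSL(2, ℝ)} (h : e0.map g = e0.map g') :
    ∃ c : ℝ, 0 < c ∧ ∀ x : ℝ, (g⁻¹ * g') • (x : OnePoint ℝ) = ((c * x : ℝ) : OnePoint ℝ) := by
  have h1 : g • (∞ : OnePoint ℝ) = g' • ∞ := congrArg Geodesic.tail h
  have h2 : g • ((0 : ℝ) : OnePoint ℝ) = g' • ((0 : ℝ) : OnePoint ℝ) := congrArg Geodesic.head h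
  have h1' : (g⁻¹ * g') • (∞ : OnePoint ℝ) = ∞ := by rw [mul_smul, ← h1, inv_smul_smul]
  have h2' : (g⁻¹ * g') • ((0 : ℝ) : OnePoint ℝ) = ((0 : ℝ) : OnePoint ℝ) := by
    rw [mul_smul, ← h2, inv_smul_smul]
  obtain ⟨S, hS⟩ := psl_surjective (g⁻¹ * g')
  rw [← hS] at h1' h2' ⊢
  have h10 : S 1 0 = 0 := by
    by_contra h
    rw [psl_smul_infty, if_neg h] at h1'
    exact OnePoint.coe_ne_infty _ h1'
  have hdet := S.det_coe
  rw [Matrix.det_fin_two] at hdet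
  have hdet' : S 0 0 * S 1 1 = 1 := by
    have : S 0 0 * S 1 1 - S 0 1 * S 1 0 = 1 := hdet
    rwa [h10, mul_zero, sub_zero] at this
  have h11 : S 1 1 ≠ 0 := right_ne_zero_of_mul (hdet' ▸ one_ne_zero)
  have h01 : S 0 1 = 0 := by
    rw [psl_smul_coe, h10, if_neg (by simpa using h11), OnePoint.coe_eq_coe] at h2'
    simpa [h11] using h2'
  refine ⟨S 0 0 / S 1 1, ?_, fun x => ?_⟩
  · rw [div_eq_mul_inv]
    have : (S 1 1)⁻¹ = S 0 0 := inv_eq_of_mul_eq_one_left hdet'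
    rw [this]
    exact mul_self_pos.2 (left_ne_zero_of_mul (hdet' ▸ one_ne_zero))
  · rw [psl_smul_coe, h10, if_neg (by simpa using h11), h01, OnePoint.coe_eq_coe]
    rw [zero_mul, zero_add, add_zero, mul_div_right_comm]

theorem mem_leftSide_map {g : PSL(2, ℝ)} {ξ : OnePoint ℝ} :
    ξ ∈ (e0.map g).leftSide ↔ g⁻¹ • ξ ∈ posArc := by
  constructor
  · rintro ⟨g', h, x, hx, rfl⟩
    obtain ⟨c, hc, h'⟩ := exists_smul_eq_of_e0_map_eq h
    exact ⟨c * x, mul_pos hc hx, by rw [← mul_smul, h']⟩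
  · rintro ⟨x, hx, h⟩
    exact ⟨g, rfl, x, hx, by rw [← h, smul_inv_smul]⟩

theorem mem_rightSide_map {g : PSL(2, ℝ)} {ξ : OnePoint ℝ} :
    ξ ∈ (e0.map g).rightSide ↔ (g * rotI)⁻¹ • ξ ∈ posArc := by
  rw [_root_.mul_inv_rev, rotI_inv, mul_smul]
  constructor
  · rintro ⟨g', h, x, hx, rfl⟩
    obtain ⟨c, hc, h'⟩ := exists_smul_eq_of_e0_map_eq h
    have hcx := mul_neg_of_pos_of_neg hc hx
    rw [← mul_smul g⁻¹, h', rotI_smul_coe hcx.ne, coe_mem_posArc]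
    have := inv_lt_zero.2 hcx
    linarith
  · rintro ⟨x, hx, h⟩
    refine ⟨g, rfl, -x⁻¹, by have := inv_pos.2 hx; linarith, ?_⟩
    rw [← rotI_smul_coe hx.ne', ← h, rotI_smul_rotI_smul, smul_inv_smul]

/-! ### The limit set -/

/-- An element of `PSL(2, ℝ)` acts on the upper half-plane and on its boundary as the restriction
of a Möbius transformation of the Riemann sphere. -/
theorem exists_complexification (g : PSL(2, ℝ)) : ∃ T : GL (Fin 2) ℂ,
    (∀ z : ℍ, (((g • z : ℍ) : ℂ) : OnePoint ℂ) = T • ((z : ℂ) : OnePoint ℂ)) ∧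
      ∀ ξ : OnePoint ℝ,
        OnePoint.map Complex.ofReal (g • ξ) = T • OnePoint.map Complex.ofReal ξ := by
  obtain ⟨S, rfl⟩ := psl_surjective g
  refine ⟨GeneralLinearGroup.map Complex.ofRealHom (S : GL (Fin 2) ℝ), fun z => ?_, fun ξ => ?_⟩
  · have hdet : 0 < (GeneralLinearGroup.det (S : GL (Fin 2) ℝ)).val := by
      simp
    have h1 := UpperHalfPlane.coe_smul_of_det_pos hdet z
    have h2 := UpperHalfPlane.denom_ne_zero (S : GL (Fin 2) ℝ) z
    rw [OnePoint.smul_some_eq_ite, if_neg]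
    · congr 1
    · exact h2
  · exact OnePoint.map_smul Complex.ofRealHom (S : GL (Fin 2) ℝ) ξ

theorem smul_mem_limitSet {G : Subgroup PSL(2, ℝ)} {g : PSL(2, ℝ)} (hg : g ∈ G) {ξ : OnePoint ℝ}
    (hξ : ξ ∈ limitSet G) : g • ξ ∈ limitSet G := by
  obtain ⟨T, h₁, h₂⟩ := exists_complexification g
  change OnePoint.map Complex.ofReal (g • ξ) ∈ closure _
  rw [h₂]
  refine map_mem_closure (continuous_moebius T) hξ ?_
  rintro _ ⟨h, hh, rfl⟩
  exact ⟨g * h, G.mul_mem hg hh, by rw [mul_smul, h₁]⟩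

theorem rotI_smul_I : rotI • UpperHalfPlane.I = UpperHalfPlane.I := by
  apply UpperHalfPlane.ext
  have h := UpperHalfPlane.coe_smul_of_det_pos
    (g := ((mkSL 0 1 (-1) 0 (by norm_num) : SL(2, ℝ)) : GL (Fin 2) ℝ)) (by simp) UpperHalfPlane.I
  refine h.trans ?_
  change (((0 : ℝ) : ℂ) * Complex.I + ((1 : ℝ) : ℂ)) /
    (((-1 : ℝ) : ℂ) * Complex.I + ((0 : ℝ) : ℂ)) = Complex.I
  simp

theorem rotI_mem_Gam (a : ℝ) : rotI ∈ Gam a := Subgroup.subset_closure (by simp)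

theorem rotRstar_mem_Gam (a : ℝ) : rotRstar a ∈ Gam a := Subgroup.subset_closure (by simp)

theorem gam_mem_Gam (a : ℝ) (k : Bool) : gam a k ∈ Gam a := by
  have h := rotRstar_mem_Gam a
  cases k
  · exact (Gam a).mul_mem ((Gam a).mul_mem h h) (rotI_mem_Gam a)
  · exact (Gam a).mul_mem h (rotI_mem_Gam a)

theorem GamO_le_Gam (a : ℝ) : GamO a ≤ Gam a := by
  rw [GamO, Subgroup.closure_le]
  rintro _ (rfl | rfl)
  · exact rotRstar_mem_Gam a
  · exact (Gam a).mul_mem ((Gam a).mul_mem (rotI_mem_Gam a) (rotRstar_mem_Gam a)) (rotI_mem_Gam a)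

theorem mem_GamO_or {a : ℝ} {g : PSL(2, ℝ)} (hg : g ∈ Gam a) : g ∈ GamO a ∨ g * rotI ∈ GamO a := by
  have hA : rotRstar a ∈ GamO a := Subgroup.subset_closure (by simp)
  have hB : rotI * rotRstar a * rotI ∈ GamO a := Subgroup.subset_closure (by simp)
  have key : ∀ x y, (y = rotI ∨ y = rotRstar a ∨ y = (rotRstar a)⁻¹) →
      (x ∈ GamO a ∨ x * rotI ∈ GamO a) → (x * y ∈ GamO a ∨ x * y * rotI ∈ GamO a) := by
    rintro x y (rfl | hy) (h | h)
    · right; rwa [mul_assoc, rotI_mul_rotI, mul_one]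
    · exact Or.inl h
    · left
      refine (GamO a).mul_mem h ?_
      rcases hy with rfl | rfl
      · exact hA
      · exact (GamO a).inv_mem hA
    · right
      have h2 : x * y * rotI = (x * rotI) * (rotI * y * rotI) := by
        rw [← mul_assoc, ← mul_assoc, mul_assoc x rotI rotI, rotI_mul_rotI, mul_one]
      rw [h2]
      refine (GamO a).mul_mem h ?_
      rcases hy with rfl | rfl
      · exact hB
      · have := (GamO a).inv_mem hB
        simpa [_root_.mul_inv_rev, rotI_inv, mul_assoc] using this
  induction hg using Subgroup.closure_induction_right with
  | one => exact Or.inl (GamO a).one_mem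
  | mul_right x hx y hy ih =>
    exact key x y (by rcases hy with rfl | rfl <;> simp) ih
  | mul_inv_cancel x hx y hy ih =>
    refine key x y⁻¹ ?_ ih
    rcases hy with rfl | rfl
    · exact Or.inl rotI_inv
    · exact Or.inr (Or.inr rfl)

/-- The limit sets of `Γ_o` and `Γ` agree, as `Γ_o` has index at most two in `Γ` and `I` fixes the
base point. -/
theorem limitSet_GamO (a : ℝ) : limitSet (GamO a) = limitSet (Gam a) := by
  have h : {z : OnePoint ℂ | ∃ g ∈ GamO a, z = (((g • UpperHalfPlane.I : ℍ) : ℂ) : OnePoint ℂ)} =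
      {z : OnePoint ℂ | ∃ g ∈ Gam a, z = (((g • UpperHalfPlane.I : ℍ) : ℂ) : OnePoint ℂ)} := by
    ext z
    constructor
    · rintro ⟨g, hg, rfl⟩
      exact ⟨g, GamO_le_Gam a hg, rfl⟩
    · rintro ⟨g, hg, rfl⟩
      rcases mem_GamO_or hg with h | h
      · exact ⟨g, h, rfl⟩
      · exact ⟨g * rotI, h, by rw [mul_smul, rotI_smul_I]⟩
  rw [limitSet, limitSet, h]

/-- The closed half-plane to the left of `[∞, 0]`, doubled by complex conjugation. -/
def halfSphere : Set (OnePoint ℂ) := {z | z = ∞ ∨ ∃ w : ℂ, 0 ≤ w.re ∧ z = w}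

theorem isClosed_halfSphere : IsClosed halfSphere := by
  have h : (OnePoint.some ⁻¹' halfSphere : Set ℂ) = {w | 0 ≤ w.re} := by
    ext w
    constructor
    · rintro (h | ⟨w', h, h'⟩)
      · exact absurd h (OnePoint.coe_ne_infty _)
      · rw [OnePoint.coe_eq_coe.1 h']
        exact h
    · exact fun h => Or.inr ⟨w, h, rfl⟩
  rw [OnePoint.isClosed_iff_of_mem (Or.inl rfl), h]
  exact isClosed_le continuous_const Complex.continuous_re

theorem mem_closedArc_of_mem_halfSphere {ξ : OnePoint ℝ}
    (h : OnePoint.map Complex.ofReal ξ ∈ halfSphere) : ξ ∈ closedArc := by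
  induction ξ using OnePoint.rec with
  | infty => exact infty_mem_closedArc
  | coe x =>
    rw [OnePoint.map_some] at h
    rcases h with h | ⟨w, h, h'⟩
    · exact absurd h (OnePoint.coe_ne_infty _)
    · rw [OnePoint.coe_eq_coe] at h'
      exact Or.inr ⟨x, by rw [← h'] at h; simpa using h, rfl⟩

theorem IsPos.re_smul_nonneg {g : PSL(2, ℝ)} (h : IsPos g) {z : ℍ} (hz : 0 ≤ (z : ℂ).re) :
    0 ≤ ((g • z : ℍ) : ℂ).re := by
  obtain ⟨S, rfl, hS⟩ := h
  have h1 : ((psl S • z : ℍ) : ℂ) =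
      UpperHalfPlane.num (S : GL (Fin 2) ℝ) z / UpperHalfPlane.denom (S : GL (Fin 2) ℝ) z :=
    UpperHalfPlane.coe_smul_of_det_pos (by simp) z
  have h00 := hS 0 0
  have h01 := hS 0 1
  have h10 := hS 1 0
  have h11 := hS 1 1
  rw [h1, Complex.div_re, ← add_div]
  refine div_nonneg ?_ (Complex.normSq_nonneg _)
  simp only [UpperHalfPlane.num, UpperHalfPlane.denom, Complex.add_re, Complex.mul_re,
    Complex.ofReal_re, Complex.ofReal_im, Complex.add_im, Complex.mul_im, zero_mul, sub_zero,
    add_zero]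
  change 0 ≤ (S 0 0 * (z : ℂ).re + S 0 1) * (S 1 0 * (z : ℂ).re + S 1 1) +
    S 0 0 * (z : ℂ).im * (S 1 0 * (z : ℂ).im)
  have := sq_nonneg (z : ℂ).im
  have h3 : S 0 0 * (z : ℂ).im * (S 1 0 * (z : ℂ).im) = S 0 0 * S 1 0 * (z : ℂ).im ^ 2 := by ring
  rw [h3]
  positivity

/-- The orbit of the base point lies, apart from this point, in the half-planes bounded by the
images of `[∞, 0]` under `R_* I`, `R_*² I` and their translates by `I`. -/
theorem smul_I_cases {a : ℝ} (ha : 0 < a) {g : PSL(2, ℝ)} (hg : g ∈ Gam a) :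
    g • UpperHalfPlane.I = UpperHalfPlane.I ∨ ∃ (b k : Bool) (z : ℍ), 0 ≤ (z : ℂ).re ∧
      g • UpperHalfPlane.I = ((if b then rotI else 1) * gam a k) • z := by
  obtain ⟨b, l, n, rfl⟩ := mem_Gam_exists_normalForm ha hg
  have hn : n = 0 ∨ ∃ k, rotRstar a ^ (n : ℕ) = gam a k * rotI := by
    fin_cases n
    · exact Or.inl rfl
    · exact Or.inr ⟨true, by simp [gam, syllable, mul_assoc, rotI_mul_rotI]⟩
    · exact Or.inr ⟨false, by simp [gam, syllable, mul_assoc, rotI_mul_rotI, pow_two]⟩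
  have hI : 0 ≤ ((UpperHalfPlane.I : ℍ) : ℂ).re := by simp
  have hn' : 0 ≤ ((rotRstar a ^ (n : ℕ) • UpperHalfPlane.I : ℍ) : ℂ).re := by
    rcases hn with rfl | ⟨k, hk⟩
    · simp
    · rw [hk, mul_smul, rotI_smul_I]
      exact (isPos_gam ha k).re_smul_nonneg hI
  cases l with
  | nil =>
    rcases hn with rfl | ⟨k, hk⟩
    · left
      cases b
      · simp [normalForm, word]
      · simp [normalForm, word, rotI_smul_I]
    · right
      refine ⟨b, k, UpperHalfPlane.I, hI, ?_⟩
      rw [normalForm, hk]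
      simp only [word, List.map_nil, List.prod_nil, mul_one, mul_smul, rotI_smul_I]
  | cons k l =>
    right
    refine ⟨b, k, word rotI (rotRstar a) l • rotRstar a ^ (n : ℕ) • UpperHalfPlane.I, ?_, ?_⟩
    · cases l with
      | nil => simpa [word] using hn'
      | cons k' l => exact (isPos_word ha k' l).re_smul_nonneg hn'
    · rw [normalForm, word, List.map_cons, List.prod_cons]
      simp only [mul_smul]
      rfl

theorem exists_smul_mem_closedArc {a : ℝ} (ha : 0 < a) {ξ : OnePoint ℝ}
    (hξ : ξ ∈ limitSet (Gam a)) :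
    ∃ b k : Bool, ((if b then rotI else 1) * gam a k)⁻¹ • ξ ∈ closedArc := by
  choose T hT₁ hT₂ using fun b k : Bool =>
    exists_complexification ((if b then rotI else 1) * gam a k)⁻¹
  let F : Set (OnePoint ℂ) := {(((UpperHalfPlane.I : ℍ) : ℂ) : OnePoint ℂ)} ∪
    ⋃ b, ⋃ k, (fun z => T b k • z) ⁻¹' halfSphere
  have hF : IsClosed F := by
    refine isClosed_singleton.union (isClosed_iUnion_of_finite fun b =>
      isClosed_iUnion_of_finite fun k => isClosed_halfSphere.preimage (continuous_moebius _))
  have hsub : {z : OnePoint ℂ | ∃ g ∈ Gam a,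
      z = (((g • UpperHalfPlane.I : ℍ) : ℂ) : OnePoint ℂ)} ⊆ F := by
    rintro _ ⟨g, hg, rfl⟩
    rcases smul_I_cases ha hg with h | ⟨b, k, z, hz, h⟩
    · left; rw [h]; rfl
    · right
      refine Set.mem_iUnion.2 ⟨b, Set.mem_iUnion.2 ⟨k, ?_⟩⟩
      rw [Set.mem_preimage, ← hT₁, h, inv_smul_smul]
      exact Or.inr ⟨_, hz, rfl⟩
  have hmem := closure_minimal hsub hF hξ
  rcases hmem with h | h
  · exfalso
    rw [Set.mem_singleton_iff] at h
    induction ξ using OnePoint.rec with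
    | infty => exact OnePoint.infty_ne_coe _ h
    | coe x =>
      rw [OnePoint.map_some, OnePoint.coe_eq_coe] at h
      have := congrArg Complex.im h
      simp at this
  · obtain ⟨b, h⟩ := Set.mem_iUnion.1 h
    obtain ⟨k, h⟩ := Set.mem_iUnion.1 h
    rw [Set.mem_preimage, ← hT₂] at h
    exact ⟨b, k, mem_closedArc_of_mem_halfSphere h⟩

theorem mem_posArc_or_of_mem_limitSet {a : ℝ} (ha : 0 < a) {ξ : OnePoint ℝ}
    (hξ : ξ ∈ limitSet (Gam a)) : ξ ∈ posArc ∨ rotI • ξ ∈ posArc := by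
  obtain ⟨b, k, h⟩ := exists_smul_mem_closedArc ha hξ
  have h1 := (isPos_gam ha k).smul_mem h
  rw [_root_.mul_inv_rev, mul_smul, smul_inv_smul] at h1
  cases b
  · left; simpa using h1
  · right; simpa [rotI_inv] using h1

theorem zero_notMem_limitSet {a : ℝ} (ha : 0 < a) :
    ((0 : ℝ) : OnePoint ℝ) ∉ limitSet (Gam a) := by
  intro h
  rcases mem_posArc_or_of_mem_limitSet ha h with h | h
  · exact zero_notMem_posArc h
  · rw [rotI_smul_zero] at h
    exact infty_notMem_posArc h

theorem infty_notMem_limitSet {a : ℝ} (ha : 0 < a) : (∞ : OnePoint ℝ) ∉ limitSet (Gam a) := by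
  intro h
  have := smul_mem_limitSet (rotI_mem_Gam a) h
  rw [rotI_smul_infty] at this
  exact zero_notMem_limitSet ha this

theorem inv_smul_mem_posArc_or {a : ℝ} (ha : 0 < a) {ξ : OnePoint ℝ}
    (hξ : ξ ∈ limitSet (Gam a)) {g : PSL(2, ℝ)} (hg : g ∈ Gam a) :
    g⁻¹ • ξ ∈ posArc ∨ (g * rotI)⁻¹ • ξ ∈ posArc := by
  rw [_root_.mul_inv_rev, rotI_inv, mul_smul]
  exact mem_posArc_or_of_mem_limitSet ha (smul_mem_limitSet ((Gam a).inv_mem hg) hξ)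

theorem exists_gam_smul_mem {a : ℝ} (ha : 0 < a) {ξ : OnePoint ℝ} (hξ : ξ ∈ limitSet (Gam a))
    (h : ξ ∈ posArc) : ∃ k, (gam a k)⁻¹ • ξ ∈ posArc := by
  obtain ⟨b, k, h'⟩ := exists_smul_mem_closedArc ha hξ
  cases b
  · refine ⟨k, ?_⟩
    simp only [Bool.false_eq_true, if_false, one_mul] at h'
    have h2 := smul_mem_limitSet ((Gam a).inv_mem (gam_mem_Gam a k)) hξ
    refine mem_posArc_of_mem_closedArc h' ?_ ?_
    · intro h0
      exact infty_notMem_limitSet ha (h0 ▸ h2)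
    · intro h0
      exact zero_notMem_limitSet ha (h0 ▸ h2)
  · exfalso
    have h1 := (isPos_gam ha k).smul_mem h'
    rw [_root_.mul_inv_rev, mul_smul, smul_inv_smul, if_pos rfl, rotI_inv] at h1
    exact rotI_smul_notMem_closedArc h (posArc_subset_closedArc h1)

/-! ### Nested sequences of leaves -/

/-- The elements `w n` of `Γ` map `[∞, 0]` to a nested sequence of consecutive leaves, each having
`ξ` on its left. -/
structure IsChain (a : ℝ) (ξ : OnePoint ℝ) (w : ℕ → PSL(2, ℝ)) : Prop where
  mem : ∀ n, w n ∈ Gam a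
  step : ∀ n, ∃ k, w (n + 1) = w n * gam a k
  left : ∀ n, (w n)⁻¹ • ξ ∈ posArc

theorem exists_isChain {a : ℝ} (ha : 0 < a) {ξ : OnePoint ℝ} (hξ : ξ ∈ limitSet (Gam a)) :
    ∃ w, IsChain a ξ w := by
  have h0 : ∃ g : PSL(2, ℝ), g ∈ Gam a ∧ g⁻¹ • ξ ∈ posArc := by
    rcases inv_smul_mem_posArc_or ha hξ (Gam a).one_mem with h | h
    · exact ⟨_, (Gam a).one_mem, h⟩
    · exact ⟨_, (Gam a).mul_mem (Gam a).one_mem (rotI_mem_Gam a), h⟩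
  have hs : ∀ g : {g : PSL(2, ℝ) // g ∈ Gam a ∧ g⁻¹ • ξ ∈ posArc},
      ∃ g' : {g : PSL(2, ℝ) // g ∈ Gam a ∧ g⁻¹ • ξ ∈ posArc}, ∃ k, g'.1 = g.1 * gam a k := by
    rintro ⟨g, hg, h⟩
    obtain ⟨k, hk⟩ := exists_gam_smul_mem ha (smul_mem_limitSet ((Gam a).inv_mem hg) hξ) h
    rw [← mul_smul, ← _root_.mul_inv_rev] at hk
    exact ⟨⟨g * gam a k, (Gam a).mul_mem hg (gam_mem_Gam a k), hk⟩, k, rfl⟩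
  choose f hf using hs
  obtain ⟨g, hg⟩ := h0
  let w : ℕ → {g : PSL(2, ℝ) // g ∈ Gam a ∧ g⁻¹ • ξ ∈ posArc} :=
    fun n => Nat.rec ⟨g, hg⟩ (fun _ g => f g) n
  exact ⟨fun n => (w n).1, fun n => (w n).2.1, fun n => hf (w n), fun n => (w n).2.2⟩

theorem inv_smul_mem_of_mul_gam {a : ℝ} (ha : 0 < a) {g : PSL(2, ℝ)} {k : Bool} {ζ : OnePoint ℝ}
    (h : (g * gam a k)⁻¹ • ζ ∈ posArc) : g⁻¹ • ζ ∈ posArc := by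
  have := (isPos_gam ha k).smul_mem (posArc_subset_closedArc h)
  rwa [_root_.mul_inv_rev, mul_smul, smul_inv_smul] at this

/-- The arcs of a nested sequence of consecutive leaves shrink to a point: the transformations
`R_* I`, `R_*² I` contract the Hilbert metric of the arc of `[∞, 0]`. -/
theorem IsChain.eq_of_forall {a : ℝ} (ha : 0 < a) {ξ ζ : OnePoint ℝ} {w : ℕ → PSL(2, ℝ)}
    (hw : IsChain a ξ w) (hζ : ∀ n, (w n)⁻¹ • ζ ∈ posArc) : ζ = ξ := by
  choose S hS hSpos using isPos_gam ha
  obtain ⟨m, M, hm, hM, hb⟩ := exists_bounds (fun q : Bool × Fin 2 × Fin 2 => S q.1 q.2.1 q.2.2)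
    (fun q => hSpos _ _ _)
  choose k hk using hw.step
  choose x hx hxξ using hw.left
  choose y hy hyζ using hζ
  have hM0 : 0 < M := hm.trans hM
  -- if `u = γ v` for positive real numbers, then `(u, 1)` is a multiple of `S (v, 1)`
  have key : ∀ (j : Bool) (u v : ℝ), 0 < v → (u : OnePoint ℝ) = gam a j • (v : OnePoint ℝ) →
      ∃ s : ℝ, 0 < s ∧ ∀ i, (s • ![u, 1]) i = ∑ l, S j i l * ![v, 1] l := by
    intro j u v hv h
    have h10 := hSpos j 1 0
    have h11 := hSpos j 1 1
    have hden : 0 < S j 1 0 * v + S j 1 1 := by positivity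
    rw [hS, psl_smul_coe, if_neg hden.ne', OnePoint.coe_eq_coe] at h
    refine ⟨_, hden, fun i => ?_⟩
    fin_cases i
    · simp [Fin.sum_univ_two, h]
      field_simp
    · simp [Fin.sum_univ_two]
  have step : ∀ (η : OnePoint ℝ) (n : ℕ), (w n)⁻¹ • η = gam a (k n) • (w (n + 1))⁻¹ • η := by
    intro η n
    rw [hk, _root_.mul_inv_rev, mul_smul, smul_inv_smul]
  have hpos : ∀ u : ℝ, 0 < u → ∀ i, 0 < ![u, 1] i := by
    intro u hu i
    fin_cases i
    · simpa
    · simp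
  have h0 := eq_zero_of_le_mul_succ (κ := 1 - (m / M) ^ 2)
    (d := fun n => 1 - affinity ![x n, 1] ![y n, 1])
    (by
      have : (m / M) ^ 2 ≤ 1 := pow_le_one₀ (by positivity) ((div_le_one hM0).2 hM.le)
      linarith)
    (by have : 0 < (m / M) ^ 2 := by positivity
        linarith)
    (fun n => sub_nonneg.2 (affinity_le_one (hpos _ (hx n)) (hpos _ (hy n))))
    (fun n => by have := affinity_pos (hpos _ (hx n)) (hpos _ (hy n)); linarith)
    (fun n => by
      obtain ⟨s, hs, hs'⟩ := key (k n) (x n) (x (n + 1)) (hx _)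
        (by rw [← hxξ, ← hxξ]; exact step ξ n)
      obtain ⟨t, ht, ht'⟩ := key (k n) (y n) (y (n + 1)) (hy _)
        (by rw [← hyζ, ← hyζ]; exact step ζ n)
      have := one_sub_affinity_le hm (fun i j => hb (k n, i, j)) (hpos _ (hx (n + 1)))
        (hpos _ (hy (n + 1))) hs' ht'
      rwa [affinity_smul hs ht (hpos _ (hx n)) (hpos _ (hy n))] at this)
  have h1 := eq_minRatio_smul (hpos _ (hx 0)) (hpos _ (hy 0)) (by linarith)
  have h2 := h1 1
  have h3 := h1 0
  have hxy : x 0 = y 0 := by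
    simp only [cons_val_one, cons_val_zero, mul_one] at h2 h3
    rw [← h2, one_mul] at h3
    exact h3
  have h4 : (w 0)⁻¹ • ζ = (w 0)⁻¹ • ξ := by rw [hxξ, hyζ, hxy]
  exact smul_left_cancel _ h4

theorem IsChain.exists_notMem {a : ℝ} (ha : 0 < a) {ξ ζ : OnePoint ℝ} {w : ℕ → PSL(2, ℝ)}
    (hw : IsChain a ξ w) (h : ζ ≠ ξ) : ∃ N, ∀ n, (w (N + n))⁻¹ • ζ ∉ posArc := by
  by_contra! hcon
  refine h (hw.eq_of_forall ha fun n => ?_)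
  obtain ⟨m, hm⟩ := hcon n
  have : ∀ m, (w (n + m))⁻¹ • ζ ∈ posArc → (w n)⁻¹ • ζ ∈ posArc := by
    intro m
    induction m with
    | zero => exact id
    | succ m ih =>
      intro h
      obtain ⟨k, hk⟩ := hw.step (n + m)
      rw [← add_assoc, hk] at h
      exact ih (inv_smul_mem_of_mul_gam ha h)
  exact this m hm

theorem IsChain.tail {a : ℝ} {ξ : OnePoint ℝ} {w : ℕ → PSL(2, ℝ)} (hw : IsChain a ξ w) (N : ℕ) :
    IsChain a ξ fun n => w (N + n) :=
  ⟨fun _ => hw.mem _, fun n => hw.step (N + n), fun _ => hw.left _⟩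

/-- A nested sequence of consecutive leaves around a limit point is cofinal among the leaves which
have this point on their left. -/
theorem IsChain.exists_eq_mul_word {a : ℝ} (ha : 0 < a) {ξ : OnePoint ℝ}
    (hξ : ξ ∈ limitSet (Gam a)) {w : ℕ → PSL(2, ℝ)} (hw : IsChain a ξ w) {g : PSL(2, ℝ)}
    (hg : g ∈ Gam a) (h : g⁻¹ • ξ ∈ posArc) : ∃ N l, w N = g * word rotI (rotRstar a) l := by
  have hne : g • ((0 : ℝ) : OnePoint ℝ) ≠ ξ := by
    rintro rfl
    have := smul_mem_limitSet ((Gam a).inv_mem hg) hξ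
    rw [inv_smul_smul] at this
    exact zero_notMem_limitSet ha this
  obtain ⟨N, hN⟩ := hw.exists_notMem ha hne
  obtain ⟨l, hl⟩ := exists_eq_word ha ((Gam a).mul_mem ((Gam a).inv_mem hg) (hw.mem N))
    (by rw [_root_.mul_inv_rev, inv_inv, mul_smul]; exact hN 0) (hw.left N)
    (by rw [mul_smul, smul_inv_smul]; exact h)
  exact ⟨N, l, by rw [← hl, mul_inv_cancel_left]⟩

theorem gam_mul_rotI_mul_gam {a : ℝ} (ha : 0 < a) (k : Bool) :
    gam a k * rotI * gam a (!k) = rotI := by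
  have h := rotRstar_cube ha
  cases k
  · simp only [gam, syllable, Bool.false_eq_true, Bool.not_false, if_true, if_false]
    rw [mul_assoc _ rotI rotI, rotI_mul_rotI, mul_one, ← mul_assoc, h, one_mul]
  · simp only [gam, syllable, Bool.false_eq_true, Bool.not_true, if_true, if_false]
    rw [mul_assoc _ rotI rotI, rotI_mul_rotI, mul_one, ← mul_assoc, ← mul_assoc, h, one_mul]

/-- A leaf strictly to the left of another one is its image under a nonempty product of the
generators. -/
theorem exists_word_of_leftSide_ssubset {a : ℝ} (ha : 0 < a) {g g' : PSL(2, ℝ)} (hg : g ∈ Gam a)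
    (hg' : g' ∈ Gam a) (h : (e0.map g').leftSide ⊂ (e0.map g).leftSide) :
    ∃ k l, g' = g * word rotI (rotRstar a) (k :: l) := by
  have hsub : ∀ ξ, g'⁻¹ • ξ ∈ posArc → g⁻¹ • ξ ∈ posArc := fun ξ hξ =>
    mem_leftSide_map.1 (h.1 (mem_leftSide_map.2 hξ))
  have h1 : ((1 : ℝ) : OnePoint ℝ) ∈ posArc := coe_mem_posArc.2 one_pos
  obtain ⟨l, hl⟩ := exists_eq_word ha ((Gam a).mul_mem ((Gam a).inv_mem hg) hg')
    (by
      rw [_root_.mul_inv_rev, inv_inv, mul_smul]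
      intro h0
      have := hsub _ h0
      rw [inv_smul_smul] at this
      exact zero_notMem_posArc this)
    h1 (by rw [mul_smul]; exact hsub _ (by rwa [inv_smul_smul]))
  have hg'' : g' = g * word rotI (rotRstar a) l := by rw [← hl, mul_inv_cancel_left]
  cases l with
  | nil =>
    exfalso
    have : g' = g := by simpa [word] using hg''
    exact h.ne (by rw [this])
  | cons k l => exact ⟨k, l, hg''⟩

/-! ### Topology of the boundary arcs -/

theorem isOpen_posArc : IsOpen posArc := by
  rw [OnePoint.isOpen_iff_of_notMem infty_notMem_posArc]
  have : (OnePoint.some ⁻¹' posArc : Set ℝ) = Set.Ioi 0 := by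
    ext x
    exact coe_mem_posArc
  rw [this]
  exact isOpen_Ioi

theorem isOpen_smul_posArc (g : PSL(2, ℝ)) : IsOpen {ξ : OnePoint ℝ | g⁻¹ • ξ ∈ posArc} := by
  obtain ⟨S, hS⟩ := psl_surjective g⁻¹
  have : Continuous fun ξ : OnePoint ℝ => g⁻¹ • ξ := by
    rw [← hS]
    exact continuous_moebius (S : GL (Fin 2) ℝ)
  exact isOpen_posArc.preimage this

/-! ### The representation -/

/-- The projective images of the standard boxes, i.e. the convex overmarked boxes. -/
def Box.IsStandard (Θ : Box) : Prop := ∃ (g : PGL(3, ℝ)) (p : Param), Θ = (std p).map g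

namespace Box.IsStandard

variable {Θ : Box}

theorem isOvermarked (h : Θ.IsStandard) : Θ.IsOvermarked := by
  obtain ⟨g, p, rfl⟩ := h
  exact (std_isOvermarked p).map g

theorem isConvex (h : Θ.IsStandard) : Θ.IsConvex := by
  obtain ⟨g, p, rfl⟩ := h
  exact (std_isConvex p).map (std_isOvermarked p) g

theorem j (h : Θ.IsStandard) : Θ.j.IsStandard := by
  obtain ⟨g, p, rfl⟩ := h
  exact ⟨_, _, std_map_j g p⟩

theorem newI (h : Θ.IsStandard) (lam : ℝ × ℝ) : (Θ.newI lam).IsStandard := by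
  obtain ⟨g, p, rfl⟩ := h
  exact ⟨_, _, std_map_newI lam g p⟩

theorem newTau1 (h : Θ.IsStandard) (lam : ℝ × ℝ) : (Θ.newTau1 lam).IsStandard := by
  obtain ⟨g, p, rfl⟩ := h
  exact ⟨_, _, std_map_newTau1 lam g p⟩

theorem map (h : Θ.IsStandard) (g : PGL(3, ℝ)) : (Θ.map g).IsStandard := by
  obtain ⟨g', p, rfl⟩ := h
  exact ⟨_, _, Box.map_map _ _ _⟩

theorem of_sameMarked {Θ' : Box} (h : Θ'.SameMarked Θ) (hΘ : Θ.IsStandard) : Θ'.IsStandard := by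
  rcases h with rfl | rfl
  · exact hΘ
  · exact hΘ.j

theorem newI_map (h : Θ.IsStandard) (lam : ℝ × ℝ) (g : PGL(3, ℝ)) :
    (Θ.map g).newI lam = (Θ.newI lam).map g := by
  obtain ⟨g', p, rfl⟩ := h
  rw [Box.map_map, std_map_newI, std_map_newI, Box.map_map]
  simp only [mul_assoc]

theorem newTau1_map (h : Θ.IsStandard) (lam : ℝ × ℝ) (g : PGL(3, ℝ)) :
    (Θ.map g).newTau1 lam = (Θ.newTau1 lam).map g := by
  obtain ⟨g', p, rfl⟩ := h
  rw [Box.map_map, std_map_newTau1, std_map_newTau1, Box.map_map]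
  simp only [mul_assoc]

theorem newI_newI (h : Θ.IsStandard) (lam : ℝ × ℝ) : (Θ.newI lam).newI lam = Θ.j := by
  obtain ⟨g, p, rfl⟩ := h
  exact std_map_newI_newI lam g p

theorem newI_j (h : Θ.IsStandard) (lam : ℝ × ℝ) : Θ.j.newI lam = (Θ.newI lam).j := by
  obtain ⟨g, p, rfl⟩ := h
  exact newI_j_std lam g p

theorem newI_injective {Θ' : Box} (h : Θ.IsStandard) (h' : Θ'.IsStandard) {lam : ℝ × ℝ}
    (heq : Θ.newI lam = Θ'.newI lam) : Θ = Θ' := by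
  have := congrArg (fun Ψ => (Box.newI lam Ψ).j) heq
  simpa only [newI_newI h, newI_newI h', Box.j_j] using this

theorem map_injective (h : Θ.IsStandard) {g g' : PGL(3, ℝ)} (heq : Θ.map g = Θ.map g') :
    g = g' := by
  obtain ⟨k, p, rfl⟩ := h
  rw [Box.map_map, Box.map_map] at heq
  exact mul_right_cancel (eq_of_std_map_eq heq)

theorem sameMarked_newI {Θ' : Box} (hΘ : Θ.IsStandard) (lam : ℝ × ℝ) (h : Θ'.SameMarked Θ) :
    (Θ'.newI lam).SameMarked (Θ.newI lam) := by
  obtain ⟨g, p, rfl⟩ := hΘ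
  exact h.newI lam

theorem sameMarked_newTau1 {Θ' : Box} (hΘ : Θ.IsStandard) (lam : ℝ × ℝ) (h : Θ'.SameMarked Θ) :
    (Θ'.newTau1 lam).SameMarked (Θ.newTau1 lam) := by
  obtain ⟨g, p, rfl⟩ := hΘ
  exact h.newTau1 lam

end Box.IsStandard

/-- The matrix of `A_Θ^λ` in an adapted basis. It is of order three by Pappus' theorem. -/
theorem isA_std (lam : ℝ × ℝ) (g : PGL(3, ℝ)) (p : Param) :
    IsA lam ((std p).map g) (g * (cls (matK p) * cls matN * cls matJ) * g⁻¹) := by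
  have hsq : (std p).map (g * (cls (matK p) * cls matN * cls matJ) ^ 2) =
      ((((((std p).map g).newTau1 lam).newI lam).newTau1 lam).newI lam) := by
    rw [std_map_rho, std_map_rho, Param.rot_rot_rot_rot, K_rot_rot]
    congr 1
    simp only [pow_two, mul_assoc, J_comm_N]
  have hj : ((((std p).map g).newTau1 lam).newI lam).j =
      (std p).map (g * (cls (matK p) * cls matN * cls matJ)) := by
    rw [std_map_rho, std_map_j, Param.rot_rot_rot_rot]
    simp only [mul_assoc]
  refine ⟨?_, ?_, ?_⟩
  · change ((std p).map g).map _ = ((((std p).map g).newTau1 lam).newI lam).j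
    rw [hj, Box.map_map, inv_mul_cancel_right]
  · change ((((std p).map g).newTau1 lam).newI lam).j.map _ =
      ((((((std p).map g).newTau1 lam).newI lam).newTau1 lam).newI lam)
    rw [← hsq, hj, Box.map_map, pow_two]
    simp only [mul_assoc, inv_mul_cancel_left]
  · change ((((((std p).map g).newTau1 lam).newI lam).newTau1 lam).newI lam).map _ = _
    rw [← hsq, Box.map_map]
    have h3 := KNJ_cube p
    rw [pow_succ'] at h3
    rw [mul_assoc, inv_mul_cancel_left, mul_assoc, h3, mul_one]

/-- The transformation `B_Θ^λ` is `A^λ` of the box `i^λ Θ`. -/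
theorem isB_of_isA_newI {lam : ℝ × ℝ} {Θ : Box} (hΘ : Θ.IsStandard) {B : PGL(3, ℝ)}
    (h : IsA lam (Θ.newI lam) B) : IsB lam Θ B := by
  obtain ⟨h1, h2, h3⟩ := h
  have s1 := (hΘ.newI lam).newTau1 lam
  have s2 := (s1.newI lam).newTau1 lam
  refine ⟨(hΘ.map B).newI_injective s1.j (lam := lam) ?_,
    (s1.j.map B).newI_injective s2 (lam := lam) ?_,
    (s2.map B).newI_injective hΘ (lam := lam) ?_⟩
  · rw [hΘ.newI_map, s1.newI_j]
    exact h1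
  · rw [s1.j.newI_map, s1.newI_j]
    exact h2
  · rw [s2.newI_map]
    exact h3

/-- A labeling, seen as a function on the group `Γ`, with labels in normal form. -/
structure IsLabelMap (a : ℝ) (lam : ℝ × ℝ) (Θ : Box) (lab : PSL(2, ℝ) → Box) : Prop where
  base : (lab 1).SameMarked Θ
  isStandard : ∀ g ∈ Gam a, (lab g).IsStandard
  stepI : ∀ g ∈ Gam a, (lab (g * rotI)).SameMarked ((lab g).newI lam)
  stepR : ∀ g ∈ Gam a, (lab (g * rotRstar a)).SameMarked (((lab g).newTau1 lam).newI lam)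

/-- The homomorphism from `Γ` to the wreath product of `PGL(3, ℝ)` with the group of order two
which sends `I` to the transposition and `R_*` to the pair `(A_Θ^λ, B_Θ^λ)`. Its first component
gives both the representation of `Γ_o` and the labels. -/
theorem exists_representation {a : ℝ} (ha : 0 < a) (lam : ℝ × ℝ) {Θ : Box} (hΘ : Θ.IsStandard) :
    ∃ (ρ : GamO a →* PGL(3, ℝ)) (lab : PSL(2, ℝ) → Box), IsNewRepresentation a lam Θ ρ ∧
      IsLabelMap a lam Θ lab ∧
      ∀ (γ : GamO a), ∀ g ∈ Gam a, lab (γ * g) = (lab g).map (ρ γ) := by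
  let Ξ : ℤˣ → Box := fun u => if u = 1 then Θ else Θ.newI lam
  have hΞ1 : Ξ 1 = Θ := if_pos rfl
  have hΞ2 : Ξ (-1) = Θ.newI lam := if_neg (by decide)
  have hstd : ∀ u, (Ξ u).IsStandard := by
    intro u
    rcases Int.units_eq_one_or u with rfl | rfl
    · rw [hΞ1]; exact hΘ
    · rw [hΞ2]; exact hΘ.newI lam
  have hex : ∀ u, ∃ A : PGL(3, ℝ), A * A * A = 1 ∧ IsA lam (Ξ u) A := by
    intro u
    obtain ⟨g, p, hg⟩ := hstd u
    refine ⟨_, ?_, hg ▸ isA_std lam g p⟩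
    have h := KNJ_cube p
    rw [pow_succ, pow_two] at h
    calc _ = g * (cls (matK p) * cls matN * cls matJ * (cls (matK p) * cls matN * cls matJ) *
          (cls (matK p) * cls matN * cls matJ)) * g⁻¹ := by group
      _ = 1 := by rw [h, mul_one, mul_inv_cancel]
  choose A hA3 hA using hex
  obtain ⟨F, hFI, hFR⟩ := exists_monoidHom_Gam ha (K := PGL(3, ℝ) ≀ᵣ ℤˣ) (x := ⟨1, -1⟩)
    (y := ⟨A, 1⟩)
    (by ext u <;> simp) (by ext u <;> simp [hA3])
  let c : Gam a → PGL(3, ℝ) := fun g => (F g).left 1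
  let s : Gam a → ℤˣ := fun g => (F g).right
  have hs : ∀ g g', s (g * g') = s g * s g' := by
    intro g g'
    simp only [s, map_mul, RegularWreathProduct.mul_right]
  have hc : ∀ g g', c (g * g') = c g * (F g').left (s g) := by
    intro g g'
    simp only [c, s, map_mul, RegularWreathProduct.mul_left, Pi.mul_apply, mul_one,
      Int.units_inv_eq_self]
  have hsO : ∀ g (hg : g ∈ GamO a), s ⟨g, GamO_le_Gam a hg⟩ = 1 := by
    intro g hg
    induction hg using Subgroup.closure_induction with
    | mem g hg =>
      rcases hg with rfl | rfl
      · exact congrArg RegularWreathProduct.right hFR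
      · change s (⟨rotI, rotI_mem_Gam a⟩ * ⟨rotRstar a, rotRstar_mem_Gam a⟩ *
          ⟨rotI, rotI_mem_Gam a⟩) = 1
        rw [hs, hs]
        simp only [s]
        rw [hFI, hFR]
        simp
    | one => exact congrArg RegularWreathProduct.right (map_one F)
    | mul g g' hg hg' h h' =>
      exact (hs ⟨g, GamO_le_Gam a hg⟩ ⟨g', GamO_le_Gam a hg'⟩).trans (by rw [h, h', mul_one])
    | inv g hg h =>
      have h2 := hs ⟨g, GamO_le_Gam a hg⟩ ⟨g⁻¹, (Gam a).inv_mem (GamO_le_Gam a hg)⟩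
      rw [h, one_mul] at h2
      rw [← h2]
      have : (⟨g, GamO_le_Gam a hg⟩ : Gam a) * ⟨g⁻¹, (Gam a).inv_mem (GamO_le_Gam a hg)⟩ = 1 :=
        Subtype.ext (mul_inv_cancel g)
      rw [this]
      exact congrArg RegularWreathProduct.right (map_one F)
  let ρ : GamO a →* PGL(3, ℝ) := MonoidHom.mk' (fun γ => c ⟨γ, GamO_le_Gam a γ.2⟩) (by
    intro γ γ'
    have := hc ⟨γ, GamO_le_Gam a γ.2⟩ ⟨γ', GamO_le_Gam a γ'.2⟩
    rw [hsO γ γ.2] at this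
    exact this)
  classical
  let lab : PSL(2, ℝ) → Box := fun g =>
    if hg : g ∈ Gam a then (Ξ (s ⟨g, hg⟩)).map (c ⟨g, hg⟩) else Θ
  have hlab : ∀ g : Gam a, lab g = (Ξ (s g)).map (c g) := fun g => dif_pos g.2
  refine ⟨ρ, lab, ⟨?_, ?_⟩, ⟨?_, ?_, ?_, ?_⟩, ?_⟩
  · have h1 : ρ ⟨rotRstar a, Subgroup.subset_closure (by simp)⟩ = A 1 := by
      change (F ⟨rotRstar a, _⟩).left 1 = A 1
      rw [hFR]
    rw [h1, ← hΞ1]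
    exact hA 1
  · have h1 : ρ ⟨rotI * rotRstar a * rotI, Subgroup.subset_closure (by simp)⟩ = A (-1) := by
      change c (⟨rotI, rotI_mem_Gam a⟩ * ⟨rotRstar a, rotRstar_mem_Gam a⟩ *
          ⟨rotI, rotI_mem_Gam a⟩) = _
      rw [hc, hc]
      simp only [c, s]
      rw [hFI, hFR]
      simp
    rw [h1]
    refine isB_of_isA_newI hΘ ?_
    rw [← hΞ2]
    exact hA (-1)
  · have h1 := hlab 1
    have h2 : s 1 = 1 := congrArg RegularWreathProduct.right (map_one F)
    have h3 : c 1 = 1 := congrFun (congrArg RegularWreathProduct.left (map_one F)) 1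
    rw [h2, h3, hΞ1, Box.map_one] at h1
    exact Or.inl h1
  · intro g hg
    rw [hlab ⟨g, hg⟩]
    exact (hstd _).map _
  · intro g hg
    have h1 : (F ⟨rotI, rotI_mem_Gam a⟩).left = 1 := congrArg RegularWreathProduct.left hFI
    have h2 : s ⟨rotI, rotI_mem_Gam a⟩ = -1 := congrArg RegularWreathProduct.right hFI
    rw [hlab ⟨g, hg⟩, show g * rotI = (⟨g, hg⟩ * ⟨rotI, rotI_mem_Gam a⟩ : Gam a) from rfl, hlab,
      hc, hs, h1, h2, Pi.one_apply, mul_one, (hstd _).newI_map]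
    refine Box.SameMarked.map ?_ _
    rcases Int.units_eq_one_or (s ⟨g, hg⟩) with h | h
    · rw [h, one_mul, hΞ1, hΞ2]
      exact Or.inl rfl
    · rw [h, neg_mul_neg, one_mul, hΞ1, hΞ2, hΘ.newI_newI]
      exact (Box.sameMarked_j Θ).symm
  · intro g hg
    have h1 : (F ⟨rotRstar a, rotRstar_mem_Gam a⟩).left = A :=
      congrArg RegularWreathProduct.left hFR
    have h2 : s ⟨rotRstar a, rotRstar_mem_Gam a⟩ = 1 := congrArg RegularWreathProduct.right hFR
    rw [hlab ⟨g, hg⟩, show g * rotRstar a = (⟨g, hg⟩ * ⟨rotRstar a, rotRstar_mem_Gam a⟩ : Gam a)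
      from rfl, hlab, hc, hs, h1, h2, mul_one, (hstd _).newTau1_map,
      ((hstd _).newTau1 lam).newI_map,
      ← Box.map_map]
    refine Box.SameMarked.map ?_ _
    rw [(hA _).1]
    exact Box.sameMarked_j _
  · intro γ g hg
    rw [show (γ : PSL(2, ℝ)) * g = (⟨γ, GamO_le_Gam a γ.2⟩ * ⟨g, hg⟩ : Gam a) from rfl, hlab,
      hs, hc, hsO γ γ.2, one_mul, ← Box.map_map]
    change ((Ξ (s ⟨g, hg⟩)).map (c ⟨g, hg⟩)).map _ = (lab (⟨g, hg⟩ : Gam a)).map _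
    rw [hlab]
    rfl

theorem representation_unique {a : ℝ} {lam : ℝ × ℝ} {Θ : Box} (hΘ : Θ.IsStandard)
    {ρ ρ' : GamO a →* PGL(3, ℝ)} (h : IsNewRepresentation a lam Θ ρ)
    (h' : IsNewRepresentation a lam Θ ρ') : ρ' = ρ := by
  have key : ∀ g (hg : g ∈ GamO a), ρ' ⟨g, hg⟩ = ρ ⟨g, hg⟩ := by
    intro g hg
    induction hg using Subgroup.closure_induction with
    | mem g hg =>
      rcases hg with rfl | rfl
      · exact hΘ.map_injective (h'.1.1.trans h.1.1.symm)
      · exact hΘ.map_injective (h'.2.1.trans h.2.1.symm)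
    | one => exact (map_one ρ').trans (map_one ρ).symm
    | mul g g' hg hg' ih ih' =>
      have h1 := map_mul ρ ⟨g, hg⟩ ⟨g', hg'⟩
      have h2 := map_mul ρ' ⟨g, hg⟩ ⟨g', hg'⟩
      rw [ih, ih', ← h1] at h2
      exact h2
    | inv g hg ih =>
      have h1 := map_inv ρ ⟨g, hg⟩
      have h2 := map_inv ρ' ⟨g, hg⟩
      rw [ih, ← h1] at h2
      exact h2
  ext1 γ
  exact key γ.1 γ.2

/-! ### Labelings of the leaves -/

theorem eq_of_e0_map_eq {a : ℝ} (ha : 0 < a) {g g' : PSL(2, ℝ)} (hg : g ∈ Gam a)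
    (hg' : g' ∈ Gam a) (h : e0.map g = e0.map g') : g = g' := by
  have h2 : g • ((0 : ℝ) : OnePoint ℝ) = g' • ((0 : ℝ) : OnePoint ℝ) := congrArg Geodesic.head h
  refine inv_mul_eq_one.1 (eq_one_of_smul_zero ha ((Gam a).mul_mem ((Gam a).inv_mem hg) hg') ?_)
  rw [mul_smul, ← h2, inv_smul_smul]

theorem e0_map_one : e0.map 1 = e0 := by
  apply Geodesic.ext <;> exact one_smul _ _

theorem IsLabelMap.exists_isLabeling {a : ℝ} (ha : 0 < a) {lam : ℝ × ℝ} {Θ : Box}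
    {lab : PSL(2, ℝ) → Box} (h : IsLabelMap a lam Θ lab) : ∃ L, IsLabeling a lam Θ L := by
  classical
  let L : Geodesic → Box := fun ℓ =>
    if hℓ : ∃ g ∈ Gam a, ℓ = e0.map g then lab hℓ.choose else Θ
  have hL : ∀ g ∈ Gam a, L (e0.map g) = lab g := by
    intro g hg
    have hex : ∃ g' ∈ Gam a, e0.map g = e0.map g' := ⟨g, hg, rfl⟩
    have h1 : L (e0.map g) = lab hex.choose := dif_pos hex
    exact h1.trans (congrArg lab (eq_of_e0_map_eq ha hg hex.choose_spec.1 hex.choose_spec.2).symm)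
  refine ⟨L, ?_, fun g hg => ?_, fun g hg => ?_⟩
  · rw [← e0_map_one, hL 1 (Gam a).one_mem]
    exact h.base
  · rw [hL _ ((Gam a).mul_mem hg (rotI_mem_Gam a)), hL g hg]
    exact h.stepI g hg
  · rw [hL _ ((Gam a).mul_mem hg (rotRstar_mem_Gam a)), hL g hg]
    exact h.stepR g hg

theorem Gam_induction {a : ℝ} (ha : 0 < a) {P : PSL(2, ℝ) → Prop} (h1 : P 1)
    (hI : ∀ g ∈ Gam a, P g → P (g * rotI)) (hR : ∀ g ∈ Gam a, P g → P (g * rotRstar a))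
    {g : PSL(2, ℝ)} (hg : g ∈ Gam a) : P g := by
  induction hg using Subgroup.closure_induction_right with
  | one => exact h1
  | mul_right x hx y hy ih =>
    rcases hy with rfl | rfl
    · exact hI x hx ih
    · exact hR x hx ih
  | mul_inv_cancel x hx y hy ih =>
    rcases hy with rfl | rfl
    · rw [rotI_inv]
      exact hI x hx ih
    · rw [inv_eq_of_mul_eq_one_left (rotRstar_cube ha), ← mul_assoc]
      exact hR _ ((Gam a).mul_mem hx (rotRstar_mem_Gam a)) (hR x hx ih)

theorem IsLabelMap.sameMarked {a : ℝ} (ha : 0 < a) {lam : ℝ × ℝ} {Θ : Box}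
    {lab : PSL(2, ℝ) → Box} (h : IsLabelMap a lam Θ lab) {L : Geodesic → Box}
    (hL : IsLabeling a lam Θ L) {g : PSL(2, ℝ)} (hg : g ∈ Gam a) :
    (L (e0.map g)).SameMarked (lab g) := by
  have hI : ∀ x ∈ Gam a, (L (e0.map x)).SameMarked (lab x) →
      (L (e0.map (x * rotI))).SameMarked (lab (x * rotI)) := fun x hx ih =>
    ((hL.stepI x hx).trans ((h.isStandard x hx).sameMarked_newI lam ih)).trans (h.stepI x hx).symm
  have hR : ∀ x ∈ Gam a, (L (e0.map x)).SameMarked (lab x) →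
      (L (e0.map (x * rotRstar a))).SameMarked (lab (x * rotRstar a)) := fun x hx ih =>
    ((hL.stepR x hx).trans (((h.isStandard x hx).newTau1 lam).sameMarked_newI lam
      ((h.isStandard x hx).sameMarked_newTau1 lam ih))).trans (h.stepR x hx).symm
  exact Gam_induction ha (P := fun x => (L (e0.map x)).SameMarked (lab x))
    ((e0_map_one ▸ hL.base).trans h.base.symm) hI hR hg

/-! ### Matrices of labels -/

/-- The columns of `X` are, up to the involution `j`, an adapted basis of the box `Ψ`, whose
parameters are those of the original box, rotated. -/
def IsFrame (p : Param) (Ψ : Box) (X : GL (Fin 3) ℝ) : Prop :=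
  ∃ n : ℕ, Ψ.SameMarked ((std (Param.rot^[n] p)).map (cls X))

theorem iterate_rot_succ (n : ℕ) (p : Param) :
    (Param.rot^[n] p).rot = Param.rot^[n + 1] p := (Function.iterate_succ_apply' _ _ _).symm

/-- The frames of the label of `g R_* I` and `g R_*² I`. -/
theorem IsLabelMap.sameMarked_gam {a : ℝ} {lam : ℝ × ℝ} {Θ : Box} {lab : PSL(2, ℝ) → Box}
    (h : IsLabelMap a lam Θ lab) {g : PSL(2, ℝ)} (hg : g ∈ Gam a) {X : GL (Fin 3) ℝ} {q : Param}
    (hX : (lab g).SameMarked ((std q).map (cls X))) :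
    (lab (g * gam a true)).SameMarked ((std q.rot).map (cls (X * (matK q * sigmaMatrix lam)))) ∧
      (lab (g * gam a false)).SameMarked
        ((std q.rot.rot.rot).map (cls (X * (matL q.rot.rot * sigmaMatrix lam)))) := by
  have hR := rotRstar_mem_Gam a
  have hgR := (Gam a).mul_mem hg hR
  have s1 : ((std q).map (cls X)).IsStandard := ⟨_, _, rfl⟩
  -- the label of `x R_* I` is `τ₁^λ` applied to the label of `x`
  have key : ∀ x ∈ Gam a, ∀ Ψ : Box, Ψ.IsStandard → (lab x).SameMarked Ψ →
      (lab (x * rotRstar a * rotI)).SameMarked (Ψ.newTau1 lam) := by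
    intro x hx Ψ hΨ hxΨ
    have h1 := (h.stepR x hx).trans
      ((hΨ.newTau1 lam).sameMarked_newI lam (hΨ.sameMarked_newTau1 lam hxΨ))
    have h2 := (h.stepI _ ((Gam a).mul_mem hx hR)).trans
      (((hΨ.newTau1 lam).newI lam).sameMarked_newI lam h1)
    rw [(hΨ.newTau1 lam).newI_newI] at h2
    exact h2.trans (Box.sameMarked_j _)
  constructor
  · have h1 := key g hg _ s1 hX
    rw [std_map_newTau1, mul_assoc, ← cls_mul, ← cls_mul] at h1
    simpa only [gam, syllable, if_true, mul_assoc] using h1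
  · have h1 := (h.stepR g hg).trans
      ((s1.newTau1 lam).sameMarked_newI lam (s1.sameMarked_newTau1 lam hX))
    rw [std_map_rho] at h1
    have h2 := key _ hgR _ ⟨_, _, rfl⟩ h1
    have h3 : cls (matK q) * cls matN * cls (matK q.rot.rot) = cls (matL q.rot.rot) := by
      have h4 := KNJ_sq_N q
      calc cls (matK q) * cls matN * cls (matK q.rot.rot)
          = cls (matK q) * cls matN * cls matJ * (cls (matK q) * cls matJ) := by
            rw [K_rot_rot]; simp only [mul_assoc]
        _ = cls (matK q) * cls matN * cls matJ * (cls (matK q) * cls matN * cls matJ) *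
              cls matN * cls matJ := by
            have : cls matN * cls matJ * cls matN = 1 := by
              rw [← J_comm_N, mul_assoc, N_mul_N, J_mul_J]
            simp only [mul_assoc]
            rw [← mul_assoc (cls matN) (cls matJ) (cls matN * cls matJ),
              ← mul_assoc _ (cls matN) (cls matJ),
              this, one_mul]
        _ = cls (matL q.rot.rot) := by
            rw [← pow_two, h4, mul_assoc, J_mul_J, mul_one]
    rw [std_map_newTau1, mul_assoc (cls X), mul_assoc (cls X), h3, mul_assoc, ← cls_mul,
      ← cls_mul] at h2
    simpa only [gam, syllable, Bool.false_eq_true, if_false, mul_assoc] using h2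

/-! ### Contraction along the leaves -/

theorem L_rot_rot (p : Param) : cls (matL p.rot.rot) = cls matJ * cls (matL p) * cls matJ := by
  rw [← cls_mul, ← cls_mul]
  refine cls_eq_of_eq_smul 1 one_ne_zero ?_
  rw [Units.val_mul, Units.val_mul, coe_matJ, coe_matL, coe_matL, one_smul]
  ext i k
  fin_cases i <;> fin_cases k <;> simp [Matrix.mul_apply, Fin.sum_univ_three] <;> ring

theorem IsFrame.convexInterior_eq {p : Param} {Ψ : Box} {X : GL (Fin 3) ℝ} (h : IsFrame p Ψ X) :
    Ψ.convexInterior = projCone (facets X) := by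
  obtain ⟨n, hn⟩ := h
  rw [hn.convexInterior_eq, convexInterior_std_map]

theorem IsFrame.dualDomain_eq {p : Param} {Ψ : Box} {X : GL (Fin 3) ℝ} (h : IsFrame p Ψ X) :
    dualDomain Ψ.convexInterior = projCone (vertices X) := by
  rw [h.convexInterior_eq, dualDomain_facets]

theorem IsFrame.dualDomain_subset {p : Param} {Ψ : Box} {X : GL (Fin 3) ℝ} (h : IsFrame p Ψ X) :
    dualDomain Ψ.convexInterior ⊆ Ψ.dual.convexInterior := by
  rw [h.dualDomain_eq]
  obtain ⟨n, hn⟩ := h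
  rw [hn.dual_convexInterior_eq]
  exact projCone_vertices_subset_dual X _

theorem IsFrame.of_sameMarked {p : Param} {Ψ Ψ' : Box} {X : GL (Fin 3) ℝ} (h : IsFrame p Ψ X)
    (h' : Ψ'.SameMarked Ψ) : IsFrame p Ψ' X := by
  obtain ⟨n, hn⟩ := h
  exact ⟨n, h'.trans hn⟩

theorem IsFrame.newI {p : Param} {Ψ : Box} {X : GL (Fin 3) ℝ} (h : IsFrame p Ψ X) (lam : ℝ × ℝ) :
    IsFrame p (Ψ.newI lam) (X * matN * sigmaMatrix lam) := by
  obtain ⟨n, hn⟩ := h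
  refine ⟨n + 1, ?_⟩
  have := hn.newI lam
  rwa [std_map_newI, iterate_rot_succ, ← cls_mul, ← cls_mul] at this

theorem IsFrame.newTau1 {p : Param} {Ψ : Box} {X : GL (Fin 3) ℝ} (h : IsFrame p Ψ X)
    (lam : ℝ × ℝ) : ∃ Y, IsFrame p (Ψ.newTau1 lam) Y := by
  obtain ⟨n, hn⟩ := h
  have := hn.newTau1 lam
  rw [std_map_newTau1, iterate_rot_succ, ← cls_mul, ← cls_mul] at this
  exact ⟨_, n + 1, this⟩

theorem IsFrame.mul_matJ {p : Param} {Ψ : Box} {X : GL (Fin 3) ℝ} (h : IsFrame p Ψ X) :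
    IsFrame p Ψ (X * matJ) := by
  obtain ⟨n, hn⟩ := h
  refine ⟨n + 2, ?_⟩
  have := hn.trans (Box.sameMarked_j _).symm
  rwa [std_map_j, iterate_rot_succ, iterate_rot_succ, ← cls_mul] at this

theorem IsFrame.congr {p : Param} {Ψ : Box} {X Y : GL (Fin 3) ℝ} (h : IsFrame p Ψ X)
    (hXY : cls Y = cls X) : IsFrame p Ψ Y := by
  obtain ⟨n, hn⟩ := h
  exact ⟨n, by rwa [hXY]⟩

theorem IsLabelMap.exists_isFrame {a : ℝ} (ha : 0 < a) {lam : ℝ × ℝ} {g₀ : PGL(3, ℝ)} {p : Param}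
    {lab : PSL(2, ℝ) → Box} (h : IsLabelMap a lam ((std p).map g₀) lab) {g : PSL(2, ℝ)}
    (hg : g ∈ Gam a) : ∃ X, IsFrame p (lab g) X := by
  refine Gam_induction ha (P := fun g => ∃ X, IsFrame p (lab g) X) ?_ ?_ ?_ hg
  · obtain ⟨M, rfl⟩ := cls_surjective g₀
    exact ⟨M, 0, h.base⟩
  · rintro g hg ⟨X, hX⟩
    exact ⟨_, (hX.newI lam).of_sameMarked (h.stepI g hg)⟩
  · rintro g hg ⟨X, hX⟩
    obtain ⟨Y, hY⟩ := hX.newTau1 lam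
    exact ⟨_, (hY.newI lam).of_sameMarked (h.stepR g hg)⟩

/-- The interior of the standard box in the frame `Y` is contained in the one in the frame `X`,
with the given bounds for the coefficients of facets and vertices. -/
def Nested (m M : ℝ) (X Y : GL (Fin 3) ℝ) : Prop :=
  Refines m M (facets X) (facets Y) ∧ Refines m M (vertices Y) (vertices X)

/-- Uniform bounds for the contraction. -/
structure IsContractionBound (p : Param) (lam : ℝ × ℝ) (m M : ℝ) : Prop where
  pos : 0 < m
  lt : m < M
  contracts : ∀ n : ℕ, ContractsWith m M (matK (Param.rot^[n] p) * sigmaMatrix lam) ∧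
    ContractsWith m M (matL (Param.rot^[n] p).rot.rot * sigmaMatrix lam)

section Frames

variable {a : ℝ} {lam : ℝ × ℝ} {Θ : Box} {p : Param} {lab : PSL(2, ℝ) → Box} {m M : ℝ}

/-- Going to a leaf further to the left is a contraction. -/
theorem IsContractionBound.exists_nested (hb : IsContractionBound p lam m M)
    (h : IsLabelMap a lam Θ lab) {g : PSL(2, ℝ)} (hg : g ∈ Gam a) (k : Bool) {X : GL (Fin 3) ℝ}
    (hX : IsFrame p (lab g) X) : ∃ Y, IsFrame p (lab (g * gam a k)) Y ∧ Nested m M X Y := by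
  obtain ⟨n, hn⟩ := hX
  obtain ⟨h1, h2⟩ := h.sameMarked_gam hg hn
  cases k
  · refine ⟨_, ⟨n + 3, ?_⟩, (hb.contracts n).2 X⟩
    rwa [← iterate_rot_succ, ← iterate_rot_succ, ← iterate_rot_succ]
  · refine ⟨_, ⟨n + 1, ?_⟩, (hb.contracts n).1 X⟩
    rwa [iterate_rot_succ] at h1

/-- The converse of `IsContractionBound.exists_nested`: the frame of the label of the leaf to the
left is given. -/
theorem IsContractionBound.exists_nested' (hb : IsContractionBound p lam m M)
    (h : IsLabelMap a lam Θ lab) {g : PSL(2, ℝ)} (hg : g ∈ Gam a) (k : Bool) {X Y : GL (Fin 3) ℝ}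
    (hX : IsFrame p (lab g) X) (hY : IsFrame p (lab (g * gam a k)) Y) :
    ∃ Z, IsFrame p (lab g) Z ∧ Nested m M Z Y := by
  obtain ⟨n, hn⟩ := hX
  obtain ⟨n', hn'⟩ := hY
  -- the step matrices of the two frames `X` and `X J` of the same label
  obtain ⟨G, G', hG, hG', hGG', hXG⟩ : ∃ G G' : GL (Fin 3) ℝ, ContractsWith m M G ∧
      ContractsWith m M G' ∧ cls G' = cls matJ * cls G * cls matJ ∧
      ∃ q, (lab (g * gam a k)).SameMarked ((std q).map (cls (X * G))) := by
    obtain ⟨h1, h2⟩ := h.sameMarked_gam hg hn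
    have e : Param.rot^[n + 2] p = (Param.rot^[n] p).rot.rot := by
      rw [iterate_rot_succ, iterate_rot_succ]
    have hc := hb.contracts n
    have hc' := hb.contracts (n + 2)
    rw [e] at hc'
    cases k
    · refine ⟨_, _, hc.2, hc'.2, ?_, _, h2⟩
      rw [cls_mul, cls_mul, L_rot_rot, mul_assoc _ (cls matJ), J_comm_sigma]
      simp only [mul_assoc]
    · refine ⟨_, _, hc.1, hc'.1, ?_, _, h1⟩
      rw [cls_mul, cls_mul, K_rot_rot, mul_assoc _ (cls matJ), J_comm_sigma]
      simp only [mul_assoc]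
  obtain ⟨q, hq⟩ := hXG
  have hfr : IsFrame p (lab g) X := ⟨n, hn⟩
  rcases hn'.symm.trans hq with heq | heq
  · have h1 := eq_of_std_map_eq heq
    refine ⟨Y * G⁻¹, hfr.congr ?_, ?_⟩
    · rw [cls_mul, h1, cls_mul, cls_inv, mul_inv_cancel_right]
    · simpa only [Nested, inv_mul_cancel_right] using hG (Y * G⁻¹)
  · rw [std_map_j] at heq
    have h1 := eq_of_std_map_eq heq
    refine ⟨Y * G'⁻¹, hfr.mul_matJ.congr ?_, ?_⟩
    · rw [cls_mul, h1, cls_mul, cls_inv, mul_inv_eq_iff_eq_mul, hGG', cls_mul]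
      have e : cls X * cls matJ * (cls matJ * cls G * cls matJ) =
        cls X * (cls matJ * cls matJ) * cls G * cls matJ := by simp only [mul_assoc]
      rw [e, J_mul_J, mul_one]
    · simpa only [Nested, inv_mul_cancel_right] using hG' (Y * G'⁻¹)

end Frames

theorem dualDomain_anti {D D' : Set Plane} (h : D ⊆ D') : dualDomain D' ⊆ dualDomain D :=
  fun _ hX x hx => hX x (closure_mono h hx)

section Expansion

variable {a : ℝ} {lam : ℝ × ℝ} {g₀ : PGL(3, ℝ)} {p : Param} {lab : PSL(2, ℝ) → Box} {m M : ℝ}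

theorem Nested.subset (hm : 0 < m) {X Y : GL (Fin 3) ℝ} (h : Nested m M X Y) :
    projCone (facets Y) ⊆ projCone (facets X) :=
  subset_closure.trans (h.1.closure_subset hm (isProper_facets Y))

theorem IsContractionBound.subset (ha : 0 < a) (hb : IsContractionBound p lam m M)
    (h : IsLabelMap a lam ((std p).map g₀) lab) {g : PSL(2, ℝ)} (hg : g ∈ Gam a) (k : Bool) :
    (lab (g * gam a k)).convexInterior ⊆ (lab g).convexInterior := by
  obtain ⟨X, hX⟩ := h.exists_isFrame ha hg
  obtain ⟨Y, hY, hXY⟩ := hb.exists_nested h hg k hX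
  rw [hX.convexInterior_eq, hY.convexInterior_eq]
  exact hXY.subset hb.pos

theorem IsContractionBound.expandsInto (ha : 0 < a) (hb : IsContractionBound p lam m M)
    (h : IsLabelMap a lam ((std p).map g₀) lab) {g : PSL(2, ℝ)} (hg : g ∈ Gam a) (k : Bool)
    (l : List Bool) :
    ExpandsInto (1 / (1 - (m / M) ^ 2))
        (lab (g * word rotI (rotRstar a) (k :: l))).convexInterior (lab g).convexInterior ∧
      ExpandsInto (1 / (1 - (m / M) ^ 2)) (dualDomain (lab g).convexInterior)
        (dualDomain (lab (g * word rotI (rotRstar a) (k :: l))).convexInterior) := by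
  have hstep : ∀ g ∈ Gam a, ∀ k,
      ExpandsInto (1 / (1 - (m / M) ^ 2)) (lab (g * gam a k)).convexInterior
        (lab g).convexInterior ∧
      ExpandsInto (1 / (1 - (m / M) ^ 2)) (dualDomain (lab g).convexInterior)
        (dualDomain (lab (g * gam a k)).convexInterior) := by
    intro g hg k
    obtain ⟨X, hX⟩ := h.exists_isFrame ha hg
    obtain ⟨Y, hY, hXY⟩ := hb.exists_nested h hg k hX
    rw [hX.dualDomain_eq, hY.dualDomain_eq, hX.convexInterior_eq, hY.convexInterior_eq]
    exact ⟨hXY.1.expandsInto hb.pos hb.lt (isProper_facets X) (isProper_facets Y),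
      hXY.2.expandsInto hb.pos hb.lt (isProper_vertices Y) (isProper_vertices X)⟩
  have hC := one_div_one_sub_sq_gt_one hb.pos hb.lt
  induction l generalizing g k with
  | nil =>
    have : word rotI (rotRstar a) [k] = gam a k := by simp [word]
    rw [this]
    exact hstep g hg k
  | cons k' l ih =>
    have : g * word rotI (rotRstar a) (k :: k' :: l) =
        g * gam a k * word rotI (rotRstar a) (k' :: l) := by simp [word, mul_assoc]
    rw [this]
    obtain ⟨h1, h2⟩ := hstep g hg k
    obtain ⟨h3, h4⟩ := ih ((Gam a).mul_mem hg (gam_mem_Gam a k)) k'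
    exact ⟨h3.trans hC h1, h2.trans hC h4⟩

end Expansion

/-! ### The limit maps -/

/-- A family of sets indexed by `Γ` which decreases along the leaves to the left, and shrinks to a
point along nested sequences of leaves. -/
structure IsShrinking (a : ℝ) (E : PSL(2, ℝ) → Set Plane) : Prop where
  anti : ∀ g ∈ Gam a, ∀ k, E (g * gam a k) ⊆ E g
  chain : ∀ ξ w, IsChain a ξ w → ∃ x, ⋂ n, E (w n) = {x} ∧
    ∀ O : Set Plane, IsOpen O → x ∈ O → ∃ n, E (w n) ⊆ O

theorem IsShrinking.word_subset {a : ℝ} {E : PSL(2, ℝ) → Set Plane} (hE : IsShrinking a E)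
    {g : PSL(2, ℝ)} (hg : g ∈ Gam a) (l : List Bool) : E (g * word rotI (rotRstar a) l) ⊆ E g := by
  induction l generalizing g with
  | nil => simp [word]
  | cons k l ih =>
    have : g * word rotI (rotRstar a) (k :: l) = g * gam a k * word rotI (rotRstar a) l := by
      simp [word, mul_assoc]
    rw [this]
    exact (ih ((Gam a).mul_mem hg (gam_mem_Gam a k))).trans (hE.anti g hg k)

theorem IsShrinking.subset_of_le {a : ℝ} {E : PSL(2, ℝ) → Set Plane} (hE : IsShrinking a E)
    {ξ : OnePoint ℝ} {w : ℕ → PSL(2, ℝ)} (hw : IsChain a ξ w) {m n : ℕ} (h : m ≤ n) :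
    E (w n) ⊆ E (w m) := by
  induction n, h using Nat.le_induction with
  | base => exact subset_rfl
  | succ n _ ih =>
    obtain ⟨k, hk⟩ := hw.step n
    rw [hk]
    exact (hE.anti _ (hw.mem n) k).trans ih

/-- A shrinking family defines a map on the limit set. -/
structure IsLimitMap (a : ℝ) (E : PSL(2, ℝ) → Set Plane) (φ : limitSet (GamO a) → Plane) :
    Prop where
  mem : ∀ ξ : limitSet (GamO a), ∀ g ∈ Gam a, g⁻¹ • (ξ : OnePoint ℝ) ∈ posArc → φ ξ ∈ E g
  iInter_eq : ∀ (ξ : limitSet (GamO a)) w, IsChain a ξ w → ⋂ n, E (w n) = {φ ξ}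
  nhds : ∀ (ξ : limitSet (GamO a)) w, IsChain a ξ w → ∀ O : Set Plane, IsOpen O → φ ξ ∈ O →
    ∃ n, E (w n) ⊆ O

theorem mem_limitSet_Gam {a : ℝ} (ξ : limitSet (GamO a)) : (ξ : OnePoint ℝ) ∈ limitSet (Gam a) :=
  limitSet_GamO a ▸ ξ.2

theorem IsShrinking.exists_isLimitMap {a : ℝ} (ha : 0 < a) {E : PSL(2, ℝ) → Set Plane}
    (hE : IsShrinking a E) : ∃ φ, IsLimitMap a E φ := by
  choose w hw using fun ξ : limitSet (GamO a) => exists_isChain ha (mem_limitSet_Gam ξ)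
  choose φ hφ hφ' using fun ξ => hE.chain _ _ (hw ξ)
  have hmem : ∀ ξ : limitSet (GamO a), ∀ g ∈ Gam a, g⁻¹ • (ξ : OnePoint ℝ) ∈ posArc →
      φ ξ ∈ E g := by
    intro ξ g hg h
    obtain ⟨N, l, hN⟩ := (hw ξ).exists_eq_mul_word ha (mem_limitSet_Gam ξ) hg h
    have h1 : φ ξ ∈ ⋂ n, E (w ξ n) := by rw [hφ]; rfl
    have h2 := Set.mem_iInter.1 h1 N
    rw [hN] at h2
    exact hE.word_subset hg l h2
  have hch : ∀ (ξ : limitSet (GamO a)) w, IsChain a ξ w → ⋂ n, E (w n) = {φ ξ} ∧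
      ∀ O : Set Plane, IsOpen O → φ ξ ∈ O → ∃ n, E (w n) ⊆ O := by
    intro ξ w hw
    obtain ⟨x, hx, hx'⟩ := hE.chain _ _ hw
    have h1 : φ ξ ∈ ⋂ n, E (w n) := Set.mem_iInter.2 fun n => hmem ξ _ (hw.mem n) (hw.left n)
    rw [hx, Set.mem_singleton_iff] at h1
    rw [h1]
    exact ⟨hx, hx'⟩
  exact ⟨φ, hmem, fun ξ w hw => (hch ξ w hw).1, fun ξ w hw => (hch ξ w hw).2⟩

section LimitMap

variable {a : ℝ} {E : PSL(2, ℝ) → Set Plane} {φ : limitSet (GamO a) → Plane}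

theorem IsLimitMap.continuous (ha : 0 < a) (hφ : IsLimitMap a E φ) : Continuous φ := by
  rw [continuous_iff_continuousAt]
  intro ξ
  obtain ⟨w, hw⟩ := exists_isChain ha (mem_limitSet_Gam ξ)
  intro s hs
  obtain ⟨O, hOs, hO, hξO⟩ := mem_nhds_iff.1 hs
  obtain ⟨n, hn⟩ := hφ.nhds ξ w hw O hO hξO
  have h1 : {ζ : limitSet (GamO a) | (w n)⁻¹ • (ζ : OnePoint ℝ) ∈ posArc} ∈ _root_.nhds ξ :=
    ((isOpen_smul_posArc (w n)).preimage continuous_subtype_val).mem_nhds (hw.left n)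
  refine Filter.mem_map.2 (Filter.mem_of_superset h1 fun ζ hζ => ?_)
  exact hOs (hn (hφ.mem ζ _ (hw.mem n) hζ))

theorem IsLimitMap.equivariant (ha : 0 < a) (hφ : IsLimitMap a E φ) {γ : PSL(2, ℝ)}
    (hγ : γ ∈ Gam a) {T : Plane → Plane} (hT : ∀ g ∈ Gam a, ∀ x ∈ E g, T x ∈ E (γ * g))
    (ξ : limitSet (GamO a)) (h : γ • (ξ : OnePoint ℝ) ∈ limitSet (GamO a)) :
    φ ⟨_, h⟩ = T (φ ξ) := by
  obtain ⟨w, hw⟩ := exists_isChain ha (mem_limitSet_Gam ξ)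
  have hw' : IsChain a (γ • (ξ : OnePoint ℝ)) fun n => γ * w n := by
    refine ⟨fun n => (Gam a).mul_mem hγ (hw.mem n), fun n => ?_, fun n => ?_⟩
    · obtain ⟨k, hk⟩ := hw.step n
      exact ⟨k, by rw [hk, mul_assoc]⟩
    · rw [_root_.mul_inv_rev, mul_smul, inv_smul_smul]
      exact hw.left n
  have h1 := hφ.iInter_eq ⟨_, h⟩ _ hw'
  have h2 : T (φ ξ) ∈ ⋂ n, E (γ * w n) :=
    Set.mem_iInter.2 fun n => hT _ (hw.mem n) _ (hφ.mem ξ _ (hw.mem n) (hw.left n))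
  rw [h1] at h2
  exact h2.symm

/-- The limit point is determined by the leaves separating it from another limit point. -/
theorem IsLimitMap.forall_mem_iff (ha : 0 < a) (hφ : IsLimitMap a E φ)
    {ξ ζ : limitSet (GamO a)} (hne : (ζ : OnePoint ℝ) ≠ ξ) {x : Plane} :
    (∀ g ∈ Gam a, g⁻¹ • (ξ : OnePoint ℝ) ∈ posArc → (g * rotI)⁻¹ • (ζ : OnePoint ℝ) ∈ posArc →
      x ∈ E g) ↔ x = φ ξ := by
  constructor
  · intro h
    obtain ⟨w, hw⟩ := exists_isChain ha (mem_limitSet_Gam ξ)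
    obtain ⟨N, hN⟩ := hw.exists_notMem ha hne
    have h1 := hφ.iInter_eq ξ _ (hw.tail N)
    have h2 : x ∈ ⋂ n, E (w (N + n)) := Set.mem_iInter.2 fun n =>
      h _ (hw.mem _) (hw.left _)
        ((inv_smul_mem_posArc_or ha (mem_limitSet_Gam ζ) (hw.mem _)).resolve_left (hN n))
    rw [h1] at h2
    exact h2
  · rintro rfl g hg h -
    exact hφ.mem ξ g hg h

end LimitMap

theorem exists_sequence {α : Type*} {P : ℕ → α → Prop} {R : α → α → Prop} (h0 : ∃ x, P 0 x)
    (hs : ∀ n x, P n x → ∃ y, P (n + 1) y ∧ R x y) :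
    ∃ f : ℕ → α, ∀ n, P n (f n) ∧ R (f n) (f (n + 1)) := by
  choose! s hs hs' using hs
  obtain ⟨x, hx⟩ := h0
  let f : ℕ → α := fun n => Nat.rec x (fun n y => s n y) n
  have hf : ∀ n, P n (f n) := by
    intro n
    induction n with
    | zero => exact hx
    | succ n ih => exact hs n _ ih
  exact ⟨f, fun n => ⟨hf n, hs' n _ (hf n)⟩⟩

section Shrinking

variable {a : ℝ} {lam : ℝ × ℝ} {g₀ : PGL(3, ℝ)} {p : Param} {lab : PSL(2, ℝ) → Box} {m M : ℝ}

/-- The interiors of the labels shrink to points. -/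
theorem IsContractionBound.isShrinking (ha : 0 < a) (hb : IsContractionBound p lam m M)
    (h : IsLabelMap a lam ((std p).map g₀) lab) :
    IsShrinking a fun g => (lab g).convexInterior := by
  refine ⟨fun g hg k => hb.subset ha h hg k, fun ξ w hw => ?_⟩
  obtain ⟨X, hX⟩ := exists_sequence (P := fun n X => IsFrame p (lab (w n)) X) (R := Nested m M)
    (h.exists_isFrame ha (hw.mem 0)) (fun n X hX => by
      obtain ⟨k, hk⟩ := hw.step n
      rw [hk]
      exact hb.exists_nested h (hw.mem n) k hX)
  have he : ∀ n, (lab (w n)).convexInterior = projCone (facets (X n)) := fun n =>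
    (hX n).1.convexInterior_eq
  simp only [he]
  obtain ⟨x, hx⟩ := exists_iInter_projCone_eq hb.pos hb.lt (fun n => isProper_facets (X n))
    (fun n => (hX n).2.1)
  exact ⟨x, hx, fun O hO hxO => exists_projCone_subset hb.pos (fun n => isProper_facets (X n))
    (fun n => (hX n).2.1) hx hO hxO⟩

/-- The domains dual to the interiors of the labels shrink to points along the leaves with the
reversed orientation. -/
theorem IsContractionBound.isShrinking_dual (ha : 0 < a) (hb : IsContractionBound p lam m M)
    (h : IsLabelMap a lam ((std p).map g₀) lab) :
    IsShrinking a fun g => dualDomain (lab (g * rotI)).convexInterior := by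
  have hstep : ∀ (g : PSL(2, ℝ)) (k : Bool), g * rotI = g * gam a k * rotI * gam a (!k) := by
    intro g k
    rw [mul_assoc g, mul_assoc g, gam_mul_rotI_mul_gam ha]
  have hI := rotI_mem_Gam a
  refine ⟨fun g hg k => ?_, fun ξ w hw => ?_⟩
  · refine dualDomain_anti ?_
    rw [hstep g k]
    exact hb.subset ha h ((Gam a).mul_mem ((Gam a).mul_mem hg (gam_mem_Gam a k)) hI) _
  · obtain ⟨X, hX⟩ := exists_sequence (P := fun n X => IsFrame p (lab (w n * rotI)) X)
      (R := fun X Y => Nested m M Y X)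
      (h.exists_isFrame ha ((Gam a).mul_mem (hw.mem 0) hI)) (fun n X hX => by
        obtain ⟨k, hk⟩ := hw.step n
        have hmem := (Gam a).mul_mem (hw.mem (n + 1)) hI
        obtain ⟨Y, hY⟩ := h.exists_isFrame ha hmem
        rw [hstep (w n) k, ← hk] at hX
        exact hb.exists_nested' h hmem _ hY hX)
    have he : ∀ n, dualDomain (lab (w n * rotI)).convexInterior = projCone (vertices (X n)) :=
      fun n => (hX n).1.dualDomain_eq
    simp only [he]
    obtain ⟨x, hx⟩ := exists_iInter_projCone_eq hb.pos hb.lt (fun n => isProper_vertices (X n))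
      (fun n => (hX n).2.2)
    exact ⟨x, hx, fun O hO hxO => exists_projCone_subset hb.pos (fun n => isProper_vertices (X n))
      (fun n => (hX n).2.2) hx hO hxO⟩

end Shrinking

/-! ### Incidence and equivariance -/

/-- Each box contains a point lying on a line which is dual to the opposite box `i^λ Θ`. -/
theorem exists_incident {lam : ℝ × ℝ} (hlam : lam ∈ interior region) (X : GL (Fin 3) ℝ) :
    ∃ x ∈ projCone (facets X), ∃ Y ∈ projCone (vertices (X * matN * sigmaMatrix lam)),
      Incident x Y := by
  obtain ⟨hs, h1, h2⟩ := pos_of_mem_interior_region hlam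
  have hrel := exp_mul_cosh_relation lam
  have p1 := mul_pos (Real.exp_pos (-lam.2)) (Real.cosh_pos lam.1)
  have p2 := mul_pos (Real.exp_pos lam.2) (Real.cosh_pos lam.1)
  set G := X * matN * sigmaMatrix lam with hG
  set s := Real.sinh lam.1 with hs_def
  set A := Real.exp (-lam.2) * Real.cosh lam.1 with hA_def
  set B := Real.exp lam.2 * Real.cosh lam.1 with hB_def
  -- `G` maps `z` to the centre of the box, `u` is positive on the vertices, and `u` annihilates `z`
  have hz : ![0, B - s, s - A] ≠ 0 := vec_ne_zero (Or.inr (Or.inl (by linarith)))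
  have hu : ![0, A - s, B - s] ≠ 0 := vec_ne_zero (Or.inr (Or.inl (by linarith)))
  have hGz : G.1 *ᵥ ![0, B - s, s - A] = X.1 *ᵥ ![0, 1, 1] := by
    rw [hG, Units.val_mul, Units.val_mul, ← Matrix.mulVec_mulVec, ← Matrix.mulVec_mulVec,
      coe_matN, coe_sigmaMatrix, mulVec_vec, mulVec_vec]
    congr 1
    ext i
    fin_cases i <;> simp <;> linarith
  refine ⟨cls G • Projectivization.mk ℝ _ hz, ⟨_, ?_, (isLift_mk hz).map G⟩,
    mapLine (cls G) (Projectivization.mk ℝ _ hu), mem_projCone_vertices.2 ⟨_, ?_, isLift_mk hu⟩,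
    incident_map _ _ _ (((isLift_mk hz).incident_iff (isLift_mk hu)).2 ?_)⟩
  · rw [hGz]
    simp only [facets_dotProduct]
    rw [forall_facet (P := fun x => 0 < x)]
    simp
  · rw [forall_vertex (P := fun x => 0 < x)]
    simp
    constructor <;> linarith
  · simp [dotProduct, Fin.sum_univ_three]
    ring

theorem mapLine_mem_dualDomain {Ψ : Box} (hΨ : Ψ.IsStandard) (g : PGL(3, ℝ)) {X : Plane}
    (hX : X ∈ dualDomain Ψ.convexInterior) :
    mapLine g X ∈ dualDomain (Ψ.map g).convexInterior := by
  obtain ⟨h, p, rfl⟩ := hΨ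
  obtain ⟨M, rfl⟩ := cls_surjective h
  obtain ⟨K, rfl⟩ := cls_surjective g
  obtain ⟨Y, rfl⟩ : ∃ Y, mapLine (cls M) Y = X :=
    ⟨(contragredient (cls M))⁻¹ • X, smul_inv_smul _ _⟩
  rw [convexInterior_std_map, dualDomain_facets, mem_projCone_vertices] at hX
  rw [Box.map_map, ← cls_mul, convexInterior_std_map, dualDomain_facets, ← mapLine_mul, ← cls_mul,
    mem_projCone_vertices]
  exact hX

theorem IsContractionBound.incident {a : ℝ} {lam : ℝ × ℝ} {g₀ : PGL(3, ℝ)} {p : Param}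
    {lab : PSL(2, ℝ) → Box} {m M : ℝ} (ha : 0 < a) (hlam : lam ∈ interior region)
    (hb : IsContractionBound p lam m M) (h : IsLabelMap a lam ((std p).map g₀) lab)
    {φ φ' : limitSet (GamO a) → Plane}
    (hφ : IsLimitMap a (fun g => (lab g).convexInterior) φ)
    (hφ' : IsLimitMap a (fun g => dualDomain (lab (g * rotI)).convexInterior) φ')
    (ξ : limitSet (GamO a)) : Incident (φ ξ) (φ' ξ) := by
  by_contra hinc
  obtain ⟨O, O', hO, hO', hx, hX, hno⟩ := exists_open_not_incident hinc
  obtain ⟨w, hw⟩ := exists_isChain ha (mem_limitSet_Gam ξ)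
  obtain ⟨n, hn⟩ := hφ.nhds ξ w hw O hO hx
  obtain ⟨n', hn'⟩ := hφ'.nhds ξ w hw O' hO' hX
  have h1 := ((hb.isShrinking ha h).subset_of_le hw (le_max_left n n')).trans hn
  have h2 := ((hb.isShrinking_dual ha h).subset_of_le hw (le_max_right n n')).trans hn'
  set N := max n n'
  obtain ⟨X, hX⟩ := h.exists_isFrame ha (hw.mem N)
  have hX' := (hX.newI lam).of_sameMarked (h.stepI _ (hw.mem N))
  obtain ⟨x, hx, Y, hY, hxY⟩ := exists_incident hlam X
  rw [← hX.convexInterior_eq] at hx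
  rw [← hX'.dualDomain_eq] at hY
  exact hno x (h1 hx) Y (h2 hY) hxY

theorem crosses_map_iff {c : Geodesic} {g : PSL(2, ℝ)} : c.Crosses (e0.map g) ↔
    (g * rotI)⁻¹ • c.tail ∈ posArc ∧ g⁻¹ • c.head ∈ posArc :=
  and_congr mem_rightSide_map mem_leftSide_map

theorem mem_iInter_crosses {a : ℝ} {c : Geodesic} {E : Geodesic → Set Plane} {x : Plane} :
    x ∈ (⋂ ℓ ∈ {ℓ ∈ leaves a | c.Crosses ℓ}, E ℓ) ↔
      ∀ g ∈ Gam a, (g * rotI)⁻¹ • c.tail ∈ posArc → g⁻¹ • c.head ∈ posArc → x ∈ E (e0.map g) := by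
  simp only [Set.mem_iInter]
  constructor
  · intro h g hg h1 h2
    exact h _ ⟨⟨g, hg, rfl⟩, crosses_map_iff.2 ⟨h1, h2⟩⟩
  · rintro h _ ⟨⟨g, hg, rfl⟩, hc⟩
    exact h g hg (crosses_map_iff.1 hc).1 (crosses_map_iff.1 hc).2

end PappusAnosov

theorem mainTheorem5 (a : ℝ) (ha : 0 < a) (lam : ℝ × ℝ) (hlam : lam ∈ interior region)
    (Θ : Box) (hΘ : Θ.IsOvermarked) (hconv : Θ.IsConvex) :
    ∃ ρ : GamO a →* Matrix.ProjGenLinGroup (Fin 3) ℝ,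
      IsNewRepresentation a lam Θ ρ ∧ (∀ ρ', IsNewRepresentation a lam Θ ρ' → ρ' = ρ) ∧
      (∃ L : Geodesic → Box, IsLabeling a lam Θ L) ∧
      ∃ Φ : limitSet (GamO a) → Flag,
        Continuous Φ ∧
        (∀ (γ : GamO a) (ξ : limitSet (GamO a)), ∃ h : (γ : PSL(2, ℝ)) • (ξ : OnePoint ℝ) ∈
          limitSet (GamO a), Φ ⟨_, h⟩ = mapFlag (ρ γ) (Φ ξ)) ∧
        ∀ L : Geodesic → Box, IsLabeling a lam Θ L →
          (∀ ℓ ∈ leaves a, (L ℓ).IsOvermarked ∧ (L ℓ).IsConvex) ∧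
          (∃ C : ℝ, 1 < C ∧ ∀ ℓ ∈ leaves a, ∀ ℓ' ∈ leaves a, ℓ'.leftSide ⊂ ℓ.leftSide →
            ExpandsInto C (L ℓ').convexInterior (L ℓ).convexInterior ∧
            ExpandsInto C (dualDomain (L ℓ).convexInterior)
              (dualDomain (L ℓ').convexInterior)) ∧
          ∀ (c : Geodesic) (hc₁ : c.tail ∈ limitSet (GamO a))
            (hc₂ : c.head ∈ limitSet (GamO a)),
            (⋂ ℓ ∈ {ℓ ∈ leaves a | c.Crosses ℓ}, (L ℓ).convexInterior) =
              {(Φ ⟨c.head, hc₂⟩).1.1} ∧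
            (⋂ ℓ ∈ {ℓ ∈ leaves a | c.Crosses ℓ}, dualDomain (L ℓ).convexInterior) =
              {(Φ ⟨c.tail, hc₁⟩).1.2} ∧
            (Φ ⟨c.tail, hc₁⟩).1.2 ∈
              ⋂ ℓ ∈ {ℓ ∈ leaves a | c.Crosses ℓ}, (L ℓ).dual.convexInterior := by
  obtain ⟨g₀, p, rfl⟩ := exists_eq_std_map hΘ hconv
  have hstd : ((std p).map g₀).IsStandard := ⟨g₀, p, rfl⟩
  obtain ⟨ρ, lab, hρ, hlab, hequi⟩ := exists_representation ha lam hstd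
  obtain ⟨m, M, hm, hM, hcon⟩ := exists_uniform_contraction p hlam
  have hb : IsContractionBound p lam m M := ⟨hm, hM, hcon⟩
  obtain ⟨φ, hφ⟩ := (hb.isShrinking ha hlab).exists_isLimitMap ha
  obtain ⟨φ', hφ'⟩ := (hb.isShrinking_dual ha hlab).exists_isLimitMap ha
  have hI := rotI_mem_Gam a
  refine ⟨ρ, hρ, fun ρ' h => representation_unique hstd hρ h, hlab.exists_isLabeling ha,
    fun ξ => ⟨(φ ξ, φ' ξ), hb.incident ha hlam hlab hφ hφ' ξ⟩,
    ((hφ.continuous ha).prodMk (hφ'.continuous ha)).subtype_mk _, fun γ ξ => ?_, fun L hL => ?_⟩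
  · have hγ := GamO_le_Gam a γ.2
    have hmem := smul_mem_limitSet γ.2 ξ.2
    refine ⟨hmem, Subtype.ext (Prod.ext ?_ ?_)⟩
    · refine hφ.equivariant ha hγ (T := fun x => ρ γ • x) (fun g hg x hx => ?_) ξ hmem
      rw [hequi γ g hg]
      exact (mem_convexInterior_map _ _).2 hx
    · refine hφ'.equivariant ha hγ (T := mapLine (ρ γ)) (fun g hg X hX => ?_) ξ hmem
      have hgI := (Gam a).mul_mem hg hI
      change _ ∈ dualDomain (lab (γ * g * rotI)).convexInterior
      rw [mul_assoc, hequi γ _ hgI]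
      exact mapLine_mem_dualDomain (hlab.isStandard _ hgI) _ hX
  · have hsame := fun {g : PSL(2, ℝ)} (hg : g ∈ Gam a) => hlab.sameMarked ha hL hg
    refine ⟨?_, ⟨_, one_div_one_sub_sq_gt_one hm hM, ?_⟩, fun c hc₁ hc₂ => ?_⟩
    · rintro _ ⟨g, hg, rfl⟩
      have := Box.IsStandard.of_sameMarked (hsame hg) (hlab.isStandard g hg)
      exact ⟨this.isOvermarked, this.isConvex⟩
    · rintro _ ⟨g, hg, rfl⟩ _ ⟨g', hg', rfl⟩ hlt
      rw [(hsame hg).convexInterior_eq, (hsame hg').convexInterior_eq]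
      obtain ⟨k, l, rfl⟩ := exists_word_of_leftSide_ssubset ha hg hg' hlt
      exact hb.expandsInto ha hlab hg k l
    · have hD : ∀ g ∈ Gam a, (L (e0.map g)).convexInterior = (lab g).convexInterior :=
        fun g hg => (hsame hg).convexInterior_eq
      -- lines are attached to the leaves with the reversed orientation
      have hrev : ∀ g, g * rotI * rotI = g := fun g => by rw [mul_assoc, rotI_mul_rotI, mul_one]
      have hdual : ∀ X, (∀ g ∈ Gam a, (g * rotI)⁻¹ • c.tail ∈ posArc → g⁻¹ • c.head ∈ posArc →
          X ∈ dualDomain (L (e0.map g)).convexInterior) ↔ X = φ' ⟨c.tail, hc₁⟩ := by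
        intro X
        rw [← hφ'.forall_mem_iff ha (ζ := ⟨c.head, hc₂⟩) c.ne.symm]
        constructor
        · intro h g hg h1 h2
          have hgI := (Gam a).mul_mem hg hI
          change X ∈ dualDomain (lab (g * rotI)).convexInterior
          rw [← hD _ hgI]
          exact h _ hgI (by rw [hrev]; exact h1) h2
        · intro h g hg h1 h2
          have hgI := (Gam a).mul_mem hg hI
          have := h _ hgI h1 (by rw [hrev]; exact h2)
          rw [hD g hg]
          simpa only [hrev] using this
      refine ⟨?_, ?_, ?_⟩
      · ext x
        rw [mem_iInter_crosses, Set.mem_singleton_iff,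
          ← hφ.forall_mem_iff ha (ξ := ⟨c.head, hc₂⟩) (ζ := ⟨c.tail, hc₁⟩) c.ne]
        constructor
        · intro h g hg h1 h2
          rw [← hD g hg]
          exact h g hg h2 h1
        · intro h g hg h1 h2
          rw [hD g hg]
          exact h g hg h2 h1
      · ext X
        rw [mem_iInter_crosses, Set.mem_singleton_iff]
        exact hdual X
      · rw [mem_iInter_crosses]
        intro g hg h1 h2
        have h3 := (hdual _).2 rfl g hg h1 h2
        obtain ⟨X, hX⟩ := hlab.exists_isFrame ha hg
        exact (hX.of_sameMarked (hsame hg)).dualDomain_subset h3
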